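/- **Notation.** For $x\in\mathbb R^N$, $B_t(x)$ is the ball of centre $x$ and radius $t$. For a nonnegative Radon measure $\mu$ on $\mathbb R^N$, $0<R<\infty$, $\eta\ge 0$, set $$\mathbf W^R_{\alpha,p}[\mu](x)=\int_0^R\Big(\frac{\mu(B_t(x))}{t^{N-\alpha p}}\Big)^{\frac1{p-1}}\frac{dt}{t},\qquad \mathbf M^\eta_{\alpha p,R}[\mu](x)=\sup_{0<t\le R}\frac{\mu(B_t(x))}{t^{N-\alpha p}h_\eta(t)},$$ where $h_\eta(t)=(-\ln t)^{-\eta}$ for $0<t\le \frac12$ and $h_\eta(t)=(\ln 2)^{-\eta}$ for $t\ge\frac12$. A nonnegative locally integrable function is identified with the measure having it as density; in particular $1$ stands for Lebesgue measure. Put $H_l(r)=e^r-\sum_{j=0}^{l-1}\frac{r^j}{j!}$, $P_{l,a,\beta}(r)=H_l(ar^\beta)$ (and $P_{l,a,\beta}(\infty)=\infty$), $c_p=\max\{1,4^{\frac{2-p}{p-1}}\}$, $Q_p(s)=\sum_{q\ge l}\frac{s^{\beta q/(p-1)}}{q^{\beta q/(p-1)}\,q!}$ if $p\ne2$, $Q_2(s)=H_l(s^\beta)$,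 and $Q_p^*(r)=\sup_{s\ge0}(rs-Q_p(s))$. Let $\mathbf G_{\alpha p}$ be the Bessel kernel of order $\alpha p$, i.e. the inverse Fourier transform of $(1+|\xi|^2)^{-\alpha p/2}$, normalized by $\int \mathbf G_{\alpha p}(x)e^{-ix\cdot\xi}dx=(1+|\xi|^2)^{-\alpha p/2}$, and $$\mathrm{Cap}_{\mathbf G_{\alpha p},Q_p^*}(E)=\inf\Big\{\int_{\mathbb R^N}Q_p^*(g)\,dx:\ \mathbf G_{\alpha p}*g\ge\chi_E,\ g\ge0,\ Q_p^*(g)\in L^1(\mathbb R^N)\Big\}\qquad(\inf\emptyset=\infty).$$ Functions below are Lebesgue measurable with values in $[0,\infty]$. **Theorem.** Let $\alpha>0$, $p>1$, $a>0$, $0<R<\infty$, $l\in\mathbb N^*$, $\beta\ge1$ with $l\beta>p-1$ and $0<\alpha p<N$. Put $\eta=\frac{(p-1)(\beta-1)}{\beta}$. For a nonnegative measurable $f$ and a nonnegative Radon measure $\mu$ on $\mathbb R^N$ consider the equation $$u=\mathbf W^R_{\alpha,p}[P_{l,a,\beta}(u)+\mu]+f\quad\text{in }\mathbb R^N. \tag{1}$$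 There is a constant $C>0$ depending only on $N,\alpha,p,l,a,\beta,R$ such that the following hold. (i) (Existence.) For every $\varepsilon>0$ there is $M>0$ depending only on $N,\alpha,p,l,a,\beta,\varepsilon,R$ such that, if $\mu_1:=P_{l,a+\varepsilon,\beta}(f)$ is locally integrable in $\mathbb R^N$ and $$\|\mathbf M^\eta_{\alpha p,R}[\mu]\|_{L^\infty(\mathbb R^N)}\le M,\qquad \|\mathbf M^\eta_{\alpha p,R}[\mu_1]\|_{L^\infty(\mathbb R^N)}\le M, \tag{2}$$ then (1) has a nonnegative solution $u$ with $P_{l,a,\beta}(u)\in L^1_{loc}(\mathbb R^N)$ and $$u\le F:=2c_p\mathbf W^R_{\alpha,p}[\omega_1]+2c_p\mathbf W^R_{\alpha,p}[\omega_2]+f,\qquad P_{l,a,\beta}(F)\in L^1_{loc}(\mathbb R^N),$$ where $\omega_1=M\|\mathbf M^\eta_{\alpha p,R}[1]\|^{-1}_{L^\infty(\mathbb R^N)}+\mu$ and $\omega_2=M\|\mathbf M^\eta_{\alpha p,R}[1]\|^{-1}_{L^\infty(\mathbb R^N)}+\mu_1$. (ii) (Converse.) Whether or not (2) holds, if (1)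 has a nonnegative solution $u$ with $P_{l,a,\beta}(u)\in L^1_{loc}(\mathbb R^N)$, then $$\int_EP_{l,a,\beta}(u)\,dx+\int_EP_{l,a,\beta}(f)\,dx+\mu(E)\le C\,\mathrm{Cap}_{\mathbf G_{\alpha p},Q_p^*}(E)\qquad\text{for all Borel }E\subset\mathbb R^N.$$ If moreover $f,\mu$ satisfy the hypotheses of (i) for some $\varepsilon>0$, with the corresponding $M$, then also $$\int_EP_{l,a,\beta}(u)\,dx+\int_EP_{l,a+\varepsilon,\beta}(f)\,dx+\mu(E)\le C\,\mathrm{Cap}_{\mathbf G_{\alpha p},Q_p^*}(E)\qquad\text{for all Borel }E\subset\mathbb R^N.$$ -/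

import Mathlib

open MeasureTheory Set
open scoped ENNReal NNReal

noncomputable section

namespace WolffEq

/-- Euclidean space `ℝ^N`. -/
abbrev E (N : ℕ) : Type := EuclideanSpace ℝ (Fin N)

/-- The truncated Wolff potential
`W^T_{α,s}[μ](x) = ∫_0^T (μ(B_t(x)) / t^(N - α s))^(1/(s-1)) dt/t`, with values in `[0,∞]`. -/
def wolff {N : ℕ} (α s T : ℝ) (μ : Measure (E N)) (x : E N) : ℝ≥0∞ :=
  ∫⁻ t in Ioc (0 : ℝ) T,
    (μ (Metric.ball x t) / ENNReal.ofReal (t ^ ((N : ℝ) - α * s))) ^ (1 / (s - 1))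
      / ENNReal.ofReal t

/-- The weight `h_η`: equal to `(-ln t)^(-η)` for `0 < t ≤ 1/2` and to `(ln 2)^(-η)` for
`t ≥ 1/2`. -/
def hWeight (η t : ℝ) : ℝ :=
  if t ≤ 1 / 2 then (-Real.log t) ^ (-η) else (Real.log 2) ^ (-η)

/-- The truncated `η`-fractional maximal potential
`M^η_{γ,T}[μ](x) = sup { μ(B_t(x)) / (t^(N - γ) h_η(t)) : 0 < t ≤ T }`. -/
def fracMax {N : ℕ} (η γ T : ℝ) (μ : Measure (E N)) (x : E N) : ℝ≥0∞ :=
  ⨆ t ∈ Ioc (0 : ℝ) T,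
    μ (Metric.ball x t) / ENNReal.ofReal (t ^ ((N : ℝ) - γ) * hWeight η t)

/-- The norm in `L^∞(ℝ^N)` (Lebesgue measure) of a `[0,∞]`-valued function. -/
def supNorm {N : ℕ} (g : E N → ℝ≥0∞) : ℝ≥0∞ := essSup g volume

/-- The truncated exponential `H_l(r) = e^r - ∑_{j<l} r^j / j!`. -/
def H (l : ℕ) (r : ℝ) : ℝ := Real.exp r - ∑ j ∈ Finset.range l, r ^ j / (j.factorial : ℝ)

/-- `P_{l,a,β}(r) = H_l(a r^β)` for `r ∈ [0,∞)`, and `P_{l,a,β}(∞) = ∞`. -/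
def P (l : ℕ) (a β : ℝ) (r : ℝ≥0∞) : ℝ≥0∞ :=
  if r = ⊤ then ⊤ else ENNReal.ofReal (H l (a * r.toReal ^ β))

/-- `Q_p(s) = ∑_{q ≥ l} s^(βq/(p-1)) / (q^(βq/(p-1)) q!)` if `p ≠ 2`, and `Q_2(s) = H_l(s^β)`. -/
def Q (l : ℕ) (β p : ℝ) (s : ℝ≥0) : ℝ≥0∞ :=
  if p = 2 then ENNReal.ofReal (H l ((s : ℝ) ^ β))
  else ∑' q : {q : ℕ // l ≤ q}, ENNReal.ofReal
    ((s : ℝ) ^ (β * (q : ℕ) / (p - 1)) /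
      (((q : ℕ) : ℝ) ^ (β * (q : ℕ) / (p - 1)) * ((q : ℕ).factorial : ℝ)))

/-- The complementary function `Q_p^*(r) = sup { r s - Q_p(s) : s ≥ 0 }`. The truncation of the
subtraction is harmless since `s = 0` contributes the value `0`. -/
def Qstar (l : ℕ) (β p : ℝ) (r : ℝ≥0∞) : ℝ≥0∞ := ⨆ s : ℝ≥0, (r * (s : ℝ≥0∞) - Q l β p s)

/-- The integrand of the heat-kernel representation of the Bessel kernel of order `σ`. -/
def besselIntegrand {N : ℕ} (σ t : ℝ) (x : E N) : ℝ :=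
  t ^ (σ / 2 - 1) * Real.exp (-t) *
    ((4 * Real.pi * t) ^ (-(N : ℝ) / 2) * Real.exp (-(1 / (4 * t)) * ‖x‖ ^ 2))

/-- The Bessel kernel of order `σ > 0`,
`G_σ(x) = Γ(σ/2)⁻¹ ∫_0^∞ t^(σ/2-1) e^(-t) (4πt)^(-N/2) e^(-|x|²/(4t)) dt`.
It is the inverse Fourier transform of `ξ ↦ (1+|ξ|²)^(-σ/2)`: see `integrable_besselKernel` and
`fourier_besselKernel`. -/
def besselKernel {N : ℕ} (σ : ℝ) (x : E N) : ℝ≥0∞ :=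
  ENNReal.ofReal (Real.Gamma (σ / 2))⁻¹ *
    ∫⁻ t in Ioi (0 : ℝ), ENNReal.ofReal (besselIntegrand σ t x)

/-- The Bessel potential `G_σ ∗ g` of a nonnegative function. -/
def besselPotential {N : ℕ} (σ : ℝ) (g : E N → ℝ≥0∞) (x : E N) : ℝ≥0∞ :=
  ∫⁻ y, besselKernel σ (x - y) * g y

/-- The Orlicz–Bessel capacity
`Cap_{G_σ,Ψ}(A) = inf { ∫ Ψ(g) dx : G_σ ∗ g ≥ χ_A, g ≥ 0, Ψ(g) ∈ L^1(ℝ^N) }`, equal to `∞` if there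
is no admissible `g`. -/
def besselCap {N : ℕ} (σ : ℝ) (Ψ : ℝ≥0∞ → ℝ≥0∞) (A : Set (E N)) : ℝ≥0∞ :=
  ⨅ (g : E N → ℝ≥0∞) (_ : AEMeasurable g volume)
    (_ : ∀ x, A.indicator (fun _ => (1 : ℝ≥0∞)) x ≤ besselPotential σ g x)
    (_ : ∫⁻ x, Ψ (g x) < ⊤), ∫⁻ x, Ψ (g x)

/-- Local integrability of a nonnegative, `[0,∞]`-valued function on `ℝ^N`. -/
def LocInt {N : ℕ} (g : E N → ℝ≥0∞) : Prop :=
  AEMeasurable g volume ∧ ∀ K : Set (E N), IsCompact K → ∫⁻ x in K, g x < ⊤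

/-- `u` is a nonnegative (Lebesgue measurable, `[0,∞]`-valued) solution of
`u = W^R_{α,p}[P_{l,a,β}(u) + μ] + f` in `ℝ^N`, with `P_{l,a,β}(u)` locally integrable. -/
structure IsSolution {N : ℕ} (α p a β R : ℝ) (l : ℕ) (μ : Measure (E N)) (f u : E N → ℝ≥0∞) :
    Prop where
  measurable : AEMeasurable u volume
  locInt : LocInt (fun x => P l a β (u x))
  eq : ∀ x, u x = wolff α p R (volume.withDensity (fun y => P l a β (u y)) + μ) x + f x

/-- `ω = M ‖M^η_{αp,R}[1]‖_∞⁻¹ + ν`, where the constant stands for the measure with this constant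
density. -/
def omega {N : ℕ} (η γ R M : ℝ) (ν : Measure (E N)) : Measure (E N) :=
  (ENNReal.ofReal M * (supNorm (fracMax η γ R (volume : Measure (E N))))⁻¹) •
    (volume : Measure (E N)) + ν

/-- The exponent `η = (p-1)(β-1)/β`. -/
def etaExp (p β : ℝ) : ℝ := (p - 1) * (β - 1) / β

/-- The constant `c_p = max(1, 4^((2-p)/(p-1)))`. -/
def cConst (p : ℝ) : ℝ := max 1 ((4 : ℝ) ^ ((2 - p) / (p - 1)))

/-- `F = 2 c_p W^R_{α,p}[ω₁] + 2 c_p W^R_{α,p}[ω₂] + f`. -/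
def majorant {N : ℕ} (α p β R M : ℝ) (μ μ₁ : Measure (E N)) (f : E N → ℝ≥0∞) (x : E N) : ℝ≥0∞ :=
  ENNReal.ofReal (2 * cConst p) * wolff α p R (omega (etaExp p β) (α * p) R M μ) x +
    ENNReal.ofReal (2 * cConst p) * wolff α p R (omega (etaExp p β) (α * p) R M μ₁) x + f x

/-! The Bessel kernel is integrable with Fourier transform `(1+|ξ|²)^(-σ/2)`. -/

lemma besselIntegrand_nonneg {N : ℕ} {σ t : ℝ} (ht : 0 < t) (x : E N) :
    0 ≤ besselIntegrand σ t x := by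
  unfold besselIntegrand; positivity

lemma measurable_besselIntegrand {N : ℕ} (σ : ℝ) :
    Measurable (fun z : ℝ × E N => besselIntegrand σ z.1 z.2) := by
  unfold besselIntegrand; fun_prop

lemma integral_heat {N : ℕ} {σ t : ℝ} (ht : 0 < t) (ξ : E N) :
    ∫ x : E N, (besselIntegrand σ t x : ℂ) * Complex.exp (-Complex.I * (inner ℝ ξ x : ℝ)) =
      ((Real.exp (-(1 + ‖ξ‖ ^ 2) * t) * t ^ (σ / 2 - 1) : ℝ) : ℂ) := by
  have hb : 0 < (((1 / (4 * t) : ℝ)) : ℂ).re := by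
    rw [Complex.ofReal_re]; positivity
  have key := GaussianFourier.integral_cexp_neg_mul_sq_norm_add hb (-Complex.I) ξ
  have hpi := Real.pi_pos
  have e : ∀ x : E N, (besselIntegrand σ t x : ℂ) * Complex.exp (-Complex.I * (inner ℝ ξ x : ℝ)) =
      ((t ^ (σ / 2 - 1) * Real.exp (-t) * (4 * Real.pi * t) ^ (-(N : ℝ) / 2) : ℝ) : ℂ) *
      Complex.exp (-((1 / (4 * t) : ℝ) : ℂ) * ‖x‖ ^ 2 + -Complex.I * (inner ℝ ξ x : ℝ)) := by
    intro x
    unfold besselIntegrand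
    rw [Complex.exp_add]
    push_cast
    ring
  simp_rw [e]
  rw [integral_const_mul, key]
  have h1 : ((Real.pi : ℂ) / ((1 / (4 * t) : ℝ) : ℂ)) ^ ((Module.finrank ℝ (E N) : ℂ) / 2) =
      (((4 * Real.pi * t) ^ ((N : ℝ) / 2) : ℝ) : ℂ) := by
    rw [Complex.ofReal_cpow (by positivity)]
    congr 1
    · push_cast; field_simp
    · simp
  have h2 : (-Complex.I) ^ 2 * (‖ξ‖ : ℂ) ^ 2 / (4 * ((1 / (4 * t) : ℝ) : ℂ)) =
      ((-(‖ξ‖ ^ 2) * t : ℝ) : ℂ) := by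
    have : (t : ℂ) ≠ 0 := by exact_mod_cast ht.ne'
    push_cast
    rw [neg_sq, Complex.I_sq]
    field_simp
  rw [h1, h2, ← Complex.ofReal_exp, ← Complex.ofReal_mul, ← Complex.ofReal_mul]
  congr 1
  have h3 : (4 * Real.pi * t) ^ (-(N : ℝ) / 2) * (4 * Real.pi * t) ^ ((N : ℝ) / 2) = 1 := by
    rw [← Real.rpow_add (by positivity)]
    ring_nf
    simp
  have h4 : Real.exp (-(1 + ‖ξ‖ ^ 2) * t) = Real.exp (-t) * Real.exp (-(‖ξ‖ ^ 2) * t) := by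
    rw [← Real.exp_add]; ring_nf
  rw [h4]
  linear_combination (t ^ (σ / 2 - 1) * Real.exp (-t) * Real.exp (-(‖ξ‖ ^ 2) * t)) * h3

lemma integrable_heat {N : ℕ} {σ t : ℝ} (ht : 0 < t) :
    Integrable (fun x : E N => besselIntegrand σ t x) := by
  have hb : 0 < (((1 / (4 * t) : ℝ)) : ℂ).re := by
    rw [Complex.ofReal_re]; positivity
  have := (GaussianFourier.integrable_cexp_neg_mul_sq_norm_add hb 0 (0 : E N)).re
  unfold besselIntegrand
  refine (Integrable.const_mul ?_ _).const_mul _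
  refine this.congr (Filter.Eventually.of_forall fun x => ?_)
  have h : -((1 / (4 * t) : ℝ) : ℂ) * (‖x‖ : ℂ) ^ 2 + 0 * ((inner ℝ (0 : E N) x : ℝ) : ℂ) =
      ((-(1 / (4 * t)) * ‖x‖ ^ 2 : ℝ) : ℂ) := by
    push_cast; ring
  simp only [h, ← Complex.ofReal_exp]
  exact Complex.ofReal_re _

lemma integral_heat_real {N : ℕ} {σ t : ℝ} (ht : 0 < t) :
    ∫ x : E N, besselIntegrand σ t x = Real.exp (-t) * t ^ (σ / 2 - 1) := by
  have h := integral_heat (σ := σ) ht (0 : E N)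
  simp only [inner_zero_left, Complex.ofReal_zero, mul_zero, Complex.exp_zero, mul_one,
    norm_zero] at h
  rw [integral_complex_ofReal] at h
  have h' := Complex.ofReal_injective h
  rw [h']
  norm_num

lemma integrable_prod_bessel {N : ℕ} {σ : ℝ} (hσ : 0 < σ) :
    Integrable (fun z : ℝ × E N => besselIntegrand σ z.1 z.2)
      ((volume.restrict (Ioi (0 : ℝ))).prod volume) := by
  rw [integrable_prod_iff (measurable_besselIntegrand σ).aestronglyMeasurable]
  constructor
  · filter_upwards [ae_restrict_mem measurableSet_Ioi] with t ht
    exact integrable_heat ht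
  · have hG := Real.GammaIntegral_convergent (s := σ / 2) (by positivity)
    refine Integrable.congr hG ?_
    filter_upwards [ae_restrict_mem measurableSet_Ioi] with t ht
    rw [← integral_heat_real (N := N) ht]
    refine integral_congr_ae (Filter.Eventually.of_forall fun x => ?_)
    simp only [Real.norm_of_nonneg (besselIntegrand_nonneg ht x)]

lemma besselKernel_toReal {N : ℕ} {σ : ℝ} (hσ : 0 < σ) (x : E N) :
    (besselKernel σ x).toReal =
      (Real.Gamma (σ / 2))⁻¹ * ∫ t in Ioi (0 : ℝ), besselIntegrand σ t x := by
  have hΓ : 0 < Real.Gamma (σ / 2) := Real.Gamma_pos_of_pos (by positivity)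
  unfold besselKernel
  rw [ENNReal.toReal_mul, ENNReal.toReal_ofReal (by positivity)]
  congr 1
  rw [integral_eq_lintegral_of_nonneg_ae]
  · filter_upwards [ae_restrict_mem measurableSet_Ioi] with t ht
    exact besselIntegrand_nonneg ht x
  · exact ((measurable_besselIntegrand σ).comp
      (measurable_id.prodMk measurable_const)).aestronglyMeasurable

theorem integrable_besselKernel {N : ℕ} {σ : ℝ} (hσ : 0 < σ) :
    (∫⁻ x : E N, besselKernel σ x) < ⊤ ∧
      Integrable (fun x : E N => (besselKernel σ x).toReal) := by
  have hm : Measurable fun z : ℝ × E N => ENNReal.ofReal (besselIntegrand σ z.1 z.2) :=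
    (measurable_besselIntegrand σ).ennreal_ofReal
  constructor
  · unfold besselKernel
    rw [lintegral_const_mul' _ _ ENNReal.ofReal_ne_top]
    refine ENNReal.mul_lt_top ENNReal.ofReal_lt_top ?_
    rw [← lintegral_prod_symm (μ := volume.restrict (Ioi (0 : ℝ))) (ν := (volume : Measure (E N)))
      (fun z : ℝ × E N => ENNReal.ofReal (besselIntegrand σ z.1 z.2)) hm.aemeasurable]
    exact (integrable_prod_bessel hσ).lintegral_lt_top
  · simp_rw [besselKernel_toReal hσ]
    exact ((integrable_prod_bessel hσ).integral_prod_right).const_mul _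

theorem fourier_besselKernel {N : ℕ} {σ : ℝ} (hσ : 0 < σ) (ξ : E N) :
    ∫ x : E N, ((besselKernel σ x).toReal : ℂ) *
        Complex.exp (-Complex.I * (inner ℝ ξ x : ℝ)) =
      (((1 + ‖ξ‖ ^ 2) ^ (-σ / 2) : ℝ) : ℂ) := by
  have hΓ : 0 < Real.Gamma (σ / 2) := Real.Gamma_pos_of_pos (by positivity)
  have hint : Integrable (fun z : ℝ × E N => (besselIntegrand σ z.1 z.2 : ℂ) *
      Complex.exp (-Complex.I * (inner ℝ ξ z.2 : ℝ)))
      ((volume.restrict (Ioi (0 : ℝ))).prod volume) := by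
    refine (integrable_prod_bessel hσ).ofReal.mul_bdd (c := 1) ?_ ?_
    · exact (by fun_prop : Continuous fun z : ℝ × E N =>
        Complex.exp (-Complex.I * (inner ℝ ξ z.2 : ℝ))).aestronglyMeasurable
    · refine Filter.Eventually.of_forall fun z => ?_
      rw [Complex.norm_exp]
      simp
  have h1 : ∀ x : E N, ((besselKernel σ x).toReal : ℂ) *
        Complex.exp (-Complex.I * (inner ℝ ξ x : ℝ)) =
      ((Real.Gamma (σ / 2))⁻¹ : ℝ) * ∫ t in Ioi (0 : ℝ), (besselIntegrand σ t x : ℂ) *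
        Complex.exp (-Complex.I * (inner ℝ ξ x : ℝ)) := by
    intro x
    rw [besselKernel_toReal hσ, integral_mul_const, integral_complex_ofReal]
    push_cast
    ring
  simp_rw [h1]
  rw [integral_const_mul, ← integral_integral_swap hint]
  have h2 : ∫ t in Ioi (0 : ℝ), ∫ x : E N, (besselIntegrand σ t x : ℂ) *
        Complex.exp (-Complex.I * (inner ℝ ξ x : ℝ)) =
      ((∫ t in Ioi (0 : ℝ), t ^ (σ / 2 - 1) * Real.exp (-((1 + ‖ξ‖ ^ 2) * t)) : ℝ) : ℂ) := by
    rw [← integral_complex_ofReal]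
    refine setIntegral_congr_fun measurableSet_Ioi fun t ht => ?_
    rw [integral_heat ht, neg_mul, mul_comm]
  have hpos : 0 < 1 + ‖ξ‖ ^ 2 := by positivity
  rw [h2, Real.integral_rpow_mul_exp_neg_mul_Ioi (by positivity) hpos, ← Complex.ofReal_mul]
  congr 1
  rw [one_div, Real.inv_rpow hpos.le, neg_div, Real.rpow_neg hpos.le]
  field_simp

end WolffEq

end

/-!
Existence and capacitary estimates for Wolff potential equations with exponential nonlinearity.

*Existence.* If `ω(B_t(x)) ≤ t^(N-αp) h_η(t)` for `t ≤ R`, then the scales between `r` and `R`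
contribute at most a multiple of `(-log r)^(1/β)` to `W[ω]`, by the choice of `η`, while the scales
below `r` contribute at most a power of `r` in the mean. Chebyshev's inequality at the scales
`r = e^(-n)` shows that `exp(λ W[ω]^β)` is integrable over balls, uniformly in `ω`
(`exists_exp_wolff_le`). Since `P` vanishes to the order `lβ > p - 1` at zero, `W[P(K W[ω])]` is of
higher order in `M` than `W[ω]` when `ω` is built from data of size `M`, so that it is at most
`W[ω]` for small `M` (`exists_small_wolff_P_le`); the constant density in `ω` provides the lower
bound of `W[ω]`. Hence the majorant `F` is a supersolution, and the least fixed point of the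
monotone operator `v ↦ W[P(v) + μ] + f` is a solution below `F` (`exists_isSolution_of_supersolution`).

*Capacitary estimate.* For a solution `u`, the measure `ω = P(u) dx + μ` satisfies
`P(W[ω]) dx ≤ ω`. Let `ν` be the restriction of `ω` to a bounded part of a Borel set `A`. Pointwise,
`W[ν]` is at most `W[ω]` times the power `1/(p-1)` of the centred maximal function of `A` with
respect to `ω`, which is bounded on `L^κ(ω)` for `κ = lβ/(p-1) > 1` by the Besicovitch covering
theorem; hence `∫ P(W[ν]) ≤ C ν(A)` (`exists_lintegral_P_wolff_restrict_le`). A Wolff inequality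
turns this into an estimate of the `Q_p`-energy of the Bessel potential of `ν`: the Bessel kernel is
a truncated Riesz kernel up to an integrable tail, and the `L^m` norm of the dyadic Riesz potential
is bounded by that of `W[ν]^(p-1)` with a constant linear in `m`
(`exists_lintegral_tsum_ballTerm_rpow_le`), which the factor `q^(βq/(p-1))` in the coefficients of
`Q_p` compensates when the power series are compared term by term (`exists_qCoeff_mul_lintegral_le`,
`exists_lintegral_qSeries_le`). For `p = 2` there is no such factor, but the Riesz potential is
dominated by the Wolff potential pointwise. Finally, for `g` with `G * g ≥ 1` on `A`, Young's
inequality for `Q_p` and `Q_p^*` bounds a multiple of `ν(A) ≤ ∫ g (G * ν)` by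
`∫ Q_p^*(g) + ∫ Q_p(c δ G * ν)`, and the last term is absorbed for small `δ` because `Q_p` vanishes
to an order greater than one at zero (`exists_measure_le_besselCap`).

The estimate with `a + ε` follows by applying the previous one also to the solution with the measure
`μ₁ = P_{l,a+ε,β}(f) dx` as datum, which exists by the first part.
-/

namespace WolffEq

/-! ### The truncated exponentials as power series -/

lemma ofReal_H (l : ℕ) {r : ℝ} (hr : 0 ≤ r) :
    ENNReal.ofReal (H l r) =
      ∑' n : ℕ, ENNReal.ofReal r ^ (n + l) / ((n + l).factorial : ℝ≥0∞) := by
  have hs : Summable fun n : ℕ => r ^ n / (n.factorial : ℝ) := Real.summable_pow_div_factorial r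
  have h1 : H l r = ∑' n : ℕ, r ^ (n + l) / ((n + l).factorial : ℝ) := by
    have h2 := hs.sum_add_tsum_nat_add l
    have h3 : Real.exp r = ∑' n : ℕ, r ^ n / (n.factorial : ℝ) := by
      rw [Real.exp_eq_exp_ℝ, NormedSpace.exp_eq_tsum_div]
    unfold H
    rw [h3, ← h2]
    ring
  rw [h1, ENNReal.ofReal_tsum_of_nonneg (fun n => by positivity) ((summable_nat_add_iff l).2 hs)]
  refine tsum_congr fun n => ?_
  rw [ENNReal.ofReal_div_of_pos (by positivity), ENNReal.ofReal_pow hr, ENNReal.ofReal_natCast]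

lemma P_eq_tsum (l : ℕ) {a β : ℝ} (ha : 0 < a) (hβ : 0 < β) (r : ℝ≥0∞) :
    P l a β r = ∑' n : ℕ, ENNReal.ofReal a ^ (n + l) / ((n + l).factorial : ℝ≥0∞) *
      r ^ (β * ((n + l : ℕ) : ℝ)) := by
  unfold P
  split_ifs with h
  · subst h
    refine (top_unique ?_).symm
    refine le_trans ?_ (ENNReal.le_tsum 1)
    rw [ENNReal.top_rpow_of_pos (by push_cast; positivity), ENNReal.mul_top]
    refine (ENNReal.div_pos (pow_ne_zero _ (by simpa using ha)) (ENNReal.natCast_ne_top _)).ne'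
  · rw [ofReal_H l (by positivity)]
    refine tsum_congr fun n => ?_
    rw [ENNReal.ofReal_mul ha.le, mul_pow, ← ENNReal.ofReal_rpow_of_nonneg ENNReal.toReal_nonneg
      hβ.le, ENNReal.ofReal_toReal h, ← ENNReal.rpow_natCast (r ^ β), ← ENNReal.rpow_mul,
      ENNReal.mul_div_right_comm]

lemma P_mono (l : ℕ) {a β : ℝ} (ha : 0 < a) (hβ : 0 < β) : Monotone (P l a β) := by
  intro r s h
  rw [P_eq_tsum l ha hβ, P_eq_tsum l ha hβ]
  gcongr

lemma P_measurable (l : ℕ) {a β : ℝ} (ha : 0 < a) (hβ : 0 < β) : Measurable (P l a β) :=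
  (P_mono l ha hβ).measurable

lemma P_zero {l : ℕ} (hl : 1 ≤ l) {a β : ℝ} (ha : 0 < a) (hβ : 0 < β) : P l a β 0 = 0 := by
  rw [P_eq_tsum l ha hβ, ENNReal.tsum_eq_zero]
  intro n
  rw [ENNReal.zero_rpow_of_pos, mul_zero]
  have : (1 : ℝ) ≤ ((n + l : ℕ) : ℝ) := by exact_mod_cast by omega
  positivity

lemma P_const_mul (l : ℕ) {a β c : ℝ} (ha : 0 < a) (hβ : 0 < β) (hc : 0 < c) (r : ℝ≥0∞) :
    P l a β (ENNReal.ofReal c * r) = P l (a * c ^ β) β r := by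
  rw [P_eq_tsum l ha hβ, P_eq_tsum l (by positivity) hβ]
  refine tsum_congr fun n => ?_
  rw [ENNReal.mul_rpow_of_nonneg _ _ (by positivity), ENNReal.ofReal_mul ha.le, mul_pow,
    ENNReal.rpow_mul, ENNReal.ofReal_rpow_of_pos hc, ENNReal.rpow_natCast,
    ENNReal.mul_div_right_comm, mul_assoc]

/-- Lowering the coefficient gains the `l`-th power of the ratio, because the power series starts
at order `l`. -/
lemma P_le_pow_mul (l : ℕ) {b c β : ℝ} (hb : 0 < b) (hbc : b ≤ c) (hβ : 0 < β) (r : ℝ≥0∞) :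
    P l b β r ≤ ENNReal.ofReal (b / c) ^ l * P 0 c β r := by
  have hc : 0 < c := hb.trans_le hbc
  have h0 : P l c β r ≤ P 0 c β r := by
    rw [P_eq_tsum l hc hβ, P_eq_tsum 0 hc hβ]
    exact ENNReal.tsum_comp_le_tsum_of_injective (add_left_injective l)
      (fun n => ENNReal.ofReal c ^ (n + 0) / ((n + 0).factorial : ℝ≥0∞) *
      r ^ (β * ((n + 0 : ℕ) : ℝ)))
  refine le_trans ?_ (mul_le_mul_right h0 _)
  rw [P_eq_tsum l hb hβ, P_eq_tsum l hc hβ, ← ENNReal.tsum_mul_left]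
  refine ENNReal.tsum_le_tsum fun n => ?_
  rw [← mul_assoc, ← mul_div_assoc]
  gcongr
  have h1 : ENNReal.ofReal b = ENNReal.ofReal (b / c) * ENNReal.ofReal c := by
    rw [← ENNReal.ofReal_mul (by positivity)]; congr 1; field_simp
  calc ENNReal.ofReal b ^ (n + l)
      = ENNReal.ofReal (b / c) ^ (n + l) * ENNReal.ofReal c ^ (n + l) := by rw [h1, mul_pow]
    _ ≤ _ := by
      gcongr ?_ * _
      refine pow_le_pow_right_of_le_one' ?_ (by omega)
      rw [ENNReal.ofReal_le_one]
      exact (div_le_one hc).2 hbc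

lemma P_zero_rpow {lam β θ : ℝ} (hθ : 0 < θ) (r : ℝ≥0∞) :
    P 0 (lam * θ) β r = P 0 lam β r ^ θ := by
  unfold P
  split_ifs with h
  · rw [ENNReal.top_rpow_of_pos hθ]
  · simp only [H, Finset.range_zero, Finset.sum_empty, sub_zero]
    rw [ENNReal.ofReal_rpow_of_pos (Real.exp_pos _), ← Real.exp_mul]
    congr 2; ring

/-- The coefficient of `s^(βq/(p-1))` in the power series `Q_p`. -/
noncomputable def qCoeff (β p : ℝ) (q : ℕ) : ℝ≥0∞ :=
  if p = 2 then ((q.factorial : ℝ≥0∞))⁻¹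
  else (ENNReal.ofReal ((q : ℝ) ^ (β * q / (p - 1))) * (q.factorial : ℝ≥0∞))⁻¹

/-- The power series `Q_p`, as a function on `[0,∞]`. -/
noncomputable def qSeries (l : ℕ) (β p : ℝ) (s : ℝ≥0∞) : ℝ≥0∞ :=
  ∑' n : ℕ, qCoeff β p (n + l) * s ^ (β / (p - 1) * ((n + l : ℕ) : ℝ))

/-- The natural numbers `≥ l`, enumerated. -/
def natGeEquiv (l : ℕ) : ℕ ≃ {q : ℕ // l ≤ q} where
  toFun n := ⟨n + l, by omega⟩
  invFun q := q.1 - l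
  left_inv n := by simp
  right_inv q := by ext; simpa using Nat.sub_add_cancel q.2

lemma Q_eq_qSeries {l : ℕ} (hl : 1 ≤ l) {β p : ℝ} (hβ : 0 < β) (hp : 1 < p) (s : ℝ≥0) :
    Q l β p s = qSeries l β p s := by
  unfold Q qSeries
  split_ifs with h
  · subst h
    rw [ofReal_H l (by positivity)]
    refine tsum_congr fun n => ?_
    rw [← ENNReal.ofReal_rpow_of_nonneg s.coe_nonneg hβ.le, ENNReal.ofReal_coe_nnreal,
      ← ENNReal.rpow_natCast, ← ENNReal.rpow_mul, qCoeff, if_pos rfl, div_eq_mul_inv, mul_comm]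
    norm_num
  · rw [← (natGeEquiv l).tsum_eq]
    refine tsum_congr fun n => ?_
    have hq : 0 < ((n + l : ℕ) : ℝ) := by exact_mod_cast by omega
    have h0 : 0 < ((n + l : ℕ) : ℝ) ^ (β * ((n + l : ℕ) : ℝ) / (p - 1)) *
        ((n + l).factorial : ℝ) := by positivity
    simp only [natGeEquiv, Equiv.coe_fn_mk]
    rw [ENNReal.ofReal_div_of_pos h0, qCoeff, if_neg h, ENNReal.ofReal_mul (by positivity),
      ENNReal.ofReal_natCast, div_eq_mul_inv, mul_comm]
    congr 1
    rw [← ENNReal.ofReal_rpow_of_nonneg s.coe_nonneg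
      (div_nonneg (by positivity) (by linarith)), ENNReal.ofReal_coe_nnreal]
    congr 1
    ring

/-! ### Elementary properties of Wolff potentials -/

lemma measurable_measure_ball {N : ℕ} (μ : Measure (E N)) [SFinite μ] :
    Measurable fun z : E N × ℝ => μ (Metric.ball z.1 z.2) := by
  have hs : MeasurableSet {w : (E N × ℝ) × E N | dist w.2 w.1.1 < w.1.2} :=
    measurableSet_lt (by fun_prop) (by fun_prop)
  exact measurable_measure_prodMk_left hs

lemma measurable_measure_ball_left {N : ℕ} (μ : Measure (E N)) [SFinite μ] (t : ℝ) :
    Measurable fun y : E N => μ (Metric.ball y t) := by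
  have h : Measurable fun y : E N => (y, t) := by fun_prop
  have h' := (measurable_measure_ball μ).comp h
  simpa only [Function.comp_def] using h'

lemma measurable_wolff_integrand {N : ℕ} (α s : ℝ) (μ : Measure (E N)) [SFinite μ] :
    Measurable fun z : E N × ℝ =>
      (μ (Metric.ball z.1 z.2) / ENNReal.ofReal (z.2 ^ ((N : ℝ) - α * s))) ^ (1 / (s - 1))
      / ENNReal.ofReal z.2 := by
  have h := measurable_measure_ball μ
  have h2 : Measurable fun z : E N × ℝ => ENNReal.ofReal (z.2 ^ ((N : ℝ) - α * s)) := by fun_prop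
  have h3 : Measurable fun z : E N × ℝ => ENNReal.ofReal z.2 := by fun_prop
  exact ((h.div h2).pow_const _).div h3

lemma measurable_wolff_integrand_right {N : ℕ} (α s : ℝ) (μ : Measure (E N))
    (x : E N) : Measurable fun t : ℝ =>
      (μ (Metric.ball x t) / ENNReal.ofReal (t ^ ((N : ℝ) - α * s))) ^ (1 / (s - 1))
      / ENNReal.ofReal t := by
  have hm : Monotone fun t : ℝ => μ (Metric.ball x t) :=
    fun t₁ t₂ h => measure_mono (Metric.ball_subset_ball h)
  have h := hm.measurable
  have h2 : Measurable fun t : ℝ => ENNReal.ofReal (t ^ ((N : ℝ) - α * s)) := by fun_prop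
  have h3 : Measurable fun t : ℝ => ENNReal.ofReal t := by fun_prop
  exact ((h.div h2).pow_const _).div h3

lemma measurable_wolff {N : ℕ} (α s T : ℝ) (μ : Measure (E N)) [SFinite μ] :
    Measurable (wolff α s T μ) :=
  (measurable_wolff_integrand α s μ).lintegral_prod_right'

lemma wolff_mono {N : ℕ} {α s T : ℝ} (hs : 1 < s) {μ ν : Measure (E N)} (h : μ ≤ ν) (x : E N) :
    wolff α s T μ x ≤ wolff α s T ν x := by
  have : 0 ≤ 1 / (s - 1) := by rw [one_div_nonneg]; linarith
  unfold wolff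
  gcongr

lemma wolff_smul {N : ℕ} {α s T c : ℝ} (hs : 1 < s) (hc : 0 < c) (μ : Measure (E N)) (x : E N) :
    wolff α s T (ENNReal.ofReal c • μ) x =
      ENNReal.ofReal (c ^ (1 / (s - 1))) * wolff α s T μ x := by
  have h : 0 ≤ 1 / (s - 1) := by rw [one_div_nonneg]; linarith
  unfold wolff
  rw [← lintegral_const_mul' _ _ ENNReal.ofReal_ne_top]
  refine lintegral_congr fun t => ?_
  rw [Measure.smul_apply, smul_eq_mul, mul_div_assoc, ENNReal.mul_rpow_of_nonneg _ _ h,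
    ENNReal.ofReal_rpow_of_pos hc, mul_div_assoc]

/-- The constant `max(1, 2^((2-p)/(p-1)))` in the quasi-additivity of `μ ↦ W[μ]`; its square is
`cConst p`. -/
noncomputable def quasiAdd (p : ℝ) : ℝ := max 1 ((2 : ℝ) ^ ((2 - p) / (p - 1)))

lemma one_le_quasiAdd (p : ℝ) : 1 ≤ quasiAdd p := le_max_left _ _

lemma quasiAdd_sq (p : ℝ) : quasiAdd p ^ 2 = cConst p := by
  have h4 : (4 : ℝ) ^ ((2 - p) / (p - 1)) = ((2 : ℝ) ^ ((2 - p) / (p - 1))) ^ 2 := by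
    rw [show (4 : ℝ) = 2 ^ (2 : ℕ) by norm_num, ← Real.rpow_natCast, ← Real.rpow_mul (by norm_num),
      ← Real.rpow_natCast, ← Real.rpow_mul (by norm_num), mul_comm]
  have h2 : 0 < (2 : ℝ) ^ ((2 - p) / (p - 1)) := by positivity
  unfold quasiAdd cConst
  rw [h4]
  rcases le_total 1 ((2 : ℝ) ^ ((2 - p) / (p - 1))) with h | h
  · rw [max_eq_right h, max_eq_right (by nlinarith)]
  · rw [max_eq_left h, max_eq_left (by nlinarith)]; norm_num

lemma rpow_add_le_quasiAdd {p : ℝ} (hp : 1 < p) (x y : ℝ≥0∞) :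
    (x + y) ^ (1 / (p - 1)) ≤
      ENNReal.ofReal (quasiAdd p) * (x ^ (1 / (p - 1)) + y ^ (1 / (p - 1))) := by
  have hp' : 0 < p - 1 := by linarith
  rcases le_total 1 (1 / (p - 1)) with h | h
  · refine (ENNReal.rpow_add_le_mul_rpow_add_rpow x y h).trans ?_
    gcongr
    rw [← ENNReal.ofReal_ofNat 2, ENNReal.ofReal_rpow_of_pos (by norm_num)]
    apply ENNReal.ofReal_le_ofReal
    refine le_trans (le_of_eq ?_) (le_max_right _ _)
    congr 1; field_simp; ring
  · refine (ENNReal.rpow_add_le_add_rpow x y (by positivity) h).trans ?_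
    refine le_mul_of_one_le_left' ?_
    rw [ENNReal.one_le_ofReal]
    exact one_le_quasiAdd p

lemma wolff_add_le {N : ℕ} {α p T : ℝ} (hp : 1 < p) (μ ν : Measure (E N)) (x : E N) :
    wolff α p T (μ + ν) x ≤
      ENNReal.ofReal (quasiAdd p) * (wolff α p T μ x + wolff α p T ν x) := by
  have hm : Measurable fun t : ℝ =>
      (μ (Metric.ball x t) / ENNReal.ofReal (t ^ ((N : ℝ) - α * p))) ^ (1 / (p - 1))
      / ENNReal.ofReal t := measurable_wolff_integrand_right α p μ x
  unfold wolff
  rw [← lintegral_add_left hm, ← lintegral_const_mul' _ _ ENNReal.ofReal_ne_top]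
  refine lintegral_mono fun t => ?_
  rw [Measure.add_apply, ← ENNReal.add_div, ENNReal.add_div, ← mul_div_assoc]
  gcongr
  exact rpow_add_le_quasiAdd hp _ _

lemma lintegral_rpow_Ioc {γ r : ℝ} (hγ : 0 < γ) (hr : 0 ≤ r) :
    ∫⁻ t in Ioc 0 r, ENNReal.ofReal (t ^ (γ - 1)) = ENNReal.ofReal (r ^ γ / γ) := by
  have hi : IntervalIntegrable (fun t : ℝ => t ^ (γ - 1)) volume 0 r :=
    intervalIntegral.intervalIntegrable_rpow' (by linarith)
  rw [← ofReal_integral_eq_lintegral_ofReal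
    ((intervalIntegrable_iff_integrableOn_Ioc_of_le hr).1 hi), ← intervalIntegral.integral_of_le hr,
    integral_rpow (Or.inl (by linarith))]
  · rw [Real.zero_rpow (by linarith)]; congr 1; simp
  · filter_upwards [ae_restrict_mem measurableSet_Ioc] with t ht
    exact Real.rpow_nonneg ht.1.le _

/-! ### Maximal potentials are bounded everywhere by their essential supremum -/

lemma hWeight_pos (η : ℝ) {t : ℝ} (ht : 0 < t) : 0 < hWeight η t := by
  unfold hWeight
  split_ifs with h
  · refine Real.rpow_pos_of_pos ?_ _
    have := Real.log_neg ht (by linarith)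
    linarith
  · exact Real.rpow_pos_of_pos (Real.log_pos (by norm_num)) _

/-- The maximal potential is lower semicontinuous, so that an almost everywhere bound holds
everywhere. -/
lemma measure_ball_le_of_supNorm_le {N : ℕ} {η γ R : ℝ} {M : ℝ≥0∞} {μ : Measure (E N)}
    (h : supNorm (fracMax η γ R μ) ≤ M) (x : E N) {t : ℝ} (ht : t ∈ Ioc 0 R) :
    μ (Metric.ball x t) ≤ M * ENNReal.ofReal (t ^ ((N : ℝ) - γ) * hWeight η t) := by
  have hpos : 0 < t ^ ((N : ℝ) - γ) * hWeight η t :=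
    mul_pos (Real.rpow_pos_of_pos ht.1 _) (hWeight_pos η ht.1)
  by_contra! hlt
  have hU : Metric.ball x t = ⋃ n : ℕ, Metric.ball x (t - 1 / (n + 1)) := by
    ext y
    simp only [Metric.mem_ball, mem_iUnion]
    constructor
    · intro hy
      obtain ⟨n, hn⟩ := exists_nat_one_div_lt (sub_pos.2 hy)
      exact ⟨n, by linarith⟩
    · rintro ⟨n, hn⟩
      have : (0 : ℝ) < 1 / (n + 1) := by positivity
      linarith
  have hmono : Monotone fun n : ℕ => Metric.ball x (t - 1 / ((n : ℝ) + 1)) := by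
    intro m n hmn
    refine Metric.ball_subset_ball ?_
    have : (1 : ℝ) / (n + 1) ≤ 1 / (m + 1) := by gcongr
    linarith
  rw [hU, hmono.measure_iUnion, lt_iSup_iff] at hlt
  obtain ⟨n, hn⟩ := hlt
  have hn0 : (0 : ℝ) < 1 / (n + 1) := by positivity
  have hae : ∀ᵐ y, fracMax η γ R μ y ≤ M := by
    filter_upwards [ae_le_essSup (f := fracMax η γ R μ) (μ := volume)] with y hy
    exact hy.trans h
  have hball : ∃ y ∈ Metric.ball x (1 / ((n : ℝ) + 1)), fracMax η γ R μ y ≤ M := by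
    by_contra! hc
    have : volume (Metric.ball x (1 / ((n : ℝ) + 1))) = 0 :=
      measure_mono_null (fun y hy => not_le.2 (hc y hy)) hae
    exact (Metric.measure_ball_pos volume x hn0).ne' this
  obtain ⟨y, hy, hyM⟩ := hball
  have h1 : μ (Metric.ball y t) / ENNReal.ofReal (t ^ ((N : ℝ) - γ) * hWeight η t) ≤ M :=
    le_trans (le_iSup₂_of_le (f := fun t (_ : t ∈ Ioc (0 : ℝ) R) =>
      μ (Metric.ball y t) / ENNReal.ofReal (t ^ ((N : ℝ) - γ) * hWeight η t)) t ht le_rfl) hyM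
  rw [ENNReal.div_le_iff (by simpa using hpos) ENNReal.ofReal_ne_top] at h1
  refine absurd hn (not_lt.2 (le_trans (measure_mono ?_) h1))
  refine Metric.ball_subset_ball' ?_
  rw [Metric.mem_ball, dist_comm] at hy
  linarith

lemma fracMax_le_iff {N : ℕ} {η γ R : ℝ} {M : ℝ≥0∞} {μ : Measure (E N)} (x : E N) :
    fracMax η γ R μ x ≤ M ↔ ∀ t ∈ Ioc 0 R,
      μ (Metric.ball x t) ≤ M * ENNReal.ofReal (t ^ ((N : ℝ) - γ) * hWeight η t) := by
  unfold fracMax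
  simp only [iSup_le_iff]
  refine forall₂_congr fun t ht => ?_
  have hpos : 0 < t ^ ((N : ℝ) - γ) * hWeight η t :=
    mul_pos (Real.rpow_pos_of_pos ht.1 _) (hWeight_pos η ht.1)
  rw [ENNReal.div_le_iff (by simpa using hpos) ENNReal.ofReal_ne_top]

/-- The volume of the unit ball. -/
noncomputable def unitVol (N : ℕ) : ℝ≥0∞ := volume (Metric.ball (0 : E N) 1)

lemma unitVol_pos (N : ℕ) : 0 < unitVol N := Metric.measure_ball_pos _ _ one_pos

lemma unitVol_ne_top (N : ℕ) : unitVol N ≠ ⊤ := measure_ball_lt_top.ne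

lemma volume_ball_eq {N : ℕ} (x : E N) {t : ℝ} (ht : 0 < t) :
    volume (Metric.ball x t) = ENNReal.ofReal (t ^ N) * unitVol N := by
  rw [Measure.addHaar_ball_of_pos _ _ ht]; simp [unitVol]

lemma exists_rpow_le_hWeight {η γ R : ℝ} (hη : 0 ≤ η) (hγ : 0 < γ) (hR : 0 < R) :
    ∃ C : ℝ, 0 < C ∧ ∀ t ∈ Ioc 0 R, t ^ γ ≤ C * hWeight η t := by
  set e := γ / (η + 1) with he
  have he0 : 0 < e := by positivity
  have hlog2 : 0 < Real.log 2 := Real.log_pos (by norm_num)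
  have hC1 : 0 < e⁻¹ ^ η := by positivity
  have hC2 : 0 < R ^ γ * Real.log 2 ^ η := by positivity
  refine ⟨e⁻¹ ^ η + R ^ γ * Real.log 2 ^ η, by positivity, fun t ht => ?_⟩
  have hw := hWeight_pos η ht.1
  rw [add_mul]
  by_cases h : t ≤ 1 / 2
  · refine le_trans ?_ (le_add_of_nonneg_right (by positivity))
    have hlt : 0 < -Real.log t := by
      have := Real.log_neg ht.1 (by linarith)
      linarith
    have h1 : -Real.log t ≤ e⁻¹ * t ^ (-e) := by
      have := Real.log_le_rpow_div (x := t⁻¹) (by have := ht.1; positivity) he0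
      rwa [Real.log_inv, Real.inv_rpow ht.1.le, ← Real.rpow_neg ht.1.le, div_eq_inv_mul] at this
    have h2 : (-Real.log t) ^ η ≤ e⁻¹ ^ η * t ^ (-(e * η)) := by
      refine (Real.rpow_le_rpow hlt.le h1 hη).trans (le_of_eq ?_)
      rw [Real.mul_rpow (by positivity) (Real.rpow_nonneg ht.1.le _), ← Real.rpow_mul ht.1.le,
        neg_mul]
    have h3 : t ^ γ * t ^ (-(e * η)) ≤ 1 := by
      rw [← Real.rpow_add ht.1]
      refine Real.rpow_le_one ht.1.le (by linarith) ?_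
      have : γ = e * (η + 1) := by rw [he]; field_simp
      rw [this]; ring_nf; exact he0.le
    have h4 : hWeight η t = ((-Real.log t) ^ η)⁻¹ := by
      rw [hWeight, if_pos h, Real.rpow_neg hlt.le]
    have h5 : 0 < (-Real.log t) ^ η := Real.rpow_pos_of_pos hlt _
    rw [h4, ← div_eq_mul_inv, le_div_iff₀ h5]
    have h6 : 0 < t ^ γ := Real.rpow_pos_of_pos ht.1 _
    calc t ^ γ * (-Real.log t) ^ η ≤ t ^ γ * (e⁻¹ ^ η * t ^ (-(e * η))) := by gcongr
      _ = e⁻¹ ^ η * (t ^ γ * t ^ (-(e * η))) := by ring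
      _ ≤ e⁻¹ ^ η * 1 := by gcongr
      _ = _ := mul_one _
  · refine le_trans ?_ (le_add_of_nonneg_left (by positivity))
    have h4 : hWeight η t = (Real.log 2 ^ η)⁻¹ := by
      rw [hWeight, if_neg h, Real.rpow_neg hlog2.le]
    rw [h4, mul_assoc, mul_inv_cancel₀ (by positivity), mul_one]
    exact Real.rpow_le_rpow ht.1.le ht.2 hγ.le

lemma supNorm_fracMax_volume_ne_top {N : ℕ} {η γ R : ℝ} (hη : 0 ≤ η) (hγ : 0 < γ) (hR : 0 < R) :
    supNorm (fracMax η γ R (volume : Measure (E N))) ≠ ⊤ := by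
  obtain ⟨C, hC, h⟩ := exists_rpow_le_hWeight hη hγ hR
  refine ne_top_of_le_ne_top (ENNReal.mul_ne_top (unitVol_ne_top N)
    (ENNReal.ofReal_ne_top (r := C)))
    (essSup_le_of_ae_le _ (Filter.Eventually.of_forall fun x => ?_))
  rw [fracMax_le_iff]
  intro t ht
  rw [volume_ball_eq x ht.1, mul_comm (unitVol N), mul_right_comm]
  rw [← ENNReal.ofReal_mul hC.le]
  gcongr
  have h1 : t ^ N = t ^ ((N : ℝ) - γ) * t ^ γ := by
    rw [← Real.rpow_add ht.1, sub_add_cancel, Real.rpow_natCast]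
  have h2 : 0 < t ^ ((N : ℝ) - γ) := Real.rpow_pos_of_pos ht.1 _
  rw [h1]
  calc t ^ ((N : ℝ) - γ) * t ^ γ ≤ t ^ ((N : ℝ) - γ) * (C * hWeight η t) := by
        gcongr; exact h t ht
    _ = _ := by ring

/-- If `μ` has maximal potential at most `M`, then `omega` has maximal potential at most `2M`. -/
lemma omega_ball_le {N : ℕ} {η γ R M : ℝ} {μ : Measure (E N)}
    (h : supNorm (fracMax η γ R μ) ≤ ENNReal.ofReal M) (hM : 0 < M) (x : E N) {t : ℝ}
    (ht : t ∈ Ioc 0 R) :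
    omega η γ R M μ (Metric.ball x t) ≤
      ENNReal.ofReal (2 * M) * ENNReal.ofReal (t ^ ((N : ℝ) - γ) * hWeight η t) := by
  have h1 := measure_ball_le_of_supNorm_le h x ht
  have h2 := measure_ball_le_of_supNorm_le
    (le_refl (supNorm (fracMax η γ R (volume : Measure (E N)))))
    x ht
  rw [omega, Measure.add_apply, Measure.smul_apply, smul_eq_mul, two_mul,
    ENNReal.ofReal_add hM.le hM.le, add_mul]
  refine add_le_add ?_ h1
  calc _ ≤ _ := mul_le_mul_right h2 _
    _ = ENNReal.ofReal M * ((supNorm (fracMax η γ R (volume : Measure (E N))))⁻¹ *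
        supNorm (fracMax η γ R (volume : Measure (E N)))) *
        ENNReal.ofReal (t ^ ((N : ℝ) - γ) * hWeight η t) := by ring
    _ ≤ ENNReal.ofReal M * 1 * ENNReal.ofReal (t ^ ((N : ℝ) - γ) * hWeight η t) := by
        gcongr
        exact ENNReal.inv_mul_le_one _
    _ = _ := by rw [mul_one]

/-! ### Exponential integrability of Wolff potentials -/

/-- Hölder's inequality against the constant function, for an exponent `θ ≤ 1`. -/
lemma lintegral_rpow_le_of_le_one {Ω : Type*} [MeasurableSpace Ω] (μ : Measure Ω) {f : Ω → ℝ≥0∞}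
    (hf : AEMeasurable f μ) {θ : ℝ} (h0 : 0 < θ) (h1 : θ ≤ 1) :
    ∫⁻ x, f x ^ θ ∂μ ≤ (∫⁻ x, f x ∂μ) ^ θ * μ univ ^ (1 - θ) := by
  rcases h1.eq_or_lt with rfl | h1
  · simp
  have hpq : Real.HolderConjugate (1 / θ) (1 / (1 - θ)) := by
    have : 0 < 1 - θ := by linarith
    rw [Real.holderConjugate_iff]
    constructor
    · rw [lt_div_iff₀ h0]; linarith
    · simp
  have := ENNReal.lintegral_mul_le_Lp_mul_Lq μ hpq (hf.pow_const θ)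
    (aemeasurable_const (b := (1 : ℝ≥0∞)))
  simpa [← ENNReal.rpow_mul, h0.ne'] using this

/-- Fubini's theorem for the mass of moving balls. -/
lemma lintegral_measure_ball {N : ℕ} (ν : Measure (E N)) [SFinite ν] (t : ℝ) :
    ∫⁻ y : E N, ν (Metric.ball y t) = ν univ * volume (Metric.ball (0 : E N) t) := by
  have hs : MeasurableSet {w : E N × E N | dist w.1 w.2 < t} :=
    measurableSet_lt (by fun_prop) (by fun_prop)
  have h1 := Measure.prod_apply (μ := volume) (ν := ν) hs
  have h2 := Measure.prod_apply_symm (μ := volume) (ν := ν) hs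
  have e1 : ∀ y : E N, Prod.mk y ⁻¹' {w : E N × E N | dist w.1 w.2 < t} = Metric.ball y t := by
    intro y; ext z; simp [dist_comm]
  have e2 : ∀ z : E N, (fun y => (y, z)) ⁻¹' {w : E N × E N | dist w.1 w.2 < t} =
      Metric.ball z t := by
    intro y; ext z; simp
  simp only [e1] at h1
  simp only [e2, fun z : E N => Measure.addHaar_ball_center (volume : Measure (E N)) z t] at h2
  rw [← h1, h2, lintegral_const, mul_comm]

lemma exists_cover_ball (N : ℕ) {R : ℝ} (hR : 0 < R) :
    ∃ F : Finset (E N), ∀ x : E N, Metric.ball x (2 * R) ⊆ ⋃ z ∈ F, Metric.ball (x + z) R := by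
  obtain ⟨t, -, htf, ht⟩ := (isCompact_closedBall (0 : E N) (2 * R)).finite_cover_balls hR
  refine ⟨htf.toFinset, fun x y hy => ?_⟩
  have : y - x ∈ Metric.closedBall (0 : E N) (2 * R) := by
    rw [mem_closedBall_zero_iff, ← dist_eq_norm]; exact (Metric.mem_ball.1 hy).le
  have := ht this
  simp only [mem_iUnion, Set.Finite.mem_toFinset, Metric.mem_ball, exists_prop] at this ⊢
  obtain ⟨z, hz, h⟩ := this
  refine ⟨z, hz, ?_⟩
  rw [dist_eq_norm] at h ⊢
  rwa [sub_add_eq_sub_sub]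

lemma hWeight_le {η : ℝ} (hη : 0 ≤ η) {t : ℝ} (ht : 0 < t) :
    hWeight η t ≤ Real.log 2 ^ (-η) := by
  have hlog2 : 0 < Real.log 2 := Real.log_pos (by norm_num)
  unfold hWeight
  split_ifs with h
  · refine Real.rpow_le_rpow_of_nonpos hlog2 ?_ (by linarith)
    have := Real.log_le_log ht h
    rw [one_div, Real.log_inv] at this
    linarith
  · exact le_rfl

/-- The hypothesis that the maximal potential of `ω` is at most one, in terms of balls. -/
def BallBound {N : ℕ} (η σ R : ℝ) (ω : Measure (E N)) : Prop :=
  ∀ (x : E N), ∀ t ∈ Ioc 0 R,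
    ω (Metric.ball x t) ≤ ENNReal.ofReal (t ^ ((N : ℝ) - σ) * hWeight η t)

lemma BallBound.div_le {N : ℕ} {η σ R : ℝ} {ω : Measure (E N)} (h : BallBound η σ R ω)
    (x : E N) {t : ℝ} (ht : t ∈ Ioc 0 R) :
    ω (Metric.ball x t) / ENNReal.ofReal (t ^ ((N : ℝ) - σ)) ≤ ENNReal.ofReal (hWeight η t) := by
  have hp : 0 < t ^ ((N : ℝ) - σ) := Real.rpow_pos_of_pos ht.1 _
  rw [ENNReal.div_le_iff (by simpa using hp) ENNReal.ofReal_ne_top, mul_comm,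
    ← ENNReal.ofReal_mul hp.le]
  exact h x t ht

/-- The mean of the `s`-th power of the density of `ω` at scale `t` decays like a power of `t`.
The density itself has mean of order `t^σ` by Fubini's theorem; for `s < 1` Hölder's inequality
applies, and for `s > 1` the excess of the exponent is absorbed by the uniform bound of the
density. -/
lemma exists_lintegral_ball_le {N : ℕ} {η σ R s : ℝ} (hη : 0 ≤ η) (hs : 0 < s) (hR : 0 < R) :
    ∃ C : ℝ≥0∞, C ≠ ⊤ ∧ ∀ (ω : Measure (E N)) [SFinite ω], BallBound η σ R ω →
      ∀ (x : E N), ∀ t ∈ Ioc 0 R, ∫⁻ y in Metric.ball x R,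
        (ω (Metric.ball y t) / ENNReal.ofReal (t ^ ((N : ℝ) - σ))) ^ s ≤
          C * ENNReal.ofReal (t ^ (σ * min s 1)) := by
  obtain ⟨F, hF⟩ := exists_cover_ball N hR
  set τ := min s 1 with hτ
  have hτ0 : 0 < τ := lt_min hs one_pos
  have hτ1 : τ ≤ 1 := min_le_right _ _
  set hm : ℝ≥0∞ := ENNReal.ofReal (Real.log 2 ^ (-η)) with hhm
  set m2 : ℝ≥0∞ := (F.card : ℝ≥0∞) * ENNReal.ofReal (R ^ ((N : ℝ) - σ) * hWeight η R) with hm2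
  refine ⟨hm ^ (s - τ) * ((m2 * unitVol N) ^ τ * volume (Metric.ball (0 : E N) R) ^ (1 - τ)),
    ?_, ?_⟩
  · refine ENNReal.mul_ne_top (ENNReal.rpow_ne_top_of_nonneg (sub_nonneg.2 (min_le_left _ _))
      ENNReal.ofReal_ne_top) (ENNReal.mul_ne_top (ENNReal.rpow_ne_top_of_nonneg hτ0.le
      (ENNReal.mul_ne_top ?_ (unitVol_ne_top N)))
      (ENNReal.rpow_ne_top_of_nonneg (by linarith) measure_ball_lt_top.ne))
    exact ENNReal.mul_ne_top (ENNReal.natCast_ne_top _) ENNReal.ofReal_ne_top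
  intro ω _ hω x t ht
  have htp : 0 < t ^ ((N : ℝ) - σ) := Real.rpow_pos_of_pos ht.1 _
  have hmeas := measurable_measure_ball_left ω t
  have hbig : ω (Metric.ball x (2 * R)) ≤ m2 := by
    refine (measure_mono (hF x)).trans ((measure_biUnion_finset_le _ _).trans ?_)
    rw [hm2, ← nsmul_eq_mul]
    exact Finset.sum_le_card_nsmul _ _ _ fun z _ => hω _ R ⟨hR, le_rfl⟩
  have h1 : ∫⁻ y in Metric.ball x R, ω (Metric.ball y t) ≤
      m2 * (ENNReal.ofReal (t ^ N) * unitVol N) := by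
    rw [← volume_ball_eq 0 ht.1]
    refine le_trans ?_ (mul_le_mul_left hbig _)
    have h2 := lintegral_measure_ball (ω.restrict (Metric.ball x (2 * R))) t
    rw [Measure.restrict_apply_univ] at h2
    rw [← h2]
    refine le_trans (setLIntegral_mono' measurableSet_ball fun y hy => ?_)
      (setLIntegral_le_lintegral _ _)
    rw [Measure.restrict_apply measurableSet_ball, inter_eq_left.2]
    refine Metric.ball_subset_ball' ?_
    have := Metric.mem_ball.1 hy
    linarith [ht.2]
  have h3 : ∫⁻ y in Metric.ball x R, ω (Metric.ball y t) / ENNReal.ofReal (t ^ ((N : ℝ) - σ)) ≤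
      m2 * unitVol N * ENNReal.ofReal (t ^ σ) := by
    simp_rw [div_eq_mul_inv]
    rw [lintegral_mul_const' _ _ (ENNReal.inv_ne_top.2 (by simpa using htp)), ← div_eq_mul_inv]
    rw [ENNReal.div_le_iff (by simpa using htp) ENNReal.ofReal_ne_top, mul_assoc _
      (ENNReal.ofReal (t ^ σ)), ← ENNReal.ofReal_mul (Real.rpow_nonneg ht.1.le _),
      ← Real.rpow_add ht.1]
    refine h1.trans (le_of_eq ?_)
    rw [add_sub_cancel, Real.rpow_natCast]; ring
  calc _ ≤ ∫⁻ y in Metric.ball x R, hm ^ (s - τ) *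
        (ω (Metric.ball y t) / ENNReal.ofReal (t ^ ((N : ℝ) - σ))) ^ τ := by
        refine lintegral_mono fun y => ?_
        have hle : ω (Metric.ball y t) / ENNReal.ofReal (t ^ ((N : ℝ) - σ)) ≤ hm :=
          (hω.div_le y ht).trans (ENNReal.ofReal_le_ofReal (hWeight_le hη ht.1))
        conv_lhs => rw [← sub_add_cancel s τ]
        rw [ENNReal.rpow_add_of_nonneg _ _ (sub_nonneg.2 (min_le_left _ _)) hτ0.le]
        gcongr
        exact sub_nonneg.2 (min_le_left _ _)
    _ = hm ^ (s - τ) * ∫⁻ y in Metric.ball x R,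
        (ω (Metric.ball y t) / ENNReal.ofReal (t ^ ((N : ℝ) - σ))) ^ τ := by
        rw [lintegral_const_mul]
        exact (hmeas.div_const _).pow_const _
    _ ≤ hm ^ (s - τ) * ((m2 * unitVol N * ENNReal.ofReal (t ^ σ)) ^ τ *
        volume (Metric.ball (0 : E N) R) ^ (1 - τ)) := by
        gcongr
        refine (lintegral_rpow_le_of_le_one _ (hmeas.div_const _).aemeasurable hτ0 hτ1).trans ?_
        rw [Measure.restrict_apply_univ, Measure.addHaar_ball_center]
        gcongr
    _ = _ := by
        rw [ENNReal.mul_rpow_of_nonneg _ (ENNReal.ofReal _) hτ0.le,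
          ENNReal.ofReal_rpow_of_nonneg (Real.rpow_nonneg ht.1.le _) hτ0.le,
          ← Real.rpow_mul ht.1.le]
        ring

/-- The part of the Wolff potential at scales below `r` is small in mean. -/
lemma exists_lintegral_wolff_le {N : ℕ} {η α p R : ℝ} (hη : 0 ≤ η) (hp : 1 < p) (hα : 0 < α)
    (hR : 0 < R) :
    ∃ C : ℝ≥0∞, C ≠ ⊤ ∧ ∀ (ω : Measure (E N)) [SFinite ω], BallBound η (α * p) R ω →
      ∀ (x : E N), ∀ r ∈ Ioc 0 R, ∫⁻ y in Metric.ball x R, wolff α p r ω y ≤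
          C * ENNReal.ofReal (r ^ (α * p * min (1 / (p - 1)) 1)) := by
  have hs : 0 < 1 / (p - 1) := by rw [one_div_pos]; linarith
  obtain ⟨C, hC, h⟩ := exists_lintegral_ball_le (N := N) (σ := α * p) hη hs hR
  set γ := α * p * min (1 / (p - 1)) 1 with hγd
  have hγ : 0 < γ := by
    have : 0 < min (1 / (p - 1)) 1 := lt_min hs one_pos
    positivity
  refine ⟨C * ENNReal.ofReal (1 / γ), ENNReal.mul_ne_top hC ENNReal.ofReal_ne_top, ?_⟩
  intro ω _ hω x r hr
  unfold wolff
  rw [lintegral_lintegral_swap (measurable_wolff_integrand α p ω).aemeasurable]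
  calc _ ≤ ∫⁻ t in Ioc 0 r, C * ENNReal.ofReal (t ^ (γ - 1)) := by
        refine setLIntegral_mono' measurableSet_Ioc fun t ht => ?_
        have hinv : (ENNReal.ofReal t)⁻¹ ≠ ⊤ := ENNReal.inv_ne_top.2 (by simpa using ht.1)
        simp_rw [div_eq_mul_inv _ (ENNReal.ofReal t)]
        rw [lintegral_mul_const' _ _ hinv]
        refine (mul_le_mul_left (h ω hω x t ⟨ht.1, ht.2.trans hr.2⟩) _).trans (le_of_eq ?_)
        rw [mul_assoc, ← ENNReal.ofReal_inv_of_pos ht.1,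
          ← ENNReal.ofReal_mul (Real.rpow_nonneg ht.1.le _), Real.rpow_sub_one ht.1.ne',
          div_eq_mul_inv]
    _ = C * ENNReal.ofReal (r ^ γ / γ) := by
        rw [lintegral_const_mul' _ _ hC, lintegral_rpow_Ioc hγ hr.1.le]
    _ = _ := by
        rw [mul_assoc, ← ENNReal.ofReal_mul (by positivity)]
        congr 2; ring

/-- The relation between `η` and `β` makes the scales above `r` contribute at most a multiple of
`(-log r)^(1/β)` to a Wolff potential: the integrand is `(-log t)^(1/β-1) / t` up to constants. -/
lemma exists_lintegral_hWeight_le {η s β R : ℝ} (hβ : 0 < β) (hηs : η * s = 1 - 1 / β) :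
    ∃ C : ℝ, 0 < C ∧ ∀ r : ℝ, 0 < r → r ≤ 1 / 2 →
      ∫⁻ t in Ioc r R, ENNReal.ofReal (hWeight η t ^ s / t) ≤
        ENNReal.ofReal (C * (-Real.log r) ^ (1 / β)) := by
  have hlog2 : 0 < Real.log 2 := Real.log_pos (by norm_num)
  set K : ℝ := (Real.log 2 ^ (-η)) ^ s * 2 * |R| with hK
  have hK0 : 0 ≤ K := by positivity
  refine ⟨β + K / Real.log 2 ^ (1 / β), by positivity, fun r hr hr2 => ?_⟩
  have hlr : Real.log 2 ≤ -Real.log r := by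
    have := Real.log_le_log hr hr2
    rw [one_div, Real.log_inv] at this
    linarith
  have hsub : Ioc r R ⊆ Ioc r (1 / 2) ∪ Ioc (1 / 2) R := by
    intro t ht
    rcases le_or_gt t (1 / 2) with h | h
    · exact Or.inl ⟨ht.1, h⟩
    · exact Or.inr ⟨h, ht.2⟩
  refine (lintegral_mono_set hsub).trans ((lintegral_union_le _ _ _).trans ?_)
  rw [add_mul, ENNReal.ofReal_add (by have := hlog2.trans_le hlr; positivity)
    (by have := hlog2.trans_le hlr; positivity)]
  refine add_le_add ?_ ?_
  · have hpos : ∀ t ∈ Icc r (1 / 2), 0 < -Real.log t := by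
      intro t ht
      have := Real.log_le_log (hr.trans_le ht.1) ht.2
      rw [one_div, Real.log_inv] at this
      linarith
    have hd : ∀ t ∈ uIcc r (1 / 2), HasDerivAt (fun t => -β * (-Real.log t) ^ (1 / β))
        ((-Real.log t) ^ (1 / β - 1) / t) t := by
      intro t ht
      rw [uIcc_of_le hr2] at ht
      have h1 := ((Real.hasDerivAt_log (hr.trans_le ht.1).ne').neg.rpow_const (p := 1 / β)
        (Or.inl (hpos t ht).ne')).const_mul (-β)
      refine h1.congr_deriv ?_
      have : t ≠ 0 := (hr.trans_le ht.1).ne'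
      rw [Pi.neg_apply]
      field_simp
    have hcont : ContinuousOn (fun t : ℝ => (-Real.log t) ^ (1 / β - 1) / t) (uIcc r (1 / 2)) := by
      rw [uIcc_of_le hr2]
      refine ContinuousOn.div ?_ continuousOn_id fun t ht => (hr.trans_le ht.1).ne'
      refine ContinuousOn.rpow_const ?_ fun t ht => Or.inl (hpos t ht).ne'
      exact (Real.continuousOn_log.mono fun t ht => (hr.trans_le ht.1).ne').neg
    have hint := hcont.intervalIntegrable (μ := volume)
    have hFTC := intervalIntegral.integral_eq_sub_of_hasDerivAt hd hint
    rw [intervalIntegral.integral_of_le hr2] at hFTC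
    have : ∫⁻ t in Ioc r (1 / 2), ENNReal.ofReal (hWeight η t ^ s / t) =
        ENNReal.ofReal (∫ t in Ioc r (1 / 2), (-Real.log t) ^ (1 / β - 1) / t) := by
      rw [ofReal_integral_eq_lintegral_ofReal
        ((intervalIntegrable_iff_integrableOn_Ioc_of_le hr2).1 hint)]
      · refine setLIntegral_congr_fun measurableSet_Ioc fun t ht => ?_
        rw [hWeight, if_pos ht.2, ← Real.rpow_mul (hpos t ⟨ht.1.le, ht.2⟩).le]
        congr 3
        linarith
      · filter_upwards [ae_restrict_mem measurableSet_Ioc] with t ht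
        have h2 := hpos t ⟨ht.1.le, ht.2⟩
        have h3 := hr.trans ht.1
        simp only [Pi.zero_apply]
        positivity
    rw [this, hFTC]
    apply ENNReal.ofReal_le_ofReal
    have := hpos (1 / 2) ⟨hr2, le_rfl⟩
    have : 0 ≤ β * (-Real.log (1 / 2)) ^ (1 / β) := by positivity
    linarith
  · calc _ ≤ ∫⁻ t in Ioc (1 / 2) R, ENNReal.ofReal ((Real.log 2 ^ (-η)) ^ s * 2) := by
          refine setLIntegral_mono' measurableSet_Ioc fun t ht => ?_
          apply ENNReal.ofReal_le_ofReal
          rw [hWeight, if_neg (not_le.2 ht.1), div_eq_mul_inv]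
          gcongr
          rw [inv_le_comm₀ (by linarith [ht.1]) (by norm_num)]
          linarith [ht.1]
      _ ≤ ENNReal.ofReal K := by
          rw [setLIntegral_const, Real.volume_Ioc, ← ENNReal.ofReal_mul (by positivity), hK]
          apply ENNReal.ofReal_le_ofReal
          gcongr
          linarith [le_abs_self R]
      _ ≤ _ := by
          apply ENNReal.ofReal_le_ofReal
          rw [div_mul_eq_mul_div, le_div_iff₀ (by positivity)]
          gcongr

lemma wolff_split {N : ℕ} {α p R r : ℝ} (ω : Measure (E N)) (x : E N) (hr : r ∈ Ioc 0 R) :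
    wolff α p R ω x = wolff α p r ω x + ∫⁻ t in Ioc r R,
      (ω (Metric.ball x t) / ENNReal.ofReal (t ^ ((N : ℝ) - α * p))) ^ (1 / (p - 1))
      / ENNReal.ofReal t := by
  unfold wolff
  rw [← Ioc_union_Ioc_eq_Ioc hr.1.le hr.2, lintegral_union measurableSet_Ioc]
  exact Ioc_disjoint_Ioc_of_le le_rfl

/-- A measure with bounded maximal potential of weight `h_η`, `η = (p-1)(β-1)/β`, has a Wolff
potential whose power `β` is exponentially integrable, uniformly on balls of radius `R`. The part
at scales above `e^{-n}` is at most a multiple of `n^(1/β)`, and the part below is controlled by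
Chebyshev's inequality. -/
lemma exists_exp_wolff_le {N : ℕ} {α p β R : ℝ} (hp : 1 < p) (hα : 0 < α) (hβ : 1 ≤ β)
    (hR : 0 < R) :
    ∃ lam : ℝ, 0 < lam ∧ ∃ D : ℝ≥0∞, D ≠ ⊤ ∧ ∀ (ω : Measure (E N)) [SFinite ω],
      BallBound (etaExp p β) (α * p) R ω →
      ∀ (x : E N), ∫⁻ y in Metric.ball x R, P 0 lam β (wolff α p R ω y) ≤ D := by
  have hp' : 0 < p - 1 := by linarith
  have hs : 0 < 1 / (p - 1) := by positivity
  have hβ0 : 0 < β := by linarith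
  have hη : 0 ≤ etaExp p β := by
    have : 0 ≤ β - 1 := by linarith
    unfold etaExp; positivity
  have hηs : etaExp p β * (1 / (p - 1)) = 1 - 1 / β := by unfold etaExp; field_simp
  obtain ⟨C₂, hC₂, hnear⟩ := exists_lintegral_wolff_le (N := N) hη hp hα hR
  obtain ⟨C₁, hC₁, htail⟩ := exists_lintegral_hWeight_le (R := R) hβ0 hηs
  set γ := α * p * min (1 / (p - 1)) 1 with hγd
  have hγ : 0 < γ := by
    have : 0 < min (1 / (p - 1)) 1 := lt_min hs one_pos
    positivity
  obtain ⟨n₀, hn₀⟩ : ∃ n₀ : ℕ, 1 ≤ n₀ ∧ Real.exp (-n₀) ≤ min R (1 / 2) := by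
    have h0 : 0 < min R (1 / 2) := by positivity
    obtain ⟨n, hn⟩ := exists_nat_ge (-Real.log (min R (1 / 2)))
    refine ⟨n + 1, by omega, ?_⟩
    rw [← Real.le_log_iff_exp_le h0]
    push_cast; linarith
  -- the exponential `P` then grows like `e^(γn/2)` along the levels `L n` below, while the measure
  -- of the superlevel sets decays like `e^(-γn)`
  set lam : ℝ := γ / 2 / (2 * C₁) ^ β with hlam
  have hlam0 : 0 < lam := by positivity
  set L : ℕ → ℝ≥0∞ := fun n => ENNReal.ofReal (2 * C₁ * (n : ℝ) ^ (1 / β)) with hL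
  have hPL : ∀ n : ℕ, P 0 lam β (L n) = ENNReal.ofReal (Real.exp (γ / 2 * n)) := by
    intro n
    simp only [hL, P, if_neg ENNReal.ofReal_ne_top, H, Finset.range_zero, Finset.sum_empty,
      sub_zero]
    rw [ENNReal.toReal_ofReal (by positivity), Real.mul_rpow (by positivity) (by positivity),
      ← Real.rpow_mul (by positivity), one_div_mul_cancel hβ0.ne', Real.rpow_one, hlam]
    congr 2; field_simp
  have hPmono := P_mono 0 hlam0 hβ0
  have hLtop : ∀ w : ℝ≥0∞, w ≠ ⊤ → ∃ k : ℕ, w ≤ L (n₀ + k) := by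
    intro w hw
    obtain ⟨k, hk⟩ := exists_nat_ge ((w.toReal / (2 * C₁)) ^ β)
    refine ⟨k, ?_⟩
    rw [← ENNReal.ofReal_toReal hw]
    apply ENNReal.ofReal_le_ofReal
    rw [← div_le_iff₀' (by positivity)]
    calc w.toReal / (2 * C₁) = ((w.toReal / (2 * C₁)) ^ β) ^ (1 / β) := by
          rw [← Real.rpow_mul (by positivity), mul_one_div_cancel hβ0.ne', Real.rpow_one]
      _ ≤ _ := by
          gcongr
          push_cast
          have : (0 : ℝ) ≤ n₀ := by positivity
          linarith
  have hpt : ∀ w : ℝ≥0∞, P 0 lam β w ≤ ENNReal.ofReal (Real.exp (γ / 2 * n₀)) +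
      ∑' k : ℕ, (Ioi (L (n₀ + k))).indicator
        (fun _ => ENNReal.ofReal (Real.exp (γ / 2 * (n₀ + k + 1 : ℕ)))) w := by
    intro w
    rcases eq_or_ne w ⊤ with rfl | hw
    · have : ∑' k : ℕ, (Ioi (L (n₀ + k))).indicator
        (fun _ => ENNReal.ofReal (Real.exp (γ / 2 * (n₀ + k + 1 : ℕ)))) ⊤ = ⊤ := by
        refine top_unique ?_
        rw [← ENNReal.tsum_const_eq_top_of_ne_zero (α := ℕ) one_ne_zero]
        refine ENNReal.tsum_le_tsum fun k => ?_
        rw [indicator_of_mem (by simp [hL]), ENNReal.one_le_ofReal]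
        exact Real.one_le_exp (by positivity)
      rw [this]; simp
    · classical
      have hex := hLtop w hw
      rcases h : Nat.find hex with _ | k
      · have := Nat.find_spec hex
        rw [h] at this
        refine le_trans ?_ le_self_add
        rw [← hPL]; exact hPmono this
      · have h1 := Nat.find_spec hex
        have h2 : ¬ w ≤ L (n₀ + k) := Nat.find_min hex (by omega)
        rw [h] at h1
        refine le_trans ?_ le_add_self
        refine le_trans ?_ (ENNReal.le_tsum k)
        rw [indicator_of_mem (by simpa using h2), ← hPL]
        exact hPmono h1
  set C₃ : ℝ≥0∞ := (ENNReal.ofReal C₁)⁻¹ * C₂ with hC₃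
  have hC₃t : C₃ ≠ ⊤ := ENNReal.mul_ne_top (ENNReal.inv_ne_top.2 (by simpa using hC₁)) hC₂
  refine ⟨lam, hlam0, ENNReal.ofReal (Real.exp (γ / 2 * n₀)) * volume (Metric.ball (0 : E N) R) +
    ∑' k : ℕ, C₃ * ENNReal.ofReal (Real.exp (γ / 2)) * ENNReal.ofReal (Real.exp (-(γ / 2))) ^ k,
    ?_, ?_⟩
  · refine ENNReal.add_ne_top.2 ⟨ENNReal.mul_ne_top ENNReal.ofReal_ne_top
      measure_ball_lt_top.ne, ?_⟩
    rw [ENNReal.tsum_mul_left, ENNReal.tsum_geometric]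
    refine ENNReal.mul_ne_top (ENNReal.mul_ne_top hC₃t ENNReal.ofReal_ne_top) ?_
    rw [ENNReal.inv_ne_top, ne_eq, tsub_eq_zero_iff_le, not_le, ENNReal.ofReal_lt_one,
      Real.exp_lt_one_iff]
    linarith
  intro ω _ hω x
  have hW := measurable_wolff α p R ω
  -- the scales above `e^(-n)` contribute at most half of the level `L n`; Chebyshev's inequality
  -- applies to the scales below
  have hdist : ∀ n : ℕ, n₀ ≤ n → volume.restrict (Metric.ball x R)
      {y | L n < wolff α p R ω y} ≤ C₃ * ENNReal.ofReal (Real.exp (-(γ * n))) := by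
    intro n hn
    have hn1 : (1 : ℝ) ≤ n := by exact_mod_cast hn₀.1.trans hn
    set r := Real.exp (-n) with hr
    have hrle : r ≤ min R (1 / 2) := by
      refine le_trans ?_ hn₀.2
      rw [hr, Real.exp_le_exp, neg_le_neg_iff]; exact_mod_cast hn
    have hr0 : r ∈ Ioc 0 R := ⟨Real.exp_pos _, hrle.trans (min_le_left _ _)⟩
    have hlogr : -Real.log r = n := by rw [hr, Real.log_exp, neg_neg]
    have hsub : {y | L n < wolff α p R ω y} ⊆
        {y | ENNReal.ofReal C₁ ≤ wolff α p r ω y} := by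
      intro y hy
      simp only [mem_ofPred_eq] at hy ⊢
      by_contra! hlt
      refine absurd hy (not_lt.2 ?_)
      rw [wolff_split ω y hr0]
      have ht := htail r hr0.1 (hrle.trans (min_le_right _ _))
      rw [hlogr] at ht
      have h1 : (1 : ℝ) ≤ (n : ℝ) ^ (1 / β) := Real.one_le_rpow hn1 (by positivity)
      calc _ ≤ ENNReal.ofReal (C₁ * (n : ℝ) ^ (1 / β)) +
            ENNReal.ofReal (C₁ * (n : ℝ) ^ (1 / β)) := by
            refine add_le_add (hlt.le.trans (ENNReal.ofReal_le_ofReal ?_)) (le_trans ?_ ht)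
            · nlinarith
            · refine setLIntegral_mono' measurableSet_Ioc fun t ht => ?_
              have ht0 : 0 < t := hr0.1.trans ht.1
              rw [ENNReal.ofReal_div_of_pos ht0]
              gcongr
              rw [← ENNReal.ofReal_rpow_of_pos (hWeight_pos _ ht0)]
              gcongr
              exact hω.div_le y ⟨ht0, ht.2⟩
        _ = L n := by
            rw [← ENNReal.ofReal_add (by positivity) (by positivity)]
            simp only [hL]; congr 1; ring
    refine (measure_mono hsub).trans ?_
    have hch := mul_meas_ge_le_lintegral₀ (μ := volume.restrict (Metric.ball x R))
      (measurable_wolff α p r ω).aemeasurable (ENNReal.ofReal C₁)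
    have h4 := hch.trans (hnear ω hω x r hr0)
    rw [mul_comm, ← ENNReal.le_div_iff_mul_le (Or.inl (by simpa using hC₁))
      (Or.inl ENNReal.ofReal_ne_top)] at h4
    refine h4.trans (le_of_eq ?_)
    rw [div_eq_mul_inv, hC₃, hr, ← Real.exp_mul, hγd]
    ring_nf
  calc _ ≤ ∫⁻ y in Metric.ball x R, (ENNReal.ofReal (Real.exp (γ / 2 * n₀)) +
      ∑' k : ℕ, (Ioi (L (n₀ + k))).indicator
        (fun _ => ENNReal.ofReal (Real.exp (γ / 2 * (n₀ + k + 1 : ℕ)))) (wolff α p R ω y)) :=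
        lintegral_mono fun y => hpt _
    _ = ENNReal.ofReal (Real.exp (γ / 2 * n₀)) * volume (Metric.ball (0 : E N) R) +
      ∑' k : ℕ, ENNReal.ofReal (Real.exp (γ / 2 * (n₀ + k + 1 : ℕ))) *
        volume.restrict (Metric.ball x R) {y | L (n₀ + k) < wolff α p R ω y} := by
        rw [lintegral_add_left measurable_const, setLIntegral_const, Measure.addHaar_ball_center,
          lintegral_tsum]
        swap
        · intro k
          have h1 : Measurable ((Ioi (L (n₀ + k))).indicator
            (fun _ => ENNReal.ofReal (Real.exp (γ / 2 * (n₀ + k + 1 : ℕ))))) :=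
            measurable_const.indicator measurableSet_Ioi
          exact (h1.comp hW).aemeasurable
        congr 1
        refine tsum_congr fun k => ?_
        have : ∀ y, (Ioi (L (n₀ + k))).indicator
          (fun _ => ENNReal.ofReal (Real.exp (γ / 2 * (n₀ + k + 1 : ℕ)))) (wolff α p R ω y) =
          {y | L (n₀ + k) < wolff α p R ω y}.indicator
          (fun _ => ENNReal.ofReal (Real.exp (γ / 2 * (n₀ + k + 1 : ℕ)))) y := fun y => rfl
        simp_rw [this]
        rw [lintegral_indicator_const (measurableSet_lt measurable_const hW)]
    _ ≤ _ := by
        refine add_le_add_right (ENNReal.tsum_le_tsum fun k => ?_) _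
        refine (mul_le_mul_right (hdist (n₀ + k) (by omega)) _).trans ?_
        rw [mul_left_comm, mul_assoc C₃, ← ENNReal.ofReal_mul (by positivity),
          ← ENNReal.ofReal_pow (by positivity), ← ENNReal.ofReal_mul (by positivity)]
        refine mul_le_mul_right (ENNReal.ofReal_le_ofReal ?_) _
        rw [← Real.exp_nat_mul, ← Real.exp_add, ← Real.exp_add, Real.exp_le_exp]
        push_cast
        have : (0 : ℝ) ≤ n₀ := by positivity
        nlinarith

/-! ### Existence of solutions for small data -/

/-- The integral of `P(W[ω])` over a ball of radius `t` decays faster than `t^(N-αp)`. This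
interpolates exponential integrability with the volume of the ball; the `l`-th power of the
coefficient is gained since the power series of `P` starts at order `l`. -/
lemma exists_lintegral_P_wolff_le {N : ℕ} {α p β R : ℝ} (l : ℕ) (hp : 1 < p) (hα : 0 < α)
    (hβ : 1 ≤ β) (hR : 0 < R) (hαp : α * p < N) :
    ∃ m₀ : ℝ, 0 < m₀ ∧ ∃ C : ℝ, 0 ≤ C ∧ ∀ b ∈ Ioc 0 m₀, ∀ (ω : Measure (E N)) [SFinite ω],
      BallBound (etaExp p β) (α * p) R ω → ∀ (x : E N), ∀ t ∈ Ioc 0 R,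
        ∫⁻ y in Metric.ball x t, P l b β (wolff α p R ω y) ≤
          ENNReal.ofReal (C * b ^ l * t ^ ((N : ℝ) - α * p / 2)) := by
  obtain ⟨lam, hlam, D, hD, h⟩ := exists_exp_wolff_le (N := N) hp hα hβ hR
  have hσ : 0 < α * p := by positivity
  have hN : (0 : ℝ) < N := hσ.trans hαp
  -- with this exponent, `(t^N)^(1-θ) = t^(N-αp/2)`
  set θ := α * p / (2 * N) with hθd
  have hθ : 0 < θ := by positivity
  have hθ1 : θ < 1 := by rw [hθd, div_lt_one (by positivity)]; linarith
  have hβ0 : 0 < β := by linarith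
  have hm : 0 < lam * θ := by positivity
  refine ⟨lam * θ, hm, ((lam * θ)⁻¹) ^ l * (D ^ θ * unitVol N ^ (1 - θ)).toReal, by positivity, ?_⟩
  intro b hb ω _ hω x t ht
  have hDv : D ^ θ * unitVol N ^ (1 - θ) ≠ ⊤ := ENNReal.mul_ne_top
    (ENNReal.rpow_ne_top_of_nonneg hθ.le hD)
    (ENNReal.rpow_ne_top_of_nonneg (by linarith) (unitVol_ne_top N))
  have hW : Measurable fun y => P 0 lam β (wolff α p R ω y) :=
    (P_measurable 0 hlam hβ0).comp (measurable_wolff α p R ω)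
  calc _ ≤ ∫⁻ y in Metric.ball x t, ENNReal.ofReal (b / (lam * θ)) ^ l *
        P 0 lam β (wolff α p R ω y) ^ θ := by
        refine lintegral_mono fun y => ?_
        simp only
        rw [← P_zero_rpow hθ]
        exact P_le_pow_mul l hb.1 hb.2 hβ0 _
    _ = ENNReal.ofReal (b / (lam * θ)) ^ l *
        ∫⁻ y in Metric.ball x t, P 0 lam β (wolff α p R ω y) ^ θ :=
        lintegral_const_mul' _ _ (ENNReal.pow_ne_top ENNReal.ofReal_ne_top)
    _ ≤ ENNReal.ofReal (b / (lam * θ)) ^ l * (D ^ θ *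
        (ENNReal.ofReal (t ^ N) * unitVol N) ^ (1 - θ)) := by
        refine mul_le_mul_right ?_ _
        refine (lintegral_rpow_le_of_le_one _ hW.aemeasurable hθ hθ1.le).trans ?_
        rw [Measure.restrict_apply_univ, volume_ball_eq x ht.1]
        refine mul_le_mul_left (ENNReal.rpow_le_rpow ?_ hθ.le) _
        exact (lintegral_mono_set (Metric.ball_subset_ball ht.2)).trans (h ω hω x)
    _ = _ := by
        rw [ENNReal.mul_rpow_of_nonneg _ _ (by linarith : 0 ≤ 1 - θ),
          ENNReal.ofReal_rpow_of_pos (pow_pos ht.1 N), ← Real.rpow_natCast t N,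
          ← Real.rpow_mul ht.1.le, mul_left_comm (D ^ θ), mul_comm (ENNReal.ofReal (t ^ _)),
          ← mul_assoc, ← ENNReal.ofReal_toReal hDv,
          ← ENNReal.ofReal_pow (by have := hb.1; positivity),
          ← ENNReal.ofReal_mul (by have := hb.1; positivity),
          ← ENNReal.ofReal_mul (by have := hb.1; positivity),
          ENNReal.toReal_ofReal ENNReal.toReal_nonneg]
        congr 1
        have : (N : ℝ) * (1 - θ) = (N : ℝ) - α * p / 2 := by rw [hθd]; field_simp
        rw [this, div_pow, inv_pow]
        ring

lemma exists_pos_rpow_le {e₁ e₂ d₁ d₂ : ℝ} (he₁ : 0 < e₁) (he₂ : 0 < e₂) (hd₁ : 0 < d₁)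
    (hd₂ : 0 < d₂) : ∃ M : ℝ, 0 < M ∧ M ^ e₁ ≤ d₁ ∧ M ^ e₂ ≤ d₂ := by
  have key : ∀ {e d M : ℝ}, 0 < e → 0 < d → 0 < M → M ≤ d ^ (1 / e) → M ^ e ≤ d := by
    intro e d M he hd hM h
    calc M ^ e ≤ (d ^ (1 / e)) ^ e := by gcongr
      _ = d := by rw [← Real.rpow_mul hd.le, one_div_mul_cancel he.ne', Real.rpow_one]
  have h1 : 0 < d₁ ^ (1 / e₁) := by positivity
  have h2 : 0 < d₂ ^ (1 / e₂) := by positivity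
  exact ⟨min (d₁ ^ (1 / e₁)) (d₂ ^ (1 / e₂)), lt_min h1 h2,
    key he₁ hd₁ (lt_min h1 h2) (min_le_left _ _), key he₂ hd₂ (lt_min h1 h2) (min_le_right _ _)⟩

lemma LocInt.isLocallyFiniteMeasure {N : ℕ} {g : E N → ℝ≥0∞} (hg : LocInt g) :
    IsLocallyFiniteMeasure (volume.withDensity g) := by
  refine ⟨fun x => ⟨Metric.closedBall x 1, Metric.closedBall_mem_nhds x one_pos, ?_⟩⟩
  rw [withDensity_apply _ Metric.isClosed_closedBall.measurableSet]
  exact hg.2 _ (isCompact_closedBall x 1)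

lemma locInt_of_ball {N : ℕ} {g : E N → ℝ≥0∞} (hg : AEMeasurable g volume) {R : ℝ} (hR : 0 < R)
    (h : ∀ x, ∫⁻ y in Metric.ball x R, g y < ⊤) : LocInt g := by
  have : IsLocallyFiniteMeasure (volume.withDensity g) := by
    refine ⟨fun x => ⟨Metric.ball x R, Metric.ball_mem_nhds x hR, ?_⟩⟩
    rw [withDensity_apply _ measurableSet_ball]
    exact h x
  refine ⟨hg, fun K hK => ?_⟩
  rw [← withDensity_apply _ hK.measurableSet]
  exact hK.measure_lt_top

instance isLocallyFiniteMeasure_ofReal_smul {N : ℕ} (c : ℝ) (μ : Measure (E N))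
    [IsLocallyFiniteMeasure μ] : IsLocallyFiniteMeasure (ENNReal.ofReal c • μ) := by
  refine ⟨fun x => ?_⟩
  obtain ⟨s, hs, h⟩ := μ.finiteAt_nhds x
  exact ⟨s, hs, ENNReal.mul_lt_top ENNReal.ofReal_lt_top h⟩

instance isLocallyFiniteMeasure_add {N : ℕ} (μ ν : Measure (E N))
    [IsLocallyFiniteMeasure μ] [IsLocallyFiniteMeasure ν] : IsLocallyFiniteMeasure (μ + ν) := by
  refine ⟨fun x => ?_⟩
  obtain ⟨s, hs, h⟩ := μ.finiteAt_nhds x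
  obtain ⟨t, ht, h'⟩ := ν.finiteAt_nhds x
  refine ⟨s ∩ t, Filter.inter_mem hs ht, ?_⟩
  rw [Measure.add_apply]
  exact ENNReal.add_lt_top.2 ⟨(measure_mono inter_subset_left).trans_lt h,
    (measure_mono inter_subset_right).trans_lt h'⟩

lemma wolff_le_of_ball_le {N : ℕ} {α p R c e : ℝ} (hp : 1 < p) (hR : 0 < R) (hc : 0 ≤ c)
    (he : 0 < e) {ρ : Measure (E N)} {x : E N}
    (h : ∀ t ∈ Ioc 0 R, ρ (Metric.ball x t) ≤ ENNReal.ofReal (c * t ^ ((N : ℝ) - α * p + e))) :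
    wolff α p R ρ x ≤
      ENNReal.ofReal (c ^ (1 / (p - 1)) * (R ^ (e * (1 / (p - 1))) / (e * (1 / (p - 1))))) := by
  have hs : 0 < 1 / (p - 1) := by rw [one_div_pos]; linarith
  rw [ENNReal.ofReal_mul (by positivity), ← lintegral_rpow_Ioc (by positivity) hR.le,
    ← lintegral_const_mul' _ _ ENNReal.ofReal_ne_top]
  refine setLIntegral_mono' measurableSet_Ioc fun t ht => ?_
  have ht0 := ht.1
  have h1 : ρ (Metric.ball x t) / ENNReal.ofReal (t ^ ((N : ℝ) - α * p)) ≤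
      ENNReal.ofReal (c * t ^ e) := by
    have h2 : 0 < t ^ ((N : ℝ) - α * p) := by positivity
    refine (ENNReal.div_le_div_right (h t ht) _).trans ?_
    rw [← ENNReal.ofReal_div_of_pos h2, Real.rpow_add ht0]
    apply ENNReal.ofReal_le_ofReal
    rw [div_le_iff₀ h2]
    apply le_of_eq; ring
  rw [← ENNReal.ofReal_mul (by positivity), Real.rpow_sub_one ht0.ne', ← mul_div_assoc,
    ENNReal.ofReal_div_of_pos ht0]
  gcongr
  refine (ENNReal.rpow_le_rpow h1 hs.le).trans ?_
  rw [ENNReal.ofReal_rpow_of_nonneg (by positivity) hs.le, Real.mul_rpow hc (by positivity),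
    ← Real.rpow_mul ht0.le]

lemma le_wolff_of_le_ball {N : ℕ} {α p R c e : ℝ} (hp : 1 < p) (hR : 0 < R) (hc : 0 ≤ c)
    (he : 0 < e) {ρ : Measure (E N)} {x : E N}
    (h : ∀ t ∈ Ioc 0 R, ENNReal.ofReal (c * t ^ ((N : ℝ) - α * p + e)) ≤ ρ (Metric.ball x t)) :
    ENNReal.ofReal (c ^ (1 / (p - 1)) * (R ^ (e * (1 / (p - 1))) / (e * (1 / (p - 1))))) ≤
      wolff α p R ρ x := by
  have hs : 0 < 1 / (p - 1) := by rw [one_div_pos]; linarith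
  rw [ENNReal.ofReal_mul (by positivity), ← lintegral_rpow_Ioc (by positivity) hR.le,
    ← lintegral_const_mul' _ _ ENNReal.ofReal_ne_top]
  refine setLIntegral_mono' measurableSet_Ioc fun t ht => ?_
  have ht0 := ht.1
  have h1 : ENNReal.ofReal (c * t ^ e) ≤
      ρ (Metric.ball x t) / ENNReal.ofReal (t ^ ((N : ℝ) - α * p)) := by
    have h2 : 0 < t ^ ((N : ℝ) - α * p) := by positivity
    refine le_trans ?_ (ENNReal.div_le_div_right (h t ht) _)
    rw [← ENNReal.ofReal_div_of_pos h2, Real.rpow_add ht0]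
    apply ENNReal.ofReal_le_ofReal
    rw [le_div_iff₀ h2]
    apply le_of_eq; ring
  rw [← ENNReal.ofReal_mul (by positivity), Real.rpow_sub_one ht0.ne', ← mul_div_assoc,
    ENNReal.ofReal_div_of_pos ht0]
  gcongr
  refine le_trans ?_ (ENNReal.rpow_le_rpow h1 hs.le)
  rw [ENNReal.ofReal_rpow_of_nonneg (by positivity) hs.le, Real.mul_rpow hc (by positivity),
    ← Real.rpow_mul ht0.le]

/-- For a small bound `M` on the maximal potential, the Wolff potential of the nonlinear term is
dominated by the Wolff potential of `omega`. Both sides are comparable to constants: the left side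
is of order `M^(lβ/(p-1)²)`, the right side at least of order `M^(1/(p-1))`, and `lβ > p-1`. -/
lemma exists_small_wolff_P_le {N : ℕ} {α p a β R : ℝ} {l : ℕ} (hp : 1 < p) (hα : 0 < α)
    (ha : 0 < a) (hβ : 1 ≤ β) (hR : 0 < R) (hlβ : p - 1 < l * β) (hαp : α * p < N) {K : ℝ}
    (hK : 0 < K) :
    ∃ M : ℝ, 0 < M ∧ ∀ (μ : Measure (E N)) [IsLocallyFiniteMeasure μ],
      supNorm (fracMax (etaExp p β) (α * p) R μ) ≤ ENNReal.ofReal M →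
      LocInt (fun x => P l a β (ENNReal.ofReal K *
        wolff α p R (omega (etaExp p β) (α * p) R M μ) x)) ∧
      ∀ x, wolff α p R (volume.withDensity fun y => P l a β (ENNReal.ofReal K *
        wolff α p R (omega (etaExp p β) (α * p) R M μ) y)) x ≤
        wolff α p R (omega (etaExp p β) (α * p) R M μ) x := by
  obtain ⟨m₀, hm₀, C, hC, h⟩ := exists_lintegral_P_wolff_le (N := N) l hp hα hβ hR hαp
  have hp' : 0 < p - 1 := by linarith
  set s := 1 / (p - 1) with hsd
  have hs : 0 < s := by positivity
  have hβ0 : 0 < β := by linarith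
  have hσ : 0 < α * p := by positivity
  set η := etaExp p β with hηd
  have hη : 0 ≤ η := by
    have : 0 ≤ β - 1 := by linarith
    rw [hηd]; unfold etaExp; positivity
  -- the reciprocal of the norm of the maximal potential of Lebesgue measure
  set k : ℝ≥0∞ := (supNorm (fracMax η (α * p) R (volume : Measure (E N))))⁻¹ with hk
  have hk0 : k ≠ 0 := ENNReal.inv_ne_zero.2 (supNorm_fracMax_volume_ne_top hη hσ hR)
  have hkt : k ≠ ⊤ := by
    rw [hk, ne_eq, ENNReal.inv_eq_top]
    intro h0
    have := measure_ball_le_of_supNorm_le h0.le (0 : E N) ⟨hR, le_rfl⟩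
    rw [zero_mul] at this
    exact absurd this (not_le.2 (Metric.measure_ball_pos _ _ hR))
  set kv : ℝ := (k * unitVol N).toReal with hkv
  have hkv0 : 0 < kv := ENNReal.toReal_pos (mul_ne_zero hk0 (unitVol_pos N).ne')
    (ENNReal.mul_ne_top hkt (unitVol_ne_top N))
  set A₁ := R ^ (α * p / 2 * s) / (α * p / 2 * s) with hA₁
  set A₂ := R ^ (α * p * s) / (α * p * s) with hA₂
  have hA₁0 : 0 < A₁ := by positivity
  have hA₂0 : 0 < A₂ := by positivity
  set r := (A₂ / A₁) ^ (1 / s) with hr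
  have hr0 : 0 < r := by positivity
  set b₀ := a * (K * 2 ^ s) ^ β with hb₀
  have hb₀0 : 0 < b₀ := by positivity
  have he : 0 < s * β * l - 1 := by
    rw [hsd, sub_pos, mul_assoc, one_div, ← div_eq_inv_mul, lt_div_iff₀ hp']
    linarith
  obtain ⟨M, hM, hM1, hM2⟩ := exists_pos_rpow_le (d₁ := m₀ / b₀) (d₂ := kv * r / (C * b₀ ^ l + 1))
    (mul_pos hs hβ0) he (by positivity) (by positivity)
  refine ⟨M, hM, fun μ _ hμ => ?_⟩
  set ω := omega η (α * p) R M μ with hω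
  set b := b₀ * M ^ (s * β) with hb
  have hb0 : b ∈ Ioc 0 m₀ := by
    refine ⟨by positivity, ?_⟩
    rw [hb, mul_comm]
    exact (le_div_iff₀ hb₀0).1 hM1
  have hbl : C * b ^ l ≤ kv * M * r := by
    have h1 : M ^ (s * β * l) = M ^ (s * β * l - 1) * M := by
      rw [← Real.rpow_add_one hM.ne', sub_add_cancel]
    calc C * b ^ l = C * b₀ ^ l * M ^ (s * β * l) := by
          rw [hb, mul_pow, ← Real.rpow_natCast (M ^ _), ← Real.rpow_mul hM.le,
            ← mul_assoc C]
      _ = C * b₀ ^ l * M ^ (s * β * l - 1) * M := by rw [h1, ← mul_assoc]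
      _ ≤ (C * b₀ ^ l + 1) * (kv * r / (C * b₀ ^ l + 1)) * M := by gcongr; linarith
      _ = _ := by field_simp
  have hlfω : IsLocallyFiniteMeasure ω := by
    have : ω = ENNReal.ofReal (M * k.toReal) • volume + μ := by
      rw [hω, omega, ENNReal.ofReal_mul hM.le, ENNReal.ofReal_toReal hkt]
    rw [this]; infer_instance
  -- normalization to a measure with maximal potential at most one
  set ω' : Measure (E N) := ENNReal.ofReal ((2 * M)⁻¹) • ω with hω'
  have hωω' : ω = ENNReal.ofReal (2 * M) • ω' := by
    rw [hω', smul_smul, ← ENNReal.ofReal_mul (by positivity), mul_inv_cancel₀ (by positivity),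
      ENNReal.ofReal_one, one_smul]
  have hBB : BallBound η (α * p) R ω' := by
    intro x t ht
    have := omega_ball_le hμ hM x ht
    rw [hω', Measure.smul_apply, smul_eq_mul]
    refine (mul_le_mul_right this _).trans (le_of_eq ?_)
    rw [← mul_assoc, ← ENNReal.ofReal_mul (by positivity), inv_mul_cancel₀ (by positivity),
      ENNReal.ofReal_one, one_mul]
  have hPeq : ∀ y, P l a β (ENNReal.ofReal K * wolff α p R ω y) =
      P l b β (wolff α p R ω' y) := by
    intro y
    rw [hωω', wolff_smul hp (by positivity), ← mul_assoc, ← ENNReal.ofReal_mul hK.le,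
      P_const_mul l ha hβ0 (by positivity)]
    congr 1
    rw [hb, hb₀, Real.mul_rpow (by norm_num) hM.le, ← mul_assoc,
      Real.mul_rpow (by positivity) (by positivity), ← Real.rpow_mul hM.le]
    ring
  simp_rw [hPeq]
  have hmeas : Measurable fun y => P l b β (wolff α p R ω' y) :=
    (P_measurable l hb0.1 hβ0).comp (measurable_wolff α p R ω')
  constructor
  · exact locInt_of_ball hmeas.aemeasurable hR fun x =>
      (h b hb0 ω' hBB x R ⟨hR, le_rfl⟩).trans_lt ENNReal.ofReal_lt_top
  intro x
  have h1 : wolff α p R (volume.withDensity fun y => P l b β (wolff α p R ω' y)) x ≤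
      ENNReal.ofReal ((C * b ^ l) ^ s * A₁) := by
    refine wolff_le_of_ball_le hp hR (by have := hb0.1; positivity) (by positivity) fun t ht => ?_
    rw [withDensity_apply _ measurableSet_ball]
    refine (h b hb0 ω' hBB x t ht).trans (le_of_eq ?_)
    congr 3; ring
  have h2 : ENNReal.ofReal ((kv * M) ^ s * A₂) ≤ wolff α p R ω x := by
    refine le_wolff_of_le_ball hp hR (by positivity) hσ fun t ht => ?_
    rw [hω, omega, Measure.add_apply, Measure.smul_apply, smul_eq_mul, volume_ball_eq x ht.1]
    refine le_trans (le_of_eq ?_) le_self_add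
    rw [sub_add_cancel, Real.rpow_natCast, ENNReal.ofReal_mul (by positivity),
      ENNReal.ofReal_mul hkv0.le, hkv, ENNReal.ofReal_toReal
      (ENNReal.mul_ne_top hkt (unitVol_ne_top N))]
    ring
  refine h1.trans (le_trans (ENNReal.ofReal_le_ofReal ?_) h2)
  calc (C * b ^ l) ^ s * A₁ ≤ (kv * M * r) ^ s * A₁ := by
        have := hb0.1
        gcongr
    _ = (kv * M) ^ s * (r ^ s * A₁) := by
        rw [Real.mul_rpow (by positivity) hr0.le]; ring
    _ = _ := by
        rw [hr, ← Real.rpow_mul (by positivity), one_div_mul_cancel hs.ne', Real.rpow_one,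
          div_mul_cancel₀ _ hA₁0.ne']

/-- Because the coefficient of `f` may increase from `a` to `a + ε`, the nonlinear term of a sum
`w + f` splits into the nonlinear terms of `f` and of a multiple of `w`. -/
lemma P_add_le (l : ℕ) {a ε β : ℝ} (ha : 0 < a) (hε : 0 < ε) (hβ : 0 < β) :
    ∃ c : ℝ, 0 < c ∧ ∀ w f : ℝ≥0∞,
      P l a β (w + f) ≤ P l (a + ε) β f + P l a β (ENNReal.ofReal c * w) := by
  set d := ((a + ε) / a) ^ (1 / β) with hd
  have hd1 : 1 < d := by
    apply Real.one_lt_rpow _ (by positivity)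
    rw [lt_div_iff₀ ha]; linarith
  have hd0 : 0 < d - 1 := by linarith
  refine ⟨1 + (d - 1)⁻¹, by positivity, fun w f => ?_⟩
  have e1 : a * d ^ β = a + ε := by
    rw [hd, ← Real.rpow_mul (by positivity), one_div_mul_cancel hβ.ne', Real.rpow_one]
    field_simp
  rw [← e1, ← P_const_mul l ha hβ (by linarith)]
  rcases le_total w (ENNReal.ofReal (d - 1) * f) with h | h
  · refine le_trans (P_mono l ha hβ ?_) le_self_add
    calc w + f ≤ ENNReal.ofReal (d - 1) * f + ENNReal.ofReal 1 * f := by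
          rw [ENNReal.ofReal_one, one_mul]; gcongr
      _ = _ := by rw [← add_mul, ← ENNReal.ofReal_add hd0.le one_pos.le, sub_add_cancel]
  · refine le_trans (P_mono l ha hβ ?_) le_add_self
    rw [ENNReal.ofReal_add one_pos.le (by positivity), add_mul, ENNReal.ofReal_one, one_mul]
    gcongr
    calc f = ENNReal.ofReal (d - 1)⁻¹ * (ENNReal.ofReal (d - 1) * f) := by
          rw [← mul_assoc, ← ENNReal.ofReal_mul (by positivity), inv_mul_cancel₀ hd0.ne',
            ENNReal.ofReal_one, one_mul]
      _ ≤ _ := by gcongr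

lemma P_add_le_two (l : ℕ) {a β : ℝ} (ha : 0 < a) (hβ : 0 < β) (x y : ℝ≥0∞) :
    P l a β (x + y) ≤ P l a β (2 * x) + P l a β (2 * y) := by
  rcases le_total x y with h | h
  · refine le_trans (P_mono l ha hβ ?_) le_add_self
    rw [two_mul]; gcongr
  · refine le_trans (P_mono l ha hβ ?_) le_self_add
    rw [two_mul]; gcongr

lemma LocInt.add {N : ℕ} {g h : E N → ℝ≥0∞} (hg : LocInt g) (hh : LocInt h) :
    LocInt (fun x => g x + h x) := by
  refine ⟨hg.1.add hh.1, fun K hK => ?_⟩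
  rw [lintegral_add_left' hg.1.restrict]
  exact ENNReal.add_lt_top.2 ⟨hg.2 K hK, hh.2 K hK⟩

lemma LocInt.mono {N : ℕ} {g h : E N → ℝ≥0∞} (hg : LocInt g) (hh : AEMeasurable h volume)
    (hle : ∀ x, h x ≤ g x) : LocInt h :=
  ⟨hh, fun K hK => (lintegral_mono hle).trans_lt (hg.2 K hK)⟩

/-- Existence below a supersolution, by the Knaster–Tarski theorem. A fixed point is automatically
measurable, since it is the sum of `f` and a Wolff potential. -/
lemma exists_isSolution_of_supersolution {N : ℕ} {α p a β R : ℝ} {l : ℕ} (hp : 1 < p)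
    (ha : 0 < a) (hβ : 0 < β) {μ : Measure (E N)} [IsLocallyFiniteMeasure μ]
    {f F : E N → ℝ≥0∞} (hf : AEMeasurable f volume) (hF : LocInt fun x => P l a β (F x))
    (hsuper : ∀ x, wolff α p R (volume.withDensity (fun y => P l a β (F y)) + μ) x + f x ≤ F x) :
    ∃ u : E N → ℝ≥0∞, IsSolution α p a β R l μ f u ∧ ∀ x, u x ≤ F x := by
  let T : (E N → ℝ≥0∞) →o (E N → ℝ≥0∞) :=
    { toFun := fun v x => wolff α p R (volume.withDensity (fun y => P l a β (v y)) + μ) x + f x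
      monotone' := by
        intro v w hvw x
        refine add_le_add_left (wolff_mono hp (add_le_add_left (withDensity_mono
          (Filter.Eventually.of_forall fun y => P_mono l ha hβ (hvw y))) _) x) _ }
  set u := OrderHom.lfp T with hu
  have hle : u ≤ F := OrderHom.lfp_le T hsuper
  have heq : T u = u := OrderHom.map_lfp T
  have hPle : ∀ x, P l a β (u x) ≤ P l a β (F x) := fun x => P_mono l ha hβ (hle x)
  have := hF.isLocallyFiniteMeasure
  have : IsLocallyFiniteMeasure (volume.withDensity fun y => P l a β (u y)) :=
    Measure.isLocallyFiniteMeasure_of_le (withDensity_mono (Filter.Eventually.of_forall hPle))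
  have hm : AEMeasurable u volume := by
    rw [← heq]
    exact (measurable_wolff α p R _).aemeasurable.add hf
  refine ⟨u, ⟨hm, ?_, fun x => ?_⟩, hle⟩
  · exact hF.mono ((P_measurable l ha hβ).comp_aemeasurable hm) hPle
  · conv_lhs => rw [← heq]
    rfl

/-- Solvability for small data. The majorant `F` is a supersolution: the measure `P(F) + μ` is at
most `(μ + P(K W[ω₁])) + (μ₁ + P(K W[ω₂]))`, and splitting its Wolff potential twice costs the
constant `quasiAdd p ^ 2 = cConst p`. -/
lemma exists_isSolution_of_small {N : ℕ} {α p a β R ε : ℝ} {l : ℕ} (hp : 1 < p) (hα : 0 < α)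
    (ha : 0 < a) (hβ : 1 ≤ β) (hR : 0 < R) (hlβ : p - 1 < l * β) (hαp : α * p < N)
    (hε : 0 < ε) :
    ∃ M : ℝ, 0 < M ∧ ∀ (f : E N → ℝ≥0∞) (μ μ₁ : Measure (E N)) [IsLocallyFiniteMeasure μ],
      AEMeasurable f volume → LocInt (fun x => P l (a + ε) β (f x)) →
      μ₁ = volume.withDensity (fun x => P l (a + ε) β (f x)) →
      supNorm (fracMax (etaExp p β) (α * p) R μ) ≤ ENNReal.ofReal M →
      supNorm (fracMax (etaExp p β) (α * p) R μ₁) ≤ ENNReal.ofReal M →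
      ∃ u : E N → ℝ≥0∞, IsSolution α p a β R l μ f u ∧
        (∀ x, u x ≤ majorant α p β R M μ μ₁ f x) ∧
        LocInt (fun x => P l a β (majorant α p β R M μ μ₁ f x)) := by
  have hβ0 : 0 < β := by linarith
  have hcp : 0 < cConst p := lt_max_of_lt_left one_pos
  obtain ⟨c, hc, hsplit⟩ := P_add_le l ha hε hβ0
  obtain ⟨M, hM, h⟩ := exists_small_wolff_P_le (N := N) (K := 2 * (c * (2 * cConst p))) hp hα ha hβ
    hR hlβ hαp (by positivity)
  refine ⟨M, hM, fun f μ μ₁ _ hf hloc hμ₁ hsμ hsμ₁ => ?_⟩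
  have : IsLocallyFiniteMeasure μ₁ := by rw [hμ₁]; exact hloc.isLocallyFiniteMeasure
  obtain ⟨hL1, hW1⟩ := h μ hsμ
  obtain ⟨hL2, hW2⟩ := h μ₁ hsμ₁
  set ω₁ := omega (etaExp p β) (α * p) R M μ with hω₁
  set ω₂ := omega (etaExp p β) (α * p) R M μ₁ with hω₂
  set K := 2 * (c * (2 * cConst p)) with hK
  set ρ₁ := fun x => P l a β (ENNReal.ofReal K * wolff α p R ω₁ x) with hρ₁
  set ρ₂ := fun x => P l a β (ENNReal.ofReal K * wolff α p R ω₂ x) with hρ₂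
  set F := majorant α p β R M μ μ₁ f with hF
  have hPF : ∀ x, P l a β (F x) ≤ P l (a + ε) β (f x) + (ρ₁ x + ρ₂ x) := by
    intro x
    refine (hsplit _ _).trans (add_le_add_right ?_ _)
    rw [mul_add]
    refine (P_add_le_two l ha hβ0 _ _).trans (le_of_eq ?_)
    rw [hρ₁, hρ₂, hK]
    simp only
    rw [ENNReal.ofReal_mul zero_le_two (q := c * (2 * cConst p)), ENNReal.ofReal_mul hc.le,
      ENNReal.ofReal_ofNat]
    simp only [mul_assoc]
    rfl
  have hlf : ∀ (ν : Measure (E N)) [IsLocallyFiniteMeasure ν],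
      SFinite (omega (etaExp p β) (α * p) R M ν) := by
    intro ν _; unfold omega; infer_instance
  have hm₁ : Measurable (wolff α p R ω₁) := measurable_wolff α p R ω₁
  have hm₂ : Measurable (wolff α p R ω₂) := measurable_wolff α p R ω₂
  have hFm : AEMeasurable F volume :=
    (((hm₁.const_mul _).add (hm₂.const_mul _)).aemeasurable).add hf
  have hLF : LocInt fun x => P l a β (F x) :=
    (hloc.add (hL1.add hL2)).mono ((P_measurable l ha hβ0).comp_aemeasurable hFm) hPF
  have hρ₁m : Measurable ρ₁ := (P_measurable l ha hβ0).comp (hm₁.const_mul _)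
  have hρ₂m : Measurable ρ₂ := (P_measurable l ha hβ0).comp (hm₂.const_mul _)
  obtain ⟨u, hu, huF⟩ := exists_isSolution_of_supersolution (α := α) (R := R) (μ := μ) hp ha hβ0 hf
    hLF (by
      intro x
      have hmeas : volume.withDensity (fun y => P l a β (F y)) + μ ≤
          (μ + volume.withDensity ρ₁) + (μ₁ + volume.withDensity ρ₂) := by
        have h1 : volume.withDensity (fun y => P l a β (F y)) ≤
            μ₁ + (volume.withDensity ρ₁ + volume.withDensity ρ₂) := by
          rw [hμ₁, ← withDensity_add_left hρ₁m, ← withDensity_add_right _ (hρ₁m.add hρ₂m)]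
          exact withDensity_mono (Filter.Eventually.of_forall hPF)
        refine (add_le_add_left h1 μ).trans (le_of_eq ?_)
        abel
      have hq := quasiAdd_sq p
      have hq0 : 0 ≤ quasiAdd p := by linarith [one_le_quasiAdd p]
      have hμω₁ : μ ≤ ω₁ := le_add_of_nonneg_left (Measure.zero_le _)
      have hμω₂ : μ₁ ≤ ω₂ := le_add_of_nonneg_left (Measure.zero_le _)
      refine add_le_add_left ?_ _
      calc _ ≤ _ := wolff_mono hp hmeas x
        _ ≤ _ := wolff_add_le hp _ _ x
        _ ≤ ENNReal.ofReal (quasiAdd p) *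
            (ENNReal.ofReal (quasiAdd p) * (wolff α p R ω₁ x + wolff α p R ω₁ x) +
              ENNReal.ofReal (quasiAdd p) * (wolff α p R ω₂ x + wolff α p R ω₂ x)) := by
            refine mul_le_mul_right (add_le_add ?_ ?_) _
            · refine (wolff_add_le hp _ _ x).trans (mul_le_mul_right (add_le_add ?_ (hW1 x)) _)
              exact wolff_mono hp hμω₁ x
            · refine (wolff_add_le hp _ _ x).trans (mul_le_mul_right (add_le_add ?_ (hW2 x)) _)
              exact wolff_mono hp hμω₂ x
        _ = _ := by
            rw [← hq, ENNReal.ofReal_mul (by norm_num), ENNReal.ofReal_pow hq0,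
              ENNReal.ofReal_ofNat]
            ring)
  exact ⟨u, hu, huF, hLF⟩

/-! ### The centred maximal function of a set with respect to a measure -/

/-- The weak type `(1,1)` estimate for the centred maximal function of the indicator of `A` with
respect to an arbitrary locally finite measure, from the Besicovitch covering theorem. -/
lemma exists_weak_type (N : ℕ) :
    ∃ n : ℕ, ∀ (ω : Measure (E N)) [IsLocallyFiniteMeasure ω] (A : Set (E N)) (R : ℝ)
      (lam : ℝ≥0∞), MeasurableSet A → lam ≠ ⊤ →
      lam * ω {x | ∃ t ∈ Ioc 0 R, lam * ω (Metric.ball x t) < ω (A ∩ Metric.ball x t)} ≤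
        n * ω A := by
  obtain ⟨n, τ, hτ, hn⟩ := HasBesicovitchCovering.no_satelliteConfig (α := E N)
  refine ⟨n, fun ω _ A R lam hA hlam => ?_⟩
  set S := {x | ∃ t ∈ Ioc 0 R, lam * ω (Metric.ball x t) < ω (A ∩ Metric.ball x t)} with hS
  -- pass to slightly smaller closed balls
  have hex : ∀ x : S, ∃ r : ℝ, r ∈ Ioc 0 R ∧
      lam * ω (Metric.closedBall x.1 r) ≤ ω (A ∩ Metric.closedBall x.1 r) := by
    rintro ⟨x, t, ht, hlt⟩
    have hU : A ∩ Metric.ball x t =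
        ⋃ k : ℕ, A ∩ Metric.closedBall x (t * (1 - 1 / ((k : ℝ) + 2))) := by
      rw [← inter_iUnion]
      congr 1
      ext y
      simp only [Metric.mem_ball, mem_iUnion, Metric.mem_closedBall]
      constructor
      · intro hy
        have h1 : 0 < 1 - dist y x / t := by rw [sub_pos, div_lt_one ht.1]; exact hy
        obtain ⟨k, hk⟩ := exists_nat_one_div_lt h1
        refine ⟨k, ?_⟩
        have h2 : (1 : ℝ) / (k + 2) ≤ 1 / (k + 1) := by gcongr; norm_num
        have h3 : dist y x / t ≤ 1 - 1 / ((k : ℝ) + 2) := by linarith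
        rwa [div_le_iff₀' ht.1] at h3
      · rintro ⟨k, hk⟩
        have h2 : (0 : ℝ) < 1 / (k + 2) := by positivity
        nlinarith [ht.1]
    have hmono : Monotone fun k : ℕ =>
        A ∩ Metric.closedBall x (t * (1 - 1 / ((k : ℝ) + 2))) := by
      intro i j hij
      refine inter_subset_inter_right _ (Metric.closedBall_subset_closedBall ?_)
      have : (1 : ℝ) / (j + 2) ≤ 1 / (i + 2) := by gcongr
      have := ht.1
      gcongr
    rw [hU, hmono.measure_iUnion, lt_iSup_iff] at hlt
    obtain ⟨k, hk⟩ := hlt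
    have h2 : (0 : ℝ) < 1 / (k + 2) := by positivity
    have h3 : (1 : ℝ) / (k + 2) < 1 := by
      rw [div_lt_one (by positivity)]
      have : (0 : ℝ) ≤ k := by positivity
      linarith
    have h4 : t * (1 - 1 / ((k : ℝ) + 2)) < t := by nlinarith [ht.1]
    refine ⟨t * (1 - 1 / ((k : ℝ) + 2)), ⟨mul_pos ht.1 (by linarith), h4.le.trans ht.2⟩,
      le_trans ?_ hk.le⟩
    gcongr
    exact Metric.closedBall_subset_ball h4
  choose r hr hle using hex
  let q : Besicovitch.BallPackage S (E N) :=
    { c := fun x => x.1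
      r := r
      rpos := fun x => (hr x).1
      r_bound := R
      r_le := fun x => (hr x).2 }
  obtain ⟨s, hdisj, hcov⟩ := Besicovitch.exist_disjoint_covering_families hτ hn q
  have hcount : ∀ i, (s i).Countable := by
    intro i
    refine (hdisj i).countable_of_nonempty_interior fun x _ => ?_
    exact ⟨x.1, Metric.ball_subset_interior_closedBall (Metric.mem_ball_self (hr x).1)⟩
  have hSsub : S ⊆ ⋃ i : Fin n, ⋃ j ∈ s i, Metric.closedBall j.1 (r j) := by
    intro x hx
    have := hcov ⟨⟨x, hx⟩, rfl⟩
    simp only [mem_iUnion] at this ⊢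
    obtain ⟨i, j, hj, h⟩ := this
    exact ⟨i, j, hj, Metric.ball_subset_closedBall h⟩
  have hfam : ∀ i, lam * ω (⋃ j ∈ s i, Metric.closedBall j.1 (r j)) ≤ ω A := by
    intro i
    calc lam * ω (⋃ j ∈ s i, Metric.closedBall j.1 (r j))
        ≤ lam * ∑' j : s i, ω (Metric.closedBall j.1.1 (r j.1)) := by
          gcongr
          exact measure_biUnion_le ω (hcount i) _
      _ = ∑' j : s i, lam * ω (Metric.closedBall j.1.1 (r j.1)) := ENNReal.tsum_mul_left.symm
      _ ≤ ∑' j : s i, ω.restrict A (Metric.closedBall j.1.1 (r j.1)) := by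
          refine ENNReal.tsum_le_tsum fun j => ?_
          rw [Measure.restrict_apply Metric.isClosed_closedBall.measurableSet, inter_comm]
          exact hle j.1
      _ = ω.restrict A (⋃ j ∈ s i, Metric.closedBall j.1 (r j)) :=
          (measure_biUnion (hcount i) (hdisj i)
            fun j _ => Metric.isClosed_closedBall.measurableSet).symm
      _ ≤ ω A := by
          rw [← Measure.restrict_apply_univ (μ := ω) A]
          exact measure_mono (subset_univ _)
  calc lam * ω S ≤ lam * ∑ i : Fin n, ω (⋃ j ∈ s i, Metric.closedBall j.1 (r j)) := by
        gcongr
        exact (measure_mono hSsub).trans (measure_iUnion_fintype_le _ _)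
    _ = ∑ i : Fin n, lam * ω (⋃ j ∈ s i, Metric.closedBall j.1 (r j)) := Finset.mul_sum _ _ _
    _ ≤ ∑ i : Fin n, ω A := Finset.sum_le_sum fun i _ => hfam i
    _ = n * ω A := by simp

/-- The centred maximal function of the indicator of `A` with respect to `ω`, at scales up to
`R`. -/
noncomputable def centredMax {N : ℕ} (ω : Measure (E N)) (A : Set (E N)) (R : ℝ) (x : E N) :
    ℝ≥0∞ :=
  ⨆ t ∈ Ioc 0 R, ω (A ∩ Metric.ball x t) / ω (Metric.ball x t)

lemma centredMax_le_one {N : ℕ} (ω : Measure (E N)) (A : Set (E N)) (R : ℝ) (x : E N) :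
    centredMax ω A R x ≤ 1 :=
  iSup₂_le fun _ _ => ENNReal.div_le_of_le_mul
    (by rw [one_mul]; exact measure_mono inter_subset_right)

lemma measure_inter_ball_le {N : ℕ} (ω : Measure (E N)) [IsLocallyFiniteMeasure ω] (A : Set (E N))
    {R : ℝ} (x : E N) {t : ℝ} (ht : t ∈ Ioc 0 R) :
    ω (A ∩ Metric.ball x t) ≤ centredMax ω A R x * ω (Metric.ball x t) := by
  have h : ω (A ∩ Metric.ball x t) / ω (Metric.ball x t) ≤ centredMax ω A R x :=
    le_iSup₂_of_le (f := fun t (_ : t ∈ Ioc 0 R) =>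
      ω (A ∩ Metric.ball x t) / ω (Metric.ball x t)) t ht le_rfl
  rcases eq_or_ne (ω (Metric.ball x t)) 0 with h0 | h0
  · rw [measure_mono_null inter_subset_right h0]; exact zero_le
  · exact (ENNReal.div_le_iff h0 measure_ball_lt_top.ne).1 h

/-- The strong type estimate of exponent `κ > 1`, stated with a measurable majorant because the
maximal function itself need not be measurable. -/
lemma exists_centredMax_majorant (N : ℕ) {κ : ℝ} (hκ : 1 < κ) :
    ∃ C : ℝ≥0∞, C ≠ ⊤ ∧ ∀ (ω : Measure (E N)) [IsLocallyFiniteMeasure ω] (A : Set (E N)) (R : ℝ),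
      MeasurableSet A → ∃ g : E N → ℝ≥0∞, Measurable g ∧
        (∀ x, centredMax ω A R x ^ κ ≤ g x) ∧ ∫⁻ x, g x ∂ω ≤ C * ω A := by
  obtain ⟨n, hn⟩ := exists_weak_type N
  have hκ0 : 0 < κ := by linarith
  set h : ℝ≥0∞ := 2⁻¹ with hh
  have h0 : h ≠ 0 := by simp [hh]
  have ht : h ≠ ⊤ := by simp [hh]
  refine ⟨∑' k : ℕ, n * 2 * (h ^ (κ - 1)) ^ k, ?_, fun ω _ A R hA => ?_⟩
  · rw [ENNReal.tsum_mul_left, ENNReal.tsum_geometric]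
    refine ENNReal.mul_ne_top (ENNReal.mul_ne_top (ENNReal.natCast_ne_top _) (by simp)) ?_
    rw [ENNReal.inv_ne_top, ne_eq, tsub_eq_zero_iff_le, not_le]
    refine ENNReal.rpow_lt_one ?_ (by linarith)
    simp [hh]
  -- measurable hulls of the superlevel sets, on which the weak type estimate still holds
  set S : ℕ → Set (E N) := fun k => toMeasurable ω
    {x | ∃ t ∈ Ioc 0 R, h ^ (k + 1) * ω (Metric.ball x t) < ω (A ∩ Metric.ball x t)} with hS
  have hSm : ∀ k, MeasurableSet (S k) := fun k => measurableSet_toMeasurable _ _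
  have hfm : ∀ k : ℕ, Measurable ((S k).indicator fun _ => (h ^ k) ^ κ) := fun k =>
    measurable_const.indicator (hSm k)
  refine ⟨fun x => ∑' k : ℕ, (S k).indicator (fun _ => (h ^ k) ^ κ) x, Measurable.tsum hfm,
    fun x => ?_, ?_⟩
  · rcases eq_or_ne (centredMax ω A R x) 0 with hz | hz
    · rw [hz, ENNReal.zero_rpow_of_pos hκ0]; exact zero_le
    -- the dyadic level of the maximal function
    classical
    have hex : ∃ k : ℕ, h ^ (k + 1) < centredMax ω A R x := by
      obtain ⟨k, hk⟩ := ENNReal.exists_inv_two_pow_lt hz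
      exact ⟨k, lt_of_le_of_lt (pow_le_pow_right_of_le_one' (by simp [hh]) (Nat.le_succ k)) hk⟩
    set k := Nat.find hex with hk
    have hk1 := Nat.find_spec hex
    have hk2 : centredMax ω A R x ≤ h ^ k := by
      rcases hk0 : k with _ | j
      · rw [pow_zero]; exact centredMax_le_one _ _ _ _
      · exact not_lt.1 (Nat.find_min hex (by omega : j < Nat.find hex))
    have hxS : x ∈ S k := by
      refine subset_toMeasurable _ _ ?_
      obtain ⟨t, ht⟩ := lt_iSup_iff.1 hk1
      obtain ⟨htR, hlt⟩ := lt_iSup_iff.1 ht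
      exact ⟨t, htR, ENNReal.mul_lt_of_lt_div hlt⟩
    refine le_trans (ENNReal.rpow_le_rpow hk2 hκ0.le) ?_
    refine le_trans (le_of_eq ?_) (ENNReal.le_tsum k)
    rw [indicator_of_mem hxS]
  · rw [lintegral_tsum fun k => (hfm k).aemeasurable, ← ENNReal.tsum_mul_right]
    refine ENNReal.tsum_le_tsum fun k => ?_
    rw [lintegral_indicator_const (hSm k), measure_toMeasurable]
    have hw := hn ω A R (h ^ (k + 1)) hA (ENNReal.pow_ne_top ht)
    calc _ = (h ^ (κ - 1)) ^ k * 2 * (h ^ (k + 1) * ω {x | ∃ t ∈ Ioc 0 R,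
          h ^ (k + 1) * ω (Metric.ball x t) < ω (A ∩ Metric.ball x t)}) := by
          have e1 : (h ^ k) ^ κ = (h ^ (κ - 1)) ^ k * h ^ k := by
            rw [← ENNReal.rpow_natCast, ← ENNReal.rpow_natCast, ← ENNReal.rpow_mul,
              ← ENNReal.rpow_mul, ← ENNReal.rpow_add _ _ h0 ht]
            congr 1; ring
          have e2 : (2 : ℝ≥0∞) * h = 1 := ENNReal.mul_inv_cancel (by simp) (by simp)
          rw [e1, pow_succ]
          calc _ = (h ^ (κ - 1)) ^ k * h ^ k * 1 * ω {x | ∃ t ∈ Ioc 0 R,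
                h ^ k * h * ω (Metric.ball x t) < ω (A ∩ Metric.ball x t)} := by rw [mul_one]
            _ = _ := by rw [← e2]; ring
      _ ≤ (h ^ (κ - 1)) ^ k * 2 * (n * ω A) := by gcongr
      _ = _ := by ring

/-- The power series of `P` starts at order `l`, which bounds its decay when the argument is
multiplied by a small factor. -/
lemma P_rpow_mul_le (l : ℕ) {a β s : ℝ} (ha : 0 < a) (hβ : 0 < β) (hs : 0 < s) {m : ℝ≥0∞}
    (hm : m ≤ 1) (w : ℝ≥0∞) :
    P l a β (m ^ s * w) ≤ m ^ (s * β * l) * P l a β w := by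
  rw [P_eq_tsum l ha hβ, P_eq_tsum l ha hβ, ← ENNReal.tsum_mul_left]
  refine ENNReal.tsum_le_tsum fun n => ?_
  rw [ENNReal.mul_rpow_of_nonneg _ _ (by positivity), ← ENNReal.rpow_mul,
    mul_left_comm (m ^ (s * β * l))]
  refine mul_le_mul_right (mul_le_mul_left (ENNReal.rpow_le_rpow_of_exponent_ge hm ?_) _) _
  rw [← mul_assoc]
  gcongr
  omega

/-- The trace-type inequality: if `P(W[ω]) dx ≤ ω`, then the nonlinear energy of the restriction of
`ω` to any set is bounded by the mass of that set. It follows from the pointwise bound of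
`W[ω|_A]` by `W[ω]` times a power of the centred maximal function. -/
lemma exists_lintegral_P_wolff_restrict_le {N : ℕ} {α p a β R : ℝ} {l : ℕ} (hp : 1 < p)
    (ha : 0 < a) (hβ : 1 ≤ β) (hlβ : p - 1 < l * β) :
    ∃ C : ℝ≥0∞, C ≠ ⊤ ∧ ∀ (ω : Measure (E N)) [IsLocallyFiniteMeasure ω],
      volume.withDensity (fun x => P l a β (wolff α p R ω x)) ≤ ω → ∀ A, MeasurableSet A →
      ∫⁻ x, P l a β (wolff α p R (ω.restrict A) x) ≤ C * ω A := by
  have hp' : 0 < p - 1 := by linarith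
  set s := 1 / (p - 1) with hsd
  have hs : 0 < s := by positivity
  have hβ0 : 0 < β := by linarith
  have hκ : 1 < s * β * l := by
    rw [hsd, mul_assoc, one_div, ← div_eq_inv_mul, lt_div_iff₀ hp']
    linarith
  obtain ⟨C, hC, h⟩ := exists_centredMax_majorant N hκ
  refine ⟨C, hC, fun ω _ hω A hA => ?_⟩
  obtain ⟨g, hg, hmg, hgi⟩ := h ω A R hA
  have hWm : Measurable fun x => P l a β (wolff α p R ω x) :=
    (P_measurable l ha hβ0).comp (measurable_wolff α p R ω)
  have hpt : ∀ x, wolff α p R (ω.restrict A) x ≤ centredMax ω A R x ^ s * wolff α p R ω x := by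
    intro x
    unfold wolff
    rw [← lintegral_const_mul' _ _ (ENNReal.rpow_ne_top_of_nonneg hs.le
      (ne_top_of_le_ne_top ENNReal.one_ne_top (centredMax_le_one ω A R x)))]
    refine setLIntegral_mono' measurableSet_Ioc fun t ht => ?_
    rw [← mul_div_assoc, ← ENNReal.mul_rpow_of_nonneg _ _ hs.le, ← mul_div_assoc,
      Measure.restrict_apply measurableSet_ball, inter_comm]
    gcongr
    exact measure_inter_ball_le ω A x ht
  calc _ ≤ ∫⁻ x, P l a β (wolff α p R ω x) * g x := by
        refine lintegral_mono fun x => ?_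
        refine (P_mono l ha hβ0 (hpt x)).trans ?_
        refine (P_rpow_mul_le l ha hβ0 hs (centredMax_le_one ω A R x) _).trans ?_
        rw [mul_comm]
        exact mul_le_mul_right (hmg x) _
    _ = ∫⁻ x, g x ∂(volume.withDensity fun x => P l a β (wolff α p R ω x)) :=
        (lintegral_withDensity_eq_lintegral_mul _ hWm hg).symm
    _ ≤ ∫⁻ x, g x ∂ω := lintegral_mono' hω le_rfl
    _ ≤ _ := hgi

/-! ### Sums with geometric packing are controlled by maximal functions -/

lemma rpow_add_le_rpow_add_mul {m : ℝ} (hm : 1 < m) {x y : ℝ≥0∞} (hx : x ≠ ⊤) (hy : y ≠ ⊤) :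
    (x + y) ^ m ≤ x ^ m + ENNReal.ofReal m * (y * (x + y) ^ (m - 1)) := by
  lift x to ℝ≥0 using hx
  lift y to ℝ≥0 using hy
  rcases eq_or_ne (x + y) 0 with h | h
  · rw [← ENNReal.coe_add, h, ENNReal.coe_zero, ENNReal.zero_rpow_of_pos (by linarith)]
    exact zero_le
  have hpos : 0 < (x : ℝ) + y := by
    have : 0 < x + y := pos_iff_ne_zero.2 h
    exact_mod_cast this
  have key : ((x : ℝ) + y) ^ m ≤ (x : ℝ) ^ m + m * (y * ((x : ℝ) + y) ^ (m - 1)) := by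
    have hb := one_add_mul_self_le_rpow_one_add (s := -((y : ℝ) / (x + y))) (p := m)
      (by
        rw [neg_le_neg_iff, div_le_one hpos]
        linarith [x.coe_nonneg]) hm.le
    have e : 1 + -((y : ℝ) / (x + y)) = x / (x + y) := by field_simp; ring
    rw [e, Real.div_rpow x.coe_nonneg hpos.le, le_div_iff₀ (by positivity)] at hb
    have e2 : ((x : ℝ) + y) ^ m = ((x : ℝ) + y) ^ (m - 1) * (x + y) := by
      rw [← Real.rpow_add_one hpos.ne', sub_add_cancel]
    have e3 : (1 + m * -((y : ℝ) / (x + y))) * ((x : ℝ) + y) ^ m =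
        ((x : ℝ) + y) ^ m - m * (y * ((x : ℝ) + y) ^ (m - 1)) := by
      rw [add_mul, one_mul]
      nth_rewrite 2 [e2]
      field_simp
      ring
    linarith
  have := ENNReal.ofReal_le_ofReal key
  rw [ENNReal.ofReal_add (by positivity)
    (mul_nonneg (by linarith) (by positivity)), ENNReal.ofReal_mul (by linarith),
    ENNReal.ofReal_mul y.coe_nonneg, ← ENNReal.ofReal_rpow_of_pos hpos,
    ← ENNReal.ofReal_rpow_of_pos hpos, ← ENNReal.ofReal_rpow_of_nonneg x.coe_nonneg (by linarith),
    ENNReal.ofReal_add x.coe_nonneg y.coe_nonneg, ENNReal.ofReal_coe_nnreal,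
    ENNReal.ofReal_coe_nnreal] at this
  exact this

/-- Let `A_n = a_0 + ⋯ + a_{n-1}` and suppose that, against the increments of powers of `A_i`, the
integral of `a_k` decays relatively to that of `a_i`, `i ≤ k`. Then the norm of `A_n` in `L^m` is
bounded by that of any common bound `G` of the `a_k`, with a constant linear in `m`. -/
lemma lintegral_sum_rpow_le_of_packing {Ω : Type*} [MeasurableSpace Ω] (μ : Measure Ω)
    {a : ℕ → Ω → ℝ≥0∞} {G : Ω → ℝ≥0∞} {q : ℕ → ℝ≥0∞} {m : ℝ} (hm : 1 < m)
    (ha : ∀ k, Measurable (a k)) (hat : ∀ k x, a k x ≠ ⊤) (hG : Measurable G)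
    (haG : ∀ k x, a k x ≤ G x) (hq : ∑' k, q k ≠ 0)
    (hpack : ∀ i k, i ≤ k → ∫⁻ x, ((∑ j ∈ Finset.range (i + 1), a j x) ^ (m - 1) -
        (∑ j ∈ Finset.range i, a j x) ^ (m - 1)) * a k x ∂μ ≤
      q (k - i) * ∫⁻ x, ((∑ j ∈ Finset.range (i + 1), a j x) ^ (m - 1) -
        (∑ j ∈ Finset.range i, a j x) ^ (m - 1)) * a i x ∂μ) (n : ℕ) :
    ∫⁻ x, (∑ j ∈ Finset.range n, a j x) ^ m ∂μ ≤
      (ENNReal.ofReal m * ∑' k, q k) ^ m * ∫⁻ x, G x ^ m ∂μ := by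
  set A : ℕ → Ω → ℝ≥0∞ := fun k x => ∑ j ∈ Finset.range k, a j x with hA
  have hm0 : 0 < m := by linarith
  have hAm : ∀ k, Measurable (A k) := fun k => Finset.measurable_fun_sum _ fun j _ => ha j
  have hAt : ∀ k x, A k x ≠ ⊤ := fun k x => ENNReal.sum_ne_top.2 fun j _ => hat j x
  have hAs : ∀ k x, A (k + 1) x = A k x + a k x := fun k x => Finset.sum_range_succ _ _
  set d : ℕ → Ω → ℝ≥0∞ := fun i x => A (i + 1) x ^ (m - 1) - A i x ^ (m - 1) with hd
  have hdm : ∀ i, Measurable (d i) := fun i =>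
    ((hAm (i + 1)).pow_const _).sub ((hAm i).pow_const _)
  have hdam : ∀ k i, Measurable fun x => d i x * a k x := fun k i => (hdm i).mul (ha k)
  have hGdm : ∀ i, Measurable fun x => G x * d i x := fun i => hG.mul (hdm i)
  have hdsum : ∀ k x, ∑ i ∈ Finset.range k, d i x = A k x ^ (m - 1) := by
    intro k x
    induction k with
    | zero => simp [hA, hm]
    | succ k ih =>
      rw [Finset.sum_range_succ, ih]
      refine add_tsub_cancel_of_le (ENNReal.rpow_le_rpow ?_ (by linarith))
      rw [hAs]; exact le_self_add
  have hpow : ∀ k x, A k x ^ m ≤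
      ENNReal.ofReal m * ∑ j ∈ Finset.range k, a j x * A (j + 1) x ^ (m - 1) := by
    intro k x
    induction k with
    | zero => simp [hA, hm0]
    | succ k ih =>
      rw [Finset.sum_range_succ, mul_add, hAs k x]
      exact (rpow_add_le_rpow_add_mul hm (hAt k x) (hat k x)).trans (add_le_add_left ih _)
  set X := ∫⁻ x, A n x ^ m ∂μ with hX
  set Y := ∫⁻ x, G x ^ m ∂μ with hY
  set K := ENNReal.ofReal m * ∑' k, q k with hK
  have hK0 : K ≠ 0 := mul_ne_zero (by simpa using hm0) hq
  rcases eq_or_ne Y ⊤ with hYt | hYt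
  · rw [hYt, ENNReal.mul_top]
    · exact le_top
    · simp [hK0, hm0.le]
  -- finiteness is needed for the division after Hölder's inequality
  have hXt : X ≠ ⊤ := by
    refine ne_top_of_le_ne_top (ENNReal.mul_ne_top (ENNReal.rpow_ne_top_of_nonneg hm0.le
      (ENNReal.natCast_ne_top n)) hYt) ?_
    rw [hY, ← lintegral_const_mul _ (hG.pow_const _)]
    refine lintegral_mono fun x => ?_
    simp only
    rw [← ENNReal.mul_rpow_of_nonneg _ _ hm0.le]
    refine ENNReal.rpow_le_rpow ?_ hm0.le
    calc A n x ≤ ∑ j ∈ Finset.range n, G x := Finset.sum_le_sum fun j _ => haG j x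
      _ = _ := by simp
  -- summation by parts and packing
  have h1 : X ≤ K * ∫⁻ x, G x * A n x ^ (m - 1) ∂μ := by
    calc X ≤ ∫⁻ x, ENNReal.ofReal m *
          ∑ k ∈ Finset.range n, ∑ i ∈ Finset.range (k + 1), d i x * a k x ∂μ := by
          refine lintegral_mono fun x => (hpow n x).trans ?_
          simp_rw [← Finset.sum_mul, hdsum, mul_comm]
          exact le_rfl
      _ = ENNReal.ofReal m * ∑ k ∈ Finset.range n, ∑ i ∈ Finset.range (k + 1),
          ∫⁻ x, d i x * a k x ∂μ := by
          rw [lintegral_const_mul' _ _ ENNReal.ofReal_ne_top, lintegral_finsetSum _ fun k _ =>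
            Finset.measurable_fun_sum _ fun i _ => hdam k i]
          congr 1
          refine Finset.sum_congr rfl fun k _ => ?_
          rw [lintegral_finsetSum _ fun i _ => hdam k i]
      _ ≤ ENNReal.ofReal m * ∑ k ∈ Finset.range n, ∑ i ∈ Finset.range (k + 1),
          q (k - i) * ∫⁻ x, d i x * a i x ∂μ := by
          gcongr with k _ i hi
          exact hpack i k (by have := Finset.mem_range.1 hi; omega)
      _ = ENNReal.ofReal m * ∑ i ∈ Finset.range n, ∑ k ∈ Finset.Ico i n,
          q (k - i) * ∫⁻ x, d i x * a i x ∂μ := by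
          congr 1
          refine Finset.sum_comm' fun k i => ?_
          simp only [Finset.mem_range, Finset.mem_Ico]
          omega
      _ ≤ ENNReal.ofReal m * ∑ i ∈ Finset.range n, (∑' k, q k) * ∫⁻ x, G x * d i x ∂μ := by
          refine mul_le_mul_right (Finset.sum_le_sum fun i _ => ?_) _
          rw [← Finset.sum_mul, Finset.sum_Ico_eq_sum_range]
          refine mul_le_mul' ?_ (lintegral_mono fun x => ?_)
          · simp only [add_tsub_cancel_left]
            exact ENNReal.sum_le_tsum _
          · simp only
            rw [mul_comm]
            exact mul_le_mul_left (haG i x) _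
      _ = _ := by
          rw [← Finset.mul_sum, ← mul_assoc, hK,
            ← lintegral_finsetSum _ fun i _ => hGdm i]
          congr 1
          refine lintegral_congr fun x => ?_
          rw [← Finset.mul_sum, hdsum]
  -- Hölder's inequality
  have hpq : Real.HolderConjugate m (m / (m - 1)) := Real.HolderConjugate.conjExponent hm
  have h2 := ENNReal.lintegral_mul_le_Lp_mul_Lq μ hpq hG.aemeasurable
    ((hAm n).pow_const (m - 1)).aemeasurable
  have hm1 : 0 < m - 1 := by linarith
  simp only [Pi.mul_apply, ← ENNReal.rpow_mul] at h2
  rw [mul_div_cancel₀ _ hm1.ne', ← hX, ← hY] at h2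
  rcases eq_or_ne X 0 with hX0 | hX0
  · rw [hX0]; exact zero_le
  have h3 : X ≤ K * (Y ^ (1 / m) * X ^ (1 / (m / (m - 1)))) := h1.trans (mul_le_mul_right h2 _)
  have hXe : X = X ^ (1 / m) * X ^ (1 / (m / (m - 1))) := by
    rw [← ENNReal.rpow_add _ _ hX0 hXt]
    have : 1 / m + 1 / (m / (m - 1)) = 1 := by field_simp; ring
    rw [this, ENNReal.rpow_one]
  have hXp0 : X ^ (1 / (m / (m - 1))) ≠ 0 := by
    rw [ne_eq, ENNReal.rpow_eq_zero_iff]; simp [hX0, hXt]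
  have hXpt : X ^ (1 / (m / (m - 1))) ≠ ⊤ := ENNReal.rpow_ne_top_of_nonneg (by positivity) hXt
  have h4 : X ^ (1 / m) ≤ K * Y ^ (1 / m) := by
    rw [← mul_assoc] at h3
    nth_rewrite 1 [hXe] at h3
    exact (ENNReal.mul_le_mul_iff_left hXp0 hXpt).1 h3
  calc X = (X ^ (1 / m)) ^ m := by
        rw [← ENNReal.rpow_mul, one_div_mul_cancel hm0.ne', ENNReal.rpow_one]
    _ ≤ (K * Y ^ (1 / m)) ^ m := ENNReal.rpow_le_rpow h4 hm0.le
    _ = _ := by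
        rw [ENNReal.mul_rpow_of_nonneg _ _ hm0.le, ← ENNReal.rpow_mul,
          one_div_mul_cancel hm0.ne', ENNReal.rpow_one]

lemma lintegral_tsum_rpow_le {Ω : Type*} [MeasurableSpace Ω] (μ : Measure Ω)
    {a : ℕ → Ω → ℝ≥0∞} {m : ℝ} (hm : 0 < m) (ha : ∀ k, Measurable (a k)) {B : ℝ≥0∞}
    (h : ∀ n, ∫⁻ x, (∑ j ∈ Finset.range n, a j x) ^ m ∂μ ≤ B) :
    ∫⁻ x, (∑' j, a j x) ^ m ∂μ ≤ B := by
  have e : ∀ x, (∑' j, a j x) ^ m = ⨆ n, (∑ j ∈ Finset.range n, a j x) ^ m := by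
    intro x
    rw [ENNReal.tsum_eq_iSup_nat]
    exact (ENNReal.orderIsoRpow m hm).map_iSup _
  simp_rw [e]
  rw [lintegral_iSup]
  · exact iSup_le h
  · exact fun n => (Finset.measurable_fun_sum _ fun j _ => ha j).pow_const _
  · intro i j hij x
    exact ENNReal.rpow_le_rpow (Finset.sum_le_sum_of_subset (Finset.range_mono hij)) hm.le

/-! ### Dyadic cubes -/

/-- The integer coordinates of the dyadic cube of side `ρ / 2^k` containing `x`. -/
noncomputable def dyadicIndex {N : ℕ} (ρ : ℝ) (k : ℕ) (x : E N) : Fin N → ℤ :=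
  fun i => ⌊2 ^ k * (x i / ρ)⌋

/-- Two integer vectors are adjacent if their coordinates differ by at most one. -/
def Adjacent {N : ℕ} (z w : Fin N → ℤ) : Prop := ∀ i, |z i - w i| ≤ 1

lemma floor_two_mul_div (z : ℝ) : ⌊2 * z⌋ / 2 = ⌊z⌋ := by
  have h1 : 2 * ⌊z⌋ ≤ ⌊2 * z⌋ := by
    rw [Int.le_floor]; push_cast; linarith [Int.floor_le z]
  have h2 : ⌊2 * z⌋ < 2 * ⌊z⌋ + 2 := by
    rw [Int.floor_lt]; push_cast; linarith [Int.lt_floor_add_one z]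
  omega

lemma dyadicIndex_succ {N : ℕ} (ρ : ℝ) (k : ℕ) (x : E N) (i : Fin N) :
    dyadicIndex ρ (k + 1) x i / 2 = dyadicIndex ρ k x i := by
  unfold dyadicIndex
  rw [← floor_two_mul_div (2 ^ k * (x i / ρ)), pow_succ', mul_assoc]

lemma dyadicIndex_eq_of_le {N : ℕ} {ρ : ℝ} {i k : ℕ} (hik : i ≤ k) {x y : E N}
    (h : dyadicIndex ρ k x = dyadicIndex ρ k y) : dyadicIndex ρ i x = dyadicIndex ρ i y := by
  induction k, hik using Nat.le_induction with
  | base => exact h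
  | succ k _ ih =>
    refine ih (funext fun j => ?_)
    rw [← dyadicIndex_succ ρ k x, ← dyadicIndex_succ ρ k y, h]

lemma adjacent_of_le {N : ℕ} {ρ : ℝ} {i k : ℕ} (hik : i ≤ k) {x y : E N}
    (h : Adjacent (dyadicIndex ρ k x) (dyadicIndex ρ k y)) :
    Adjacent (dyadicIndex ρ i x) (dyadicIndex ρ i y) := by
  induction k, hik using Nat.le_induction with
  | base => exact h
  | succ k _ ih =>
    refine ih fun j => ?_
    have := h j
    rw [← dyadicIndex_succ ρ k x, ← dyadicIndex_succ ρ k y]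
    rw [abs_le] at this ⊢
    omega

lemma measurable_dyadicIndex {N : ℕ} (ρ : ℝ) (k : ℕ) :
    Measurable (dyadicIndex ρ k : E N → Fin N → ℤ) := by
  refine measurable_pi_iff.2 fun i => ?_
  unfold dyadicIndex
  exact Int.measurable_floor.comp (by fun_prop)

lemma volume_box {N : ℕ} (a b : Fin N → ℝ) :
    volume {x : E N | ∀ i, x i ∈ Ico (a i) (b i)} = ∏ i, ENNReal.ofReal (b i - a i) := by
  have h := (EuclideanSpace.volume_preserving_symm_measurableEquiv_toLp (Fin N)).symm
  rw [← Real.volume_pi_Ico, ← h.measure_preimage_equiv]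
  congr 1
  ext x
  simp [Set.mem_pi]

lemma dyadicIndex_mem_iff {N : ℕ} {ρ : ℝ} (hρ : 0 < ρ) (k : ℕ) (x : E N) (i : Fin N) (m n : ℤ) :
    (m ≤ dyadicIndex ρ k x i ∧ dyadicIndex ρ k x i < n) ↔
      x i ∈ Ico (m * (ρ / 2 ^ k)) (n * (ρ / 2 ^ k)) := by
  unfold dyadicIndex
  have h2 : (0 : ℝ) < 2 ^ k := by positivity
  have e : 2 ^ k * (x i / ρ) = x i / (ρ / 2 ^ k) := by field_simp
  rw [Int.le_floor, Int.floor_lt, e, le_div_iff₀ (by positivity), div_lt_iff₀ (by positivity),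
    mem_Ico]

lemma volume_dyadicIndex_eq {N : ℕ} {ρ : ℝ} (hρ : 0 < ρ) (k : ℕ) (z : Fin N → ℤ) :
    volume {x : E N | dyadicIndex ρ k x = z} = ENNReal.ofReal (ρ / 2 ^ k) ^ N := by
  have : {x : E N | dyadicIndex ρ k x = z} =
      {x | ∀ i, x i ∈ Ico ((z i : ℝ) * (ρ / 2 ^ k)) ((z i + 1 : ℤ) * (ρ / 2 ^ k))} := by
    ext x
    simp only [mem_ofPred_eq, ← dyadicIndex_mem_iff hρ, funext_iff]
    refine forall_congr' fun i => ?_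
    omega
  rw [this, volume_box]
  have e : ∀ i, ((z i + 1 : ℤ) : ℝ) * (ρ / 2 ^ k) - (z i : ℝ) * (ρ / 2 ^ k) = ρ / 2 ^ k := by
    intro i; push_cast; ring
  simp_rw [e]
  simp

lemma volume_adjacent_le {N : ℕ} {ρ : ℝ} (hρ : 0 < ρ) (k : ℕ) (z : Fin N → ℤ) :
    volume {x : E N | Adjacent (dyadicIndex ρ k x) z} ≤ 3 ^ N * ENNReal.ofReal (ρ / 2 ^ k) ^ N := by
  have : {x : E N | Adjacent (dyadicIndex ρ k x) z} =
      {x | ∀ i, x i ∈ Ico ((z i - 1 : ℤ) * (ρ / 2 ^ k)) ((z i + 2 : ℤ) * (ρ / 2 ^ k))} := by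
    ext x
    simp only [mem_ofPred_eq, ← dyadicIndex_mem_iff hρ, Adjacent, abs_le]
    refine forall_congr' fun i => ?_
    omega
  rw [this, volume_box]
  have e : ∀ i, ((z i + 2 : ℤ) : ℝ) * (ρ / 2 ^ k) - ((z i - 1 : ℤ) : ℝ) * (ρ / 2 ^ k) =
      3 * (ρ / 2 ^ k) := by
    intro i; push_cast; ring
  simp_rw [e]
  simp [ENNReal.ofReal_mul, mul_pow]

lemma measurableSet_adjacent {N : ℕ} (ρ : ℝ) (k : ℕ) :
    MeasurableSet {w : E N × E N | Adjacent (dyadicIndex ρ k w.1) (dyadicIndex ρ k w.2)} := by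
  have h : Measurable fun w : E N × E N => (dyadicIndex ρ k w.1, dyadicIndex ρ k w.2) :=
    ((measurable_dyadicIndex ρ k).comp measurable_fst).prodMk
      ((measurable_dyadicIndex ρ k).comp measurable_snd)
  exact h (t := {v | Adjacent v.1 v.2}) (Set.to_countable _).measurableSet

open Classical in
/-- A function that is constant on the cubes of level `i` puts only a small part of its mass near a
point `y` at a finer level `k`. -/
lemma lintegral_adjacent_le {N : ℕ} {ρ : ℝ} (hρ : 0 < ρ) {i k : ℕ} (hik : i ≤ k) {φ : E N → ℝ≥0∞}
    (hφ : ∀ x x', dyadicIndex ρ i x = dyadicIndex ρ i x' → φ x = φ x') (y : E N) :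
    ∫⁻ x, φ x * (if Adjacent (dyadicIndex ρ k x) (dyadicIndex ρ k y) then 1 else 0) ≤
      3 ^ N * ENNReal.ofReal ((2 ^ N)⁻¹) ^ (k - i) *
        ∫⁻ x, φ x * (if Adjacent (dyadicIndex ρ i x) (dyadicIndex ρ i y) then 1 else 0) := by
  have hU : (univ : Set (E N)) = ⋃ z : Fin N → ℤ, {x | dyadicIndex ρ i x = z} := by
    ext x; simp
  have hms : ∀ z : Fin N → ℤ, MeasurableSet {x : E N | dyadicIndex ρ i x = z} := fun z =>
    measurable_dyadicIndex ρ i (measurableSet_singleton z)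
  have hdis : Pairwise (Function.onFun Disjoint fun z : Fin N → ℤ =>
      {x : E N | dyadicIndex ρ i x = z}) := by
    intro z w hzw
    refine Set.disjoint_left.2 fun x hx hx' => hzw ?_
    exact hx.symm.trans hx'
  have hNm : ∀ j, MeasurableSet {x : E N | Adjacent (dyadicIndex ρ j x) (dyadicIndex ρ j y)} :=
    fun j => (measurable_dyadicIndex ρ j) (t := {v | Adjacent v (dyadicIndex ρ j y)})
      (Set.to_countable _).measurableSet
  have hsum : ∀ F : E N → ℝ≥0∞, ∫⁻ x, F x =
      ∑' z : Fin N → ℤ, ∫⁻ x in {x | dyadicIndex ρ i x = z}, F x := fun F => by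
    rw [← setLIntegral_univ, hU, lintegral_iUnion hms hdis]
  rw [hsum, hsum fun x => φ x * _, ← ENNReal.tsum_mul_left]
  refine ENNReal.tsum_le_tsum fun z => ?_
  rcases ({x : E N | dyadicIndex ρ i x = z}).eq_empty_or_nonempty with he | ⟨x₀, hx₀⟩
  · simp [he]
  have hc : ∀ x ∈ {x : E N | dyadicIndex ρ i x = z}, φ x = φ x₀ := fun x hx =>
    hφ x x₀ (Eq.trans hx (Eq.symm hx₀))
  by_cases hadj : Adjacent z (dyadicIndex ρ i y)
  · have hL : ∫⁻ x in {x : E N | dyadicIndex ρ i x = z},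
        φ x * (if Adjacent (dyadicIndex ρ k x) (dyadicIndex ρ k y) then 1 else 0) ≤
        φ x₀ * (3 ^ N * ENNReal.ofReal (ρ / 2 ^ k) ^ N) := by
      calc _ = ∫⁻ x in {x : E N | dyadicIndex ρ i x = z},
            {x | Adjacent (dyadicIndex ρ k x) (dyadicIndex ρ k y)}.indicator (fun _ => φ x₀) x := by
            refine setLIntegral_congr_fun (hms z) fun x hx => ?_
            simp only [indicator, mem_ofPred_eq]
            rw [hc x hx]; split_ifs <;> simp
        _ ≤ ∫⁻ x, {x : E N | Adjacent (dyadicIndex ρ k x) (dyadicIndex ρ k y)}.indicator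
            (fun _ => φ x₀) x := setLIntegral_le_lintegral _ _
        _ = φ x₀ * volume {x : E N | Adjacent (dyadicIndex ρ k x) (dyadicIndex ρ k y)} :=
            lintegral_indicator_const (hNm k) _
        _ ≤ _ := by gcongr; exact volume_adjacent_le hρ k _
    have hR : ∫⁻ x in {x : E N | dyadicIndex ρ i x = z},
        φ x * (if Adjacent (dyadicIndex ρ i x) (dyadicIndex ρ i y) then 1 else 0) =
        φ x₀ * ENNReal.ofReal (ρ / 2 ^ i) ^ N := by
      rw [← volume_dyadicIndex_eq hρ i z, ← setLIntegral_const]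
      refine setLIntegral_congr_fun (hms z) fun x hx => ?_
      rw [hc x hx, if_pos (by rw [show dyadicIndex ρ i x = z from hx]; exact hadj), mul_one]
    rw [hR]
    refine hL.trans (le_of_eq ?_)
    have e : ENNReal.ofReal (ρ / 2 ^ k) ^ N =
        ENNReal.ofReal ((2 ^ N)⁻¹) ^ (k - i) * ENNReal.ofReal (ρ / 2 ^ i) ^ N := by
      rw [← ENNReal.ofReal_pow (by positivity), ← ENNReal.ofReal_pow (by positivity),
        ← ENNReal.ofReal_pow (by positivity), ← ENNReal.ofReal_mul (by positivity)]
      congr 1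
      obtain ⟨j, rfl⟩ := Nat.exists_eq_add_of_le hik
      rw [add_tsub_cancel_left, div_pow, div_pow, inv_pow, pow_add, mul_pow, ← pow_mul, ← pow_mul,
        ← pow_mul, mul_comm N j]
      field_simp
    rw [e]; ring
  · refine le_trans (le_of_eq ?_) zero_le
    rw [setLIntegral_congr_fun (g := fun _ => 0) (hms z), lintegral_zero]
    intro x hx
    dsimp only
    rw [if_neg, mul_zero]
    intro h
    apply hadj
    rw [← show dyadicIndex ρ i x = z from hx]
    exact adjacent_of_le hik h

/-- The term of level `k` of the dyadic Riesz potential of order `σ`: the mass of the union of the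
cubes adjacent to the cube containing `x`, divided by the side length to the power `N - σ`. -/
noncomputable def dyadicTerm {N : ℕ} (ρ σ : ℝ) (ν : Measure (E N)) (k : ℕ) (x : E N) : ℝ≥0∞ :=
  ENNReal.ofReal ((ρ / 2 ^ k) ^ (σ - N)) *
    ν {y | Adjacent (dyadicIndex ρ k x) (dyadicIndex ρ k y)}

lemma measurable_dyadicTerm {N : ℕ} (ρ σ : ℝ) (ν : Measure (E N)) (k : ℕ) :
    Measurable (dyadicTerm ρ σ ν k) := by
  have h : Measurable fun z : Fin N → ℤ => ENNReal.ofReal ((ρ / 2 ^ k) ^ (σ - N)) *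
    ν {y | Adjacent z (dyadicIndex ρ k y)} := measurable_of_countable _
  exact h.comp (measurable_dyadicIndex ρ k)

lemma dyadicTerm_congr {N : ℕ} {ρ σ : ℝ} {ν : Measure (E N)} {i k : ℕ} (hik : i ≤ k) {x x' : E N}
    (h : dyadicIndex ρ k x = dyadicIndex ρ k x') :
    dyadicTerm ρ σ ν i x = dyadicTerm ρ σ ν i x' := by
  unfold dyadicTerm
  rw [dyadicIndex_eq_of_le hik h]

lemma lintegral_mul_dyadicTerm {N : ℕ} {ρ σ : ℝ} {ν : Measure (E N)} [SFinite ν] (k : ℕ)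
    {φ : E N → ℝ≥0∞} (hφ : Measurable φ) :
    ∫⁻ x, φ x * dyadicTerm ρ σ ν k x = ENNReal.ofReal ((ρ / 2 ^ k) ^ (σ - N)) *
      ∫⁻ y, (∫⁻ x, φ x * ({w : E N × E N | Adjacent (dyadicIndex ρ k w.1)
        (dyadicIndex ρ k w.2)}.indicator 1 (x, y))) ∂ν := by
  have hm : Measurable fun w : E N × E N => φ w.1 * ({w : E N × E N |
      Adjacent (dyadicIndex ρ k w.1) (dyadicIndex ρ k w.2)}.indicator (1 : E N × E N → ℝ≥0∞) w) :=
    (hφ.comp measurable_fst).mul (measurable_one.indicator (measurableSet_adjacent ρ k))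
  rw [lintegral_lintegral_swap (f := fun y x => φ x * ({w : E N × E N |
    Adjacent (dyadicIndex ρ k w.1) (dyadicIndex ρ k w.2)}.indicator 1 (x, y)))
    (hm.comp measurable_swap).aemeasurable,
    ← lintegral_const_mul' _ _ ENNReal.ofReal_ne_top]
  refine lintegral_congr fun x => ?_
  have hs : MeasurableSet {y | Adjacent (dyadicIndex ρ k x) (dyadicIndex ρ k y)} :=
    measurable_prodMk_left (measurableSet_adjacent ρ k)
  have e : ∫⁻ y, φ x * ({w : E N × E N | Adjacent (dyadicIndex ρ k w.1)
        (dyadicIndex ρ k w.2)}.indicator 1 (x, y)) ∂ν =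
      φ x * ν {y | Adjacent (dyadicIndex ρ k x) (dyadicIndex ρ k y)} := by
    have h1 : Measurable fun y => ({w : E N × E N | Adjacent (dyadicIndex ρ k w.1)
        (dyadicIndex ρ k w.2)}.indicator (1 : E N × E N → ℝ≥0∞) (x, y)) :=
      (measurable_one.indicator (measurableSet_adjacent ρ k)).comp measurable_prodMk_left
    rw [lintegral_const_mul _ h1, ← lintegral_indicator_one hs]
    rfl
  rw [e, dyadicTerm]
  ring

lemma lintegral_mul_dyadicTerm_le {N : ℕ} {ρ σ : ℝ} (hρ : 0 < ρ) {ν : Measure (E N)} [SFinite ν]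
    {i k : ℕ} (hik : i ≤ k) {φ : E N → ℝ≥0∞} (hφm : Measurable φ)
    (hφ : ∀ x x', dyadicIndex ρ i x = dyadicIndex ρ i x' → φ x = φ x') :
    ∫⁻ x, φ x * dyadicTerm ρ σ ν k x ≤
      3 ^ N * ENNReal.ofReal (2 ^ (-σ)) ^ (k - i) * ∫⁻ x, φ x * dyadicTerm ρ σ ν i x := by
  classical
  rw [lintegral_mul_dyadicTerm k hφm, lintegral_mul_dyadicTerm i hφm]
  have h : ∀ y, ∫⁻ x, φ x * ({w : E N × E N | Adjacent (dyadicIndex ρ k w.1)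
        (dyadicIndex ρ k w.2)}.indicator 1 (x, y)) ≤
      3 ^ N * ENNReal.ofReal ((2 ^ N)⁻¹) ^ (k - i) *
      ∫⁻ x, φ x * ({w : E N × E N | Adjacent (dyadicIndex ρ i w.1)
        (dyadicIndex ρ i w.2)}.indicator 1 (x, y)) := by
    intro y
    refine le_trans (le_of_eq ?_) ((lintegral_adjacent_le hρ hik hφ y).trans (le_of_eq ?_))
    · refine lintegral_congr fun x => ?_
      simp [indicator]
    · simp [indicator]
  refine (mul_le_mul_right (lintegral_mono (μ := ν) h) _).trans (le_of_eq ?_)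
  rw [lintegral_const_mul' _ _ (ENNReal.mul_ne_top (by simp)
    (ENNReal.pow_ne_top ENNReal.ofReal_ne_top))]
  have e : ENNReal.ofReal ((ρ / 2 ^ k) ^ (σ - N)) * ENNReal.ofReal ((2 ^ N)⁻¹) ^ (k - i) =
      ENNReal.ofReal (2 ^ (-σ)) ^ (k - i) * ENNReal.ofReal ((ρ / 2 ^ i) ^ (σ - N)) := by
    rw [← ENNReal.ofReal_pow (by positivity), ← ENNReal.ofReal_pow (by positivity),
      ← ENNReal.ofReal_mul (by positivity), ← ENNReal.ofReal_mul (by positivity)]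
    congr 1
    obtain ⟨j, rfl⟩ := Nat.exists_eq_add_of_le hik
    have e1 : ρ / 2 ^ (i + j) = ρ / 2 ^ i * ((2 : ℝ) ^ j)⁻¹ := by
      rw [pow_add]; field_simp
    have e2 : (((2 : ℝ) ^ j)⁻¹) ^ (σ - N) = (2 ^ (-σ)) ^ j * 2 ^ (N * j) := by
      rw [← Real.rpow_natCast 2 j, ← Real.rpow_neg (by norm_num), ← Real.rpow_mul (by norm_num),
        ← Real.rpow_natCast (2 ^ (-σ)) j, ← Real.rpow_mul (by norm_num),
        ← Real.rpow_natCast 2 (N * j),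
        ← Real.rpow_add (by norm_num)]
      congr 1; push_cast; ring
    rw [add_tsub_cancel_left, e1, Real.mul_rpow (by positivity) (by positivity), e2, inv_pow,
      ← pow_mul, ← mul_assoc, mul_inv_cancel_right₀ (by positivity), mul_comm]
  generalize (∫⁻ y, (∫⁻ x, φ x * ({w : E N × E N | Adjacent (dyadicIndex ρ i w.1)
        (dyadicIndex ρ i w.2)}.indicator 1 (x, y))) ∂ν) = J
  calc _ = ENNReal.ofReal ((ρ / 2 ^ k) ^ (σ - N)) * ENNReal.ofReal ((2 ^ N)⁻¹) ^ (k - i) *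
        (3 ^ N * J) := by ring
    _ = _ := by rw [e]; ring

/-- A Muckenhoupt–Wheeden inequality for dyadic Riesz potentials: the `L^m` norm of the sum of the
dyadic terms is bounded by that of a common bound `G`, with a constant linear in `m`. -/
lemma lintegral_tsum_dyadicTerm_rpow_le {N : ℕ} {ρ σ m : ℝ} (hρ : 0 < ρ)
    (hm : 1 < m) {ν : Measure (E N)} [IsFiniteMeasure ν] {G : E N → ℝ≥0∞} (hG : Measurable G)
    (h : ∀ k x, dyadicTerm ρ σ ν k x ≤ G x) :
    ∫⁻ x, (∑' k, dyadicTerm ρ σ ν k x) ^ m ≤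
      (ENNReal.ofReal m * (3 ^ N * ∑' k : ℕ, ENNReal.ofReal (2 ^ (-σ)) ^ k)) ^ m *
        ∫⁻ x, G x ^ m := by
  refine lintegral_tsum_rpow_le _ (by linarith) (measurable_dyadicTerm ρ σ ν) fun n => ?_
  rw [← ENNReal.tsum_mul_left]
  refine lintegral_sum_rpow_le_of_packing _ hm (measurable_dyadicTerm ρ σ ν)
    (fun k x => ENNReal.mul_ne_top ENNReal.ofReal_ne_top (measure_ne_top _ _)) hG h ?_ ?_ n
  · intro h0
    have := ENNReal.tsum_eq_zero.1 h0 0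
    simp at this
  · intro i k hik
    refine lintegral_mul_dyadicTerm_le hρ hik ?_ ?_
    · exact ((Finset.measurable_fun_sum _ fun j _ => measurable_dyadicTerm ρ σ ν j).pow_const _).sub
        ((Finset.measurable_fun_sum _ fun j _ => measurable_dyadicTerm ρ σ ν j).pow_const _)
    · intro x x' hxx
      have e : ∀ n ≤ i + 1, ∑ j ∈ Finset.range n, dyadicTerm ρ σ ν j x =
          ∑ j ∈ Finset.range n, dyadicTerm ρ σ ν j x' := fun n hn =>
        Finset.sum_congr rfl fun j hj =>
          dyadicTerm_congr (by have := Finset.mem_range.1 hj; omega) hxx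
      rw [e _ le_rfl, e _ (Nat.le_succ i)]

/-! ### Dyadic Riesz potentials and Wolff potentials -/

/-- The term of radius `ρ / 2^k` in the dyadic form of the Riesz potential of order `σ`. -/
noncomputable def ballTerm {N : ℕ} (ρ σ : ℝ) (ν : Measure (E N)) (k : ℕ) (x : E N) : ℝ≥0∞ :=
  ENNReal.ofReal ((ρ / 2 ^ k) ^ (σ - N)) * ν (Metric.ball x (ρ / 2 ^ k))

/-- A bound for the diameter of the unit cube, with room to spare: the cubes adjacent to the cube
of side `r` containing `x` lie in the ball of centre `x` and radius `r * cubeDiam N`. -/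
noncomputable def cubeDiam (N : ℕ) : ℝ := 2 * √N + 1

lemma one_le_cubeDiam (N : ℕ) : 1 ≤ cubeDiam N := by
  unfold cubeDiam
  have := Real.sqrt_nonneg N
  linarith

lemma floor_lt_floor_add_two {a b : ℝ} (h : a < b + 1) : ⌊a⌋ < ⌊b⌋ + 2 := by
  have h1 := Int.floor_le a
  have h2 := Int.lt_floor_add_one b
  have : (⌊a⌋ : ℝ) < ⌊b⌋ + 2 := by linarith
  exact_mod_cast this

lemma ball_subset_adjacent {N : ℕ} {ρ : ℝ} (hρ : 0 < ρ) (k : ℕ) (x : E N) :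
    Metric.ball x (ρ / 2 ^ k) ⊆ {y | Adjacent (dyadicIndex ρ k x) (dyadicIndex ρ k y)} := by
  intro y hy i
  have h1 : |x i - y i| < ρ / 2 ^ k := by
    have h2 : ‖(x - y) i‖ ≤ ‖x - y‖ := PiLp.norm_apply_le (x - y) i
    rw [Metric.mem_ball, dist_comm, dist_eq_norm] at hy
    exact lt_of_le_of_lt h2 hy
  have h3 : |2 ^ k * (x i / ρ) - 2 ^ k * (y i / ρ)| < 1 := by
    have e : 2 ^ k * (x i / ρ) - 2 ^ k * (y i / ρ) = (x i - y i) / (ρ / 2 ^ k) := by field_simp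
    rw [e, abs_div, abs_of_pos (by positivity : 0 < ρ / 2 ^ k), div_lt_one (by positivity)]
    exact h1
  rw [abs_lt] at h3
  unfold dyadicIndex
  rw [abs_le]
  have c1 := floor_lt_floor_add_two (a := 2 ^ k * (x i / ρ)) (b := 2 ^ k * (y i / ρ)) (by linarith)
  have c2 := floor_lt_floor_add_two (a := 2 ^ k * (y i / ρ)) (b := 2 ^ k * (x i / ρ)) (by linarith)
  constructor <;> linarith

lemma adjacent_subset_ball {N : ℕ} {ρ : ℝ} (hρ : 0 < ρ) (k : ℕ) (x : E N) :
    {y | Adjacent (dyadicIndex ρ k x) (dyadicIndex ρ k y)} ⊆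
      Metric.ball x (cubeDiam N * (ρ / 2 ^ k)) := by
  intro y hy
  have hr : 0 < ρ / 2 ^ k := by positivity
  have h1 : ∀ i, |(y - x) i| ≤ 2 * (ρ / 2 ^ k) := by
    intro i
    have h := hy i
    unfold dyadicIndex at h
    rw [abs_le] at h
    have a1 := Int.floor_le (2 ^ k * (x i / ρ))
    have a2 := Int.lt_floor_add_one (2 ^ k * (x i / ρ))
    have b1 := Int.floor_le (2 ^ k * (y i / ρ))
    have b2 := Int.lt_floor_add_one (2 ^ k * (y i / ρ))
    have c1 : (⌊2 ^ k * (x i / ρ)⌋ : ℝ) ≤ ⌊2 ^ k * (y i / ρ)⌋ + 1 := by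
      have : ⌊2 ^ k * (x i / ρ)⌋ ≤ ⌊2 ^ k * (y i / ρ)⌋ + 1 := by omega
      exact_mod_cast this
    have c2 : (⌊2 ^ k * (y i / ρ)⌋ : ℝ) ≤ ⌊2 ^ k * (x i / ρ)⌋ + 1 := by
      have : ⌊2 ^ k * (y i / ρ)⌋ ≤ ⌊2 ^ k * (x i / ρ)⌋ + 1 := by omega
      exact_mod_cast this
    have e : (y - x) i = (2 ^ k * (y i / ρ) - 2 ^ k * (x i / ρ)) * (ρ / 2 ^ k) := by
      rw [PiLp.sub_apply]; field_simp
    rw [e, abs_mul, abs_of_pos hr]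
    gcongr
    rw [abs_le]
    constructor <;> linarith
  have h2 : ‖y - x‖ ≤ √N * (2 * (ρ / 2 ^ k)) := by
    rw [EuclideanSpace.norm_eq]
    refine Real.sqrt_le_iff.2 ⟨by positivity, ?_⟩
    calc ∑ i, ‖(y - x) i‖ ^ 2 ≤ ∑ _i : Fin N, (2 * (ρ / 2 ^ k)) ^ 2 := by
          gcongr with i
          exact h1 i
      _ = _ := by
          rw [mul_pow (√(N : ℝ)), Real.sq_sqrt (by positivity)]
          simp
  rw [Metric.mem_ball, dist_eq_norm]
  unfold cubeDiam
  nlinarith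

lemma ballTerm_le_dyadicTerm {N : ℕ} {ρ σ : ℝ} (hρ : 0 < ρ) (ν : Measure (E N)) (k : ℕ) (x : E N) :
    ballTerm ρ σ ν k x ≤ dyadicTerm ρ σ ν k x := by
  unfold ballTerm dyadicTerm
  gcongr
  exact ball_subset_adjacent hρ k x

lemma measurable_ballTerm {N : ℕ} (ρ σ : ℝ) (ν : Measure (E N)) [SFinite ν] (k : ℕ) :
    Measurable (ballTerm ρ σ ν k) :=
  (measurable_measure_ball_left ν _).const_mul _

/-- One dyadic scale of the integral defining the Wolff potential already controls the density at
that scale. -/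
lemma le_lintegral_wolff_scale {N : ℕ} {α p t : ℝ} (hp : 1 < p) (hαp : α * p < N) (ht : 0 < t)
    (ν : Measure (E N)) (x : E N) :
    (ν (Metric.ball x t) / ENNReal.ofReal ((2 * t) ^ ((N : ℝ) - α * p))) ^ (1 / (p - 1)) / 2 ≤
      ∫⁻ r in Ioc t (2 * t),
        (ν (Metric.ball x r) / ENNReal.ofReal (r ^ ((N : ℝ) - α * p))) ^ (1 / (p - 1))
          / ENNReal.ofReal r := by
  have hs : 0 ≤ 1 / (p - 1) := by rw [one_div_nonneg]; linarith
  have hN : 0 ≤ (N : ℝ) - α * p := by linarith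
  set X := (ν (Metric.ball x t) / ENNReal.ofReal ((2 * t) ^ ((N : ℝ) - α * p))) ^ (1 / (p - 1))
  calc X / 2 = ∫⁻ r in Ioc t (2 * t), X / ENNReal.ofReal (2 * t) := by
        rw [setLIntegral_const, Real.volume_Ioc, div_eq_mul_inv, div_eq_mul_inv, mul_assoc]
        congr 1
        rw [← ENNReal.ofReal_inv_of_pos (by positivity), ← ENNReal.ofReal_mul (by positivity),
          ← ENNReal.ofReal_ofNat 2, ← ENNReal.ofReal_inv_of_pos (by norm_num)]
        congr 1; field_simp; ring
    _ ≤ _ := by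
        refine setLIntegral_mono' measurableSet_Ioc fun r hr => ?_
        have hr0 : 0 < r := ht.trans hr.1
        refine ENNReal.div_le_div (ENNReal.rpow_le_rpow (ENNReal.div_le_div
          (measure_mono (Metric.ball_subset_ball hr.1.le)) (ENNReal.ofReal_le_ofReal ?_)) hs)
          (ENNReal.ofReal_le_ofReal hr.2)
        exact Real.rpow_le_rpow hr0.le hr.2 hN

lemma measure_ball_le_wolff_rpow {N : ℕ} {α p R t : ℝ} (hp : 1 < p) (hαp : α * p < N)
    (ht : 0 < t) (htR : 2 * t ≤ R) (ν : Measure (E N)) (x : E N) :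
    ENNReal.ofReal (t ^ (α * p - N)) * ν (Metric.ball x t) ≤
      ENNReal.ofReal (2 ^ ((N : ℝ) - α * p + (p - 1))) * wolff α p R ν x ^ (p - 1) := by
  have hp' : 0 < p - 1 := by linarith
  have h1 := (le_lintegral_wolff_scale hp hαp ht ν x).trans
    (lintegral_mono_set (Ioc_subset_Ioc ht.le htR))
  change _ ≤ wolff α p R ν x at h1
  rw [ENNReal.div_le_iff (by simp) (by simp)] at h1
  have h2 := ENNReal.rpow_le_rpow h1 hp'.le
  have hpos : 0 < (2 * t) ^ ((N : ℝ) - α * p) := by positivity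
  rw [← ENNReal.rpow_mul, one_div_mul_cancel hp'.ne', ENNReal.rpow_one,
    ENNReal.div_le_iff (by simpa using hpos) ENNReal.ofReal_ne_top,
    ENNReal.mul_rpow_of_nonneg _ _ hp'.le] at h2
  refine (mul_le_mul_right h2 _).trans (le_of_eq ?_)
  have e : ENNReal.ofReal (t ^ (α * p - N)) * ENNReal.ofReal ((2 * t) ^ ((N : ℝ) - α * p)) *
      2 ^ (p - 1) = ENNReal.ofReal (2 ^ ((N : ℝ) - α * p + (p - 1))) := by
    rw [← ENNReal.ofReal_ofNat 2, ENNReal.ofReal_rpow_of_pos (by norm_num),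
      ← ENNReal.ofReal_mul (by positivity), ← ENNReal.ofReal_mul (by positivity)]
    congr 1
    rw [Real.mul_rpow (by norm_num) ht.le, Real.rpow_add (by norm_num) _ (p - 1)]
    have : t ^ (α * p - N) * t ^ ((N : ℝ) - α * p) = 1 := by
      rw [← Real.rpow_add ht]; simp
    linear_combination (2 ^ ((N : ℝ) - α * p) * 2 ^ (p - 1)) * this
  rw [← e]; ring

lemma dyadicTerm_le_wolff_rpow {N : ℕ} {α p R : ℝ} (hp : 1 < p) (hαp : α * p < N) (hR : 0 < R)
    (ν : Measure (E N)) (k : ℕ) (x : E N) :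
    dyadicTerm (R / (2 * cubeDiam N)) (α * p) ν k x ≤
      ENNReal.ofReal (cubeDiam N ^ ((N : ℝ) - α * p) * 2 ^ ((N : ℝ) - α * p + (p - 1))) *
        wolff α p R ν x ^ (p - 1) := by
  have hc : 0 < cubeDiam N := by linarith [one_le_cubeDiam N]
  set r := R / (2 * cubeDiam N) / 2 ^ k with hr
  have hr0 : 0 < r := by positivity
  have hle : 2 * (cubeDiam N * r) ≤ R := by
    have e : 2 * (cubeDiam N * r) = R / 2 ^ k := by rw [hr]; field_simp
    rw [e]
    exact div_le_self hR.le (one_le_pow₀ (by norm_num))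
  have h1 := measure_ball_le_wolff_rpow hp hαp (by positivity) hle ν x
  rw [ENNReal.ofReal_mul (by positivity), mul_assoc]
  refine le_trans ?_ (mul_le_mul_right h1 _)
  unfold dyadicTerm
  rw [← hr, ← mul_assoc, ← ENNReal.ofReal_mul (by positivity)]
  refine mul_le_mul' (ENNReal.ofReal_le_ofReal (le_of_eq ?_))
    (measure_mono (adjacent_subset_ball (by positivity) k x))
  rw [Real.mul_rpow hc.le hr0.le, ← mul_assoc, ← Real.rpow_add hc]
  simp

/-- The Muckenhoupt–Wheeden inequality for the truncated Riesz potential and the Wolff potential.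
The constant is linear in the exponent `m`, because every density of a ball is at most a multiple
of `W[ν]^(p-1)`, which is therefore a bound for all dyadic terms at once. -/
lemma exists_lintegral_tsum_ballTerm_rpow_le {N : ℕ} {α p R : ℝ} (hp : 1 < p) (hα : 0 < α)
    (hαp : α * p < N) (hR : 0 < R) :
    ∃ C : ℝ≥0∞, C ≠ ⊤ ∧ ∀ (ν : Measure (E N)) [IsFiniteMeasure ν], ∀ m : ℝ, 1 < m →
      ∫⁻ x, (∑' k, ballTerm (R / (2 * cubeDiam N)) (α * p) ν k x) ^ m ≤
        (ENNReal.ofReal m * C) ^ m * ∫⁻ x, wolff α p R ν x ^ ((p - 1) * m) := by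
  have hc : 0 < cubeDiam N := by linarith [one_le_cubeDiam N]
  have hρ : 0 < R / (2 * cubeDiam N) := by positivity
  obtain ⟨c₁, hc₁⟩ : ∃ c : ℝ≥0∞, c = ENNReal.ofReal
    (cubeDiam N ^ ((N : ℝ) - α * p) * 2 ^ ((N : ℝ) - α * p + (p - 1))) := ⟨_, rfl⟩
  obtain ⟨c₂, hc₂d⟩ : ∃ c : ℝ≥0∞, c = 3 ^ N * ∑' k : ℕ, ENNReal.ofReal (2 ^ (-(α * p))) ^ k :=
    ⟨_, rfl⟩
  have hc₁t : c₁ ≠ ⊤ := hc₁ ▸ ENNReal.ofReal_ne_top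
  have hc₂ : c₂ ≠ ⊤ := by
    rw [hc₂d]
    refine ENNReal.mul_ne_top (by simp) ?_
    rw [ENNReal.tsum_geometric, ENNReal.inv_ne_top, ne_eq, tsub_eq_zero_iff_le, not_le,
      ENNReal.ofReal_lt_one]
    exact Real.rpow_lt_one_of_one_lt_of_neg (by norm_num) (by have : 0 < α * p := by positivity
                                                              linarith)
  refine ⟨c₂ * c₁, ENNReal.mul_ne_top hc₂ hc₁t, fun ν _ m hm => ?_⟩
  have hG : Measurable fun x => c₁ * wolff α p R ν x ^ (p - 1) :=
    ((measurable_wolff α p R ν).pow_const _).const_mul _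
  have h := lintegral_tsum_dyadicTerm_rpow_le hρ hm hG
    (fun k x => hc₁ ▸ dyadicTerm_le_wolff_rpow hp hαp hR ν k x)
  rw [← hc₂d] at h
  have hm0 : 0 ≤ m := by linarith
  calc _ ≤ ∫⁻ x, (∑' k, dyadicTerm (R / (2 * cubeDiam N)) (α * p) ν k x) ^ m := by
        gcongr
        exact ballTerm_le_dyadicTerm hρ ν _ _
    _ ≤ _ := h
    _ = _ := by
        simp_rw [ENNReal.mul_rpow_of_nonneg _ _ hm0, ← ENNReal.rpow_mul]
        rw [lintegral_const_mul' _ _ (ENNReal.rpow_ne_top_of_nonneg hm0 hc₁t)]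
        ring

/-- For `p = 2` the Wolff potential is linear in the measure and dominates the truncated Riesz
potential pointwise. -/
lemma tsum_ballTerm_le_wolff_two {N : ℕ} {α R ρ : ℝ} (hαp : α * 2 < N) (hρ : 0 < ρ)
    (hρR : 2 * ρ ≤ R) (ν : Measure (E N)) (x : E N) :
    ∑' k, ballTerm ρ (α * 2) ν k x ≤
      ENNReal.ofReal (2 ^ ((N : ℝ) - α * 2 + 1)) * wolff α 2 R ν x := by
  set r : ℕ → ℝ := fun k => 2 * (ρ / 2 ^ k) with hr
  have hanti : Antitone r := by
    refine antitone_nat_of_succ_le fun k => ?_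
    simp only [hr]
    have : ρ / 2 ^ (k + 1) = ρ / 2 ^ k / 2 := by rw [pow_succ]; field_simp
    have h0 : 0 < ρ / 2 ^ k := by positivity
    rw [this]; linarith
  have hrs : ∀ k, ρ / 2 ^ k = r (k + 1) := by
    intro k; simp only [hr, pow_succ]; field_simp
  have hsub : ⋃ k, Ioc (r (k + 1)) (r k) ⊆ Ioc 0 R := by
    refine iUnion_subset fun k t ht => ⟨?_, ?_⟩
    · refine lt_trans ?_ ht.1
      rw [← hrs]; positivity
    · refine ht.2.trans ((hanti (Nat.zero_le k)).trans ?_)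
      simpa [hr] using hρR
  have hdisj : Pairwise (Function.onFun Disjoint fun k => Ioc (r (k + 1)) (r k)) :=
    hanti.pairwise_disjoint_on_Ioc_succ
  have h1 : ∀ k, ballTerm ρ (α * 2) ν k x ≤ ENNReal.ofReal (2 ^ ((N : ℝ) - α * 2 + 1)) *
      ∫⁻ t in Ioc (r (k + 1)) (r k),
        (ν (Metric.ball x t) / ENNReal.ofReal (t ^ ((N : ℝ) - α * 2))) ^ (1 / ((2 : ℝ) - 1))
          / ENNReal.ofReal t := by
    intro k
    have hk : 0 < ρ / 2 ^ k := by positivity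
    have h2 := le_lintegral_wolff_scale one_lt_two hαp hk ν x
    have e1 : (1 : ℝ) / (2 - 1) = 1 := by norm_num
    rw [← hrs k]
    refine le_trans ?_ (mul_le_mul_right h2 _)
    have hpos : 0 < (2 * (ρ / 2 ^ k)) ^ ((N : ℝ) - α * 2) := by positivity
    rw [e1, ENNReal.rpow_one, ballTerm, div_eq_mul_inv _ (2 : ℝ≥0∞),
      div_eq_mul_inv (ν _),
      ← ENNReal.ofReal_inv_of_pos hpos]
    have e2 : ENNReal.ofReal (2 ^ ((N : ℝ) - α * 2 + 1)) *
        ENNReal.ofReal ((2 * (ρ / 2 ^ k)) ^ ((N : ℝ) - α * 2))⁻¹ * 2⁻¹ =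
        ENNReal.ofReal ((ρ / 2 ^ k) ^ (α * 2 - N)) := by
      rw [← ENNReal.ofReal_ofNat 2, ← ENNReal.ofReal_inv_of_pos (by norm_num),
        ← ENNReal.ofReal_mul (by positivity), ← ENNReal.ofReal_mul (by positivity)]
      congr 1
      rw [Real.mul_rpow (by norm_num) hk.le, Real.rpow_add_one (by norm_num),
        show α * 2 - N = -((N : ℝ) - α * 2) by ring, Real.rpow_neg hk.le, mul_inv]
      have : (0 : ℝ) < 2 ^ ((N : ℝ) - α * 2) := by positivity
      field_simp
    rw [← e2]
    apply le_of_eq; ring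
  calc _ ≤ ∑' k, ENNReal.ofReal (2 ^ ((N : ℝ) - α * 2 + 1)) * ∫⁻ t in Ioc (r (k + 1)) (r k),
        (ν (Metric.ball x t) / ENNReal.ofReal (t ^ ((N : ℝ) - α * 2))) ^ (1 / ((2 : ℝ) - 1))
          / ENNReal.ofReal t := ENNReal.tsum_le_tsum h1
    _ ≤ _ := by
        rw [ENNReal.tsum_mul_left, ← lintegral_iUnion (fun _ => measurableSet_Ioc) hdisj]
        exact mul_le_mul_right (lintegral_mono_set hsub) _

/-! ### Comparison of the Bessel kernel with the truncated Riesz kernel -/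

lemma exp_neg_le_factorial_mul {A : ℝ} (hA : 0 < A) (n : ℕ) :
    Real.exp (-A) ≤ n.factorial * (A⁻¹) ^ n := by
  have h := Real.pow_div_factorial_le_exp A hA.le n
  have hf : (0 : ℝ) < n.factorial := by positivity
  rw [Real.exp_neg, inv_pow, ← div_eq_mul_inv, inv_le_comm₀ (Real.exp_pos _) (by positivity),
    inv_div]
  exact h

lemma besselIntegrand_le {N : ℕ} {σ t : ℝ} (ht : 0 < t) (z : E N) :
    besselIntegrand σ t z ≤ (4 * Real.pi) ^ (-(N : ℝ) / 2) * t ^ ((σ - N) / 2 - 1) := by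
  have hpi := Real.pi_pos
  unfold besselIntegrand
  rw [Real.mul_rpow (by positivity) ht.le]
  have e : t ^ ((σ - N) / 2 - 1) = t ^ (σ / 2 - 1) * t ^ (-(N : ℝ) / 2) := by
    rw [← Real.rpow_add ht]; congr 1; ring
  have h1 : Real.exp (-t) ≤ 1 := Real.exp_le_one_iff.2 (by linarith)
  have h2 : Real.exp (-(1 / (4 * t)) * ‖z‖ ^ 2) ≤ 1 := by
    rw [Real.exp_le_one_iff, neg_mul, neg_nonpos]; positivity
  rw [e]
  calc _ ≤ t ^ (σ / 2 - 1) * 1 *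
        ((4 * Real.pi) ^ (-(N : ℝ) / 2) * t ^ (-(N : ℝ) / 2) * 1) := by gcongr
    _ = _ := by ring

lemma besselIntegrand_le_exp {N : ℕ} {σ t : ℝ} (ht : 0 < t) {z : E N} (hz : z ≠ 0) :
    besselIntegrand σ t z ≤ (4 * Real.pi) ^ (-(N : ℝ) / 2) * N.factorial * 4 ^ N *
      ‖z‖ ^ (-(2 * N : ℝ)) * (Real.exp (-t) * t ^ ((σ + N) / 2 - 1)) := by
  have hpi := Real.pi_pos
  have hz' : 0 < ‖z‖ := norm_pos_iff.2 hz
  unfold besselIntegrand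
  rw [Real.mul_rpow (by positivity) ht.le]
  have e : t ^ ((σ + N) / 2 - 1) = t ^ (σ / 2 - 1) * t ^ (-(N : ℝ) / 2) * t ^ N := by
    rw [← Real.rpow_natCast t N, ← Real.rpow_add ht, ← Real.rpow_add ht]; congr 1; ring
  have h2 : Real.exp (-(1 / (4 * t)) * ‖z‖ ^ 2) ≤
      N.factorial * (4 ^ N * t ^ N * ‖z‖ ^ (-(2 * N : ℝ))) := by
    have h3 := exp_neg_le_factorial_mul (A := 1 / (4 * t) * ‖z‖ ^ 2) (by positivity) N
    rw [← neg_mul] at h3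
    refine h3.trans (le_of_eq ?_)
    have e3 : ‖z‖ ^ (-(2 * N : ℝ)) = ((‖z‖ ^ 2) ^ N)⁻¹ := by
      rw [Real.rpow_neg hz'.le, ← pow_mul, ← Real.rpow_natCast]; push_cast; rfl
    rw [e3, ← mul_pow, mul_inv, inv_div, div_one, mul_pow, inv_pow]
  rw [e]
  calc _ ≤ t ^ (σ / 2 - 1) * Real.exp (-t) *
        ((4 * Real.pi) ^ (-(N : ℝ) / 2) * t ^ (-(N : ℝ) / 2) *
          (N.factorial * (4 ^ N * t ^ N * ‖z‖ ^ (-(2 * N : ℝ))))) := by gcongr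
    _ = _ := by ring

/-- The Bessel kernel decays faster than `|z|^(-N)` at infinity. -/
lemma exists_besselKernel_le_far {N : ℕ} {σ : ℝ} (hσ : 0 < σ) :
    ∃ C : ℝ, 0 ≤ C ∧ ∀ z : E N, z ≠ 0 →
      besselKernel σ z ≤ ENNReal.ofReal (C * ‖z‖ ^ (-(2 * N : ℝ))) := by
  have hpi := Real.pi_pos
  set c := (4 * Real.pi) ^ (-(N : ℝ) / 2) * N.factorial * 4 ^ N with hc
  have hc0 : 0 ≤ c := by positivity
  have hs : 0 < (σ + N) / 2 := by positivity
  have hG := Real.GammaIntegral_convergent hs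
  have hΓ : 0 < Real.Gamma (σ / 2) := Real.Gamma_pos_of_pos (by positivity)
  have hΓ' : 0 < Real.Gamma ((σ + N) / 2) := Real.Gamma_pos_of_pos hs
  refine ⟨(Real.Gamma (σ / 2))⁻¹ * (c * Real.Gamma ((σ + N) / 2)), by positivity,
    fun z hz => ?_⟩
  have hz' : 0 < ‖z‖ := norm_pos_iff.2 hz
  unfold besselKernel
  rw [mul_assoc, ENNReal.ofReal_mul (by positivity)]
  refine mul_le_mul_right ?_ _
  calc _ ≤ ∫⁻ t in Ioi (0 : ℝ), ENNReal.ofReal (c * ‖z‖ ^ (-(2 * N : ℝ))) *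
        ENNReal.ofReal (Real.exp (-t) * t ^ ((σ + N) / 2 - 1)) := by
        refine setLIntegral_mono' measurableSet_Ioi fun t ht => ?_
        rw [← ENNReal.ofReal_mul (by positivity)]
        exact ENNReal.ofReal_le_ofReal (besselIntegrand_le_exp ht hz)
    _ = _ := by
        rw [lintegral_const_mul' _ _ ENNReal.ofReal_ne_top,
          ← ofReal_integral_eq_lintegral_ofReal hG, ← Real.Gamma_eq_integral hs,
          ← ENNReal.ofReal_mul (by positivity)]
        · congr 1; ring
        · filter_upwards [ae_restrict_mem measurableSet_Ioi] with t ht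
          have : 0 < t := ht
          simp only [Pi.zero_apply]
          positivity

/-- The Bessel kernel is bounded by the Riesz kernel. -/
lemma exists_besselKernel_le_near {N : ℕ} {σ : ℝ} (hσ : 0 < σ) (hσN : σ < N) :
    ∃ C : ℝ, 0 ≤ C ∧ ∀ z : E N, z ≠ 0 →
      besselKernel σ z ≤ ENNReal.ofReal (C * ‖z‖ ^ (σ - N)) := by
  have hpi := Real.pi_pos
  set c := (4 * Real.pi) ^ (-(N : ℝ) / 2) with hc
  have hc0 : 0 < c := by positivity
  have hΓ : 0 < Real.Gamma (σ / 2) := Real.Gamma_pos_of_pos (by positivity)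
  have hs : 0 < (σ + N) / 2 := by positivity
  have hd : 0 < ((N : ℝ) - σ) / 2 := by linarith
  refine ⟨(Real.Gamma (σ / 2))⁻¹ * (c * N.factorial * 4 ^ N / ((σ + N) / 2) +
    c / (((N : ℝ) - σ) / 2)), by positivity, fun z hz => ?_⟩
  have hz' : 0 < ‖z‖ := norm_pos_iff.2 hz
  have hz2 : 0 < ‖z‖ ^ 2 := by positivity
  unfold besselKernel
  rw [mul_assoc, ENNReal.ofReal_mul (by positivity)]
  refine mul_le_mul_right ?_ _
  -- the heat kernel changes its behaviour at the time `‖z‖²`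
  rw [← Ioc_union_Ioi_eq_Ioi hz2.le]
  refine (lintegral_union_le _ _ _).trans ?_
  rw [add_mul, ENNReal.ofReal_add (by positivity) (by positivity)]
  refine add_le_add ?_ ?_
  · calc _ ≤ ∫⁻ t in Ioc 0 (‖z‖ ^ 2), ENNReal.ofReal (c * N.factorial * 4 ^ N *
          ‖z‖ ^ (-(2 * N : ℝ))) * ENNReal.ofReal (t ^ ((σ + N) / 2 - 1)) := by
          refine setLIntegral_mono' measurableSet_Ioc fun t ht => ?_
          have ht0 : 0 < t := ht.1
          rw [← ENNReal.ofReal_mul (by positivity)]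
          refine ENNReal.ofReal_le_ofReal ((besselIntegrand_le_exp ht0 hz).trans ?_)
          have h1 : Real.exp (-t) ≤ 1 := Real.exp_le_one_iff.2 (by linarith)
          refine mul_le_mul_of_nonneg_left ?_ (by positivity)
          exact mul_le_of_le_one_left (by positivity) h1
      _ = _ := by
          rw [lintegral_const_mul' _ _ ENNReal.ofReal_ne_top, lintegral_rpow_Ioc hs hz2.le,
            ← ENNReal.ofReal_mul (by positivity)]
          congr 1
          have e1 : (‖z‖ ^ 2) ^ ((σ + N) / 2) = ‖z‖ ^ (σ + N) := by
            rw [← Real.rpow_natCast ‖z‖ 2, ← Real.rpow_mul hz'.le]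
            congr 1; push_cast; ring
          have e2 : ‖z‖ ^ (-(2 * N : ℝ)) * ‖z‖ ^ (σ + N) = ‖z‖ ^ (σ - N) := by
            rw [← Real.rpow_add hz']; congr 1; ring
          rw [e1, ← e2]; ring
  · have hlt : (σ - N) / 2 - 1 < -1 := by linarith
    calc _ ≤ ∫⁻ t in Ioi (‖z‖ ^ 2), ENNReal.ofReal c *
          ENNReal.ofReal (t ^ ((σ - N) / 2 - 1)) := by
          refine setLIntegral_mono' measurableSet_Ioi fun t ht => ?_
          rw [← ENNReal.ofReal_mul (by positivity)]
          exact ENNReal.ofReal_le_ofReal (besselIntegrand_le (hz2.trans ht) z)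
      _ = _ := by
          rw [lintegral_const_mul' _ _ ENNReal.ofReal_ne_top,
            ← ofReal_integral_eq_lintegral_ofReal (integrableOn_Ioi_rpow_of_lt hlt hz2),
            integral_Ioi_rpow_of_lt hlt hz2, ← ENNReal.ofReal_mul (by positivity)]
          · congr 1
            have e1 : (‖z‖ ^ 2) ^ ((σ - N) / 2 - 1 + 1) = ‖z‖ ^ (σ - N) := by
              rw [← Real.rpow_natCast ‖z‖ 2, ← Real.rpow_mul hz'.le]
              congr 1; push_cast; ring
            have e2 : (σ - N) / 2 - 1 + 1 = -(((N : ℝ) - σ) / 2) := by ring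
            rw [e1, e2, neg_div_neg_eq]; ring
          · filter_upwards [ae_restrict_mem measurableSet_Ioi] with t ht
            have : 0 < t := hz2.trans ht
            simp only [Pi.zero_apply]
            positivity

/-- An integrable weight, of order `‖w‖^(-2N)` at infinity, that dominates the tail of the Bessel
kernel. -/
noncomputable def tailWeight {N : ℕ} (w : E N) : ℝ≥0∞ := ENNReal.ofReal ((1 + ‖w‖) ^ (-(2 * N : ℝ)))

lemma measurable_tailWeight {N : ℕ} : Measurable (tailWeight : E N → ℝ≥0∞) := by
  unfold tailWeight; fun_prop

lemma lintegral_tailWeight_lt_top {N : ℕ} (hN : 0 < N) : ∫⁻ w : E N, tailWeight w < ⊤ := by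
  refine finite_integral_one_add_norm (r := 2 * N) ?_
  have : (0 : ℝ) < N := by exact_mod_cast hN
  simp only [finrank_euclideanSpace, Fintype.card_fin]
  linarith

lemma measurable_besselKernel {N : ℕ} (σ : ℝ) : Measurable (besselKernel σ : E N → ℝ≥0∞) := by
  unfold besselKernel
  refine Measurable.const_mul ?_ _
  have h : Measurable fun z : E N × ℝ => ENNReal.ofReal (besselIntegrand σ z.2 z.1) :=
    ((measurable_besselIntegrand σ).comp measurable_swap).ennreal_ofReal
  exact h.lintegral_prod_right'

lemma besselKernel_neg {N : ℕ} (σ : ℝ) (z : E N) : besselKernel σ (-z) = besselKernel σ z := by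
  simp [besselKernel, besselIntegrand]

/-- The Bessel kernel is dominated by the truncated Riesz kernel, plus an average of translates of
the indicator of a ball against an integrable weight. -/
lemma exists_besselKernel_le {N : ℕ} {σ ρ : ℝ} (hσ : 0 < σ) (hσN : σ < N) (hρ : 0 < ρ) :
    ∃ C : ℝ≥0∞, C ≠ ⊤ ∧ ∀ z : E N, besselKernel σ z ≤
      C * (∑' k : ℕ, ENNReal.ofReal ((ρ / 2 ^ k) ^ (σ - N)) *
        (Metric.ball (0 : E N) (ρ / 2 ^ k)).indicator 1 z +
        ∫⁻ w, tailWeight w * (Metric.ball z ρ).indicator 1 w) := by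
  obtain ⟨C₁, hC₁, h₁⟩ := exists_besselKernel_le_near (N := N) hσ hσN
  obtain ⟨C₂, hC₂, h₂⟩ := exists_besselKernel_le_far (N := N) hσ
  have hb : 0 < (1 / ρ + 2) ^ (-(2 * N : ℝ)) * ρ ^ N := by positivity
  set v : ℝ≥0∞ := ENNReal.ofReal ((1 / ρ + 2) ^ (-(2 * N : ℝ)) * ρ ^ N) * unitVol N with hv
  have hv0 : v ≠ 0 := mul_ne_zero (by simpa using hb) (unitVol_pos N).ne'
  have hvt : v ≠ ⊤ := ENNReal.mul_ne_top ENNReal.ofReal_ne_top (unitVol_ne_top N)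
  set D₁ := ENNReal.ofReal (C₁ * 2 ^ ((N : ℝ) - σ)) with hD₁
  set D₂ := ENNReal.ofReal C₂ * v⁻¹ with hD₂
  have hD₂t : D₂ ≠ ⊤ := ENNReal.mul_ne_top ENNReal.ofReal_ne_top (ENNReal.inv_ne_top.2 hv0)
  refine ⟨1 + D₁ + D₂, by simp [hD₂t, hD₁], fun z => ?_⟩
  rw [mul_add]
  rcases eq_or_ne z 0 with rfl | hz
  · have : ∑' k : ℕ, ENNReal.ofReal ((ρ / 2 ^ k) ^ (σ - N)) *
        (Metric.ball (0 : E N) (ρ / 2 ^ k)).indicator (1 : E N → ℝ≥0∞) 0 = ⊤ := by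
      refine top_unique ?_
      have h0 : ENNReal.ofReal (ρ ^ (σ - N)) ≠ 0 := by
        have : 0 < ρ ^ (σ - N) := by positivity
        simpa using this
      rw [← ENNReal.tsum_const_eq_top_of_ne_zero (α := ℕ) h0]
      refine ENNReal.tsum_le_tsum fun k => ?_
      rw [indicator_of_mem (Metric.mem_ball_self (by positivity)), Pi.one_apply, mul_one]
      refine ENNReal.ofReal_le_ofReal (Real.rpow_le_rpow_of_nonpos (by positivity) ?_ (by linarith))
      exact div_le_self hρ.le (one_le_pow₀ (by norm_num))
    rw [this, ENNReal.mul_top (by simp)]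
    simp
  have hz' : 0 < ‖z‖ := norm_pos_iff.2 hz
  rcases lt_or_ge ‖z‖ ρ with hlt | hge
  · refine le_trans ?_ le_self_add
    -- the dyadic scale of `‖z‖`
    classical
    have hex : ∃ k : ℕ, ρ / 2 ^ (k + 1) ≤ ‖z‖ := by
      obtain ⟨k, hk⟩ := exists_pow_lt_of_lt_one (x := ‖z‖ / ρ) (y := (1 / 2 : ℝ)) (by positivity)
        (by norm_num)
      refine ⟨k, ?_⟩
      rw [one_div, inv_pow, lt_div_iff₀ hρ] at hk
      have h3 : ρ / 2 ^ (k + 1) ≤ ρ / 2 ^ k := by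
        gcongr <;> norm_num
      refine h3.trans (le_trans (le_of_eq ?_) hk.le)
      field_simp
    set k := Nat.find hex with hk
    have hk1 : ρ / 2 ^ (k + 1) ≤ ‖z‖ := Nat.find_spec hex
    have hk2 : ‖z‖ < ρ / 2 ^ k := by
      rcases hk0 : k with _ | j
      · simpa using hlt
      · exact not_le.1 (Nat.find_min hex (by omega : j < Nat.find hex))
    have hrk : 0 < ρ / 2 ^ k := by positivity
    refine (h₁ z hz).trans ?_
    refine le_trans ?_ (mul_le_mul_right (ENNReal.le_tsum k) _)
    rw [indicator_of_mem (by simpa using hk2), Pi.one_apply, mul_one]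
    refine le_trans ?_ (mul_le_mul_left (le_add_right (le_add_left le_rfl) : D₁ ≤ _) _)
    rw [hD₁, ← ENNReal.ofReal_mul (by positivity)]
    apply ENNReal.ofReal_le_ofReal
    rw [mul_assoc]
    gcongr
    calc ‖z‖ ^ (σ - N) ≤ (ρ / 2 ^ (k + 1)) ^ (σ - N) :=
          Real.rpow_le_rpow_of_nonpos (by positivity) hk1 (by linarith)
      _ = _ := by
          have e : ρ / 2 ^ (k + 1) = 2⁻¹ * (ρ / 2 ^ k) := by rw [pow_succ]; field_simp
          rw [e, Real.mul_rpow (by norm_num) hrk.le, Real.inv_rpow (by norm_num),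
            ← Real.rpow_neg (by norm_num)]
          congr 2; ring
  · refine le_trans ?_ le_add_self
    refine (h₂ z hz).trans ?_
    have hlow : ENNReal.ofReal (‖z‖ ^ (-(2 * N : ℝ))) * v ≤
        ∫⁻ w, tailWeight w * (Metric.ball z ρ).indicator 1 w := by
      calc _ = ∫⁻ w in Metric.ball z ρ,
            ENNReal.ofReal (((1 / ρ + 2) * ‖z‖) ^ (-(2 * N : ℝ))) := by
            rw [setLIntegral_const, volume_ball_eq z hρ, hv, ← mul_assoc, ← mul_assoc,
              ← ENNReal.ofReal_mul (by positivity), ← ENNReal.ofReal_mul (by positivity)]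
            congr 2
            rw [Real.mul_rpow (by positivity) hz'.le]; ring
        _ ≤ ∫⁻ w in Metric.ball z ρ, tailWeight w := by
            refine setLIntegral_mono' measurableSet_ball fun w hw => ?_
            refine ENNReal.ofReal_le_ofReal (Real.rpow_le_rpow_of_nonpos (by positivity) ?_
              (by have : (0 : ℝ) ≤ N := by positivity
                  linarith))
            have hw' : ‖w‖ ≤ ‖z‖ + ρ := by
              rw [Metric.mem_ball, dist_eq_norm] at hw
              have := norm_add_le (w - z) z
              rw [sub_add_cancel] at this
              linarith
            have h3 : 1 ≤ 1 / ρ * ‖z‖ := by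
              rw [one_div, ← div_eq_inv_mul, one_le_div hρ]; exact hge
            nlinarith
        _ = _ := by
            rw [← lintegral_indicator measurableSet_ball]
            refine lintegral_congr fun w => ?_
            simp only [indicator]
            split_ifs <;> simp
    refine le_trans ?_ (mul_le_mul' (le_add_left le_rfl : D₂ ≤ _) hlow)
    rw [hD₂, ENNReal.ofReal_mul hC₂]
    calc ENNReal.ofReal C₂ * ENNReal.ofReal (‖z‖ ^ (-(2 * N : ℝ)))
        = ENNReal.ofReal C₂ * ENNReal.ofReal (‖z‖ ^ (-(2 * N : ℝ))) * (v⁻¹ * v) := by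
          rw [ENNReal.inv_mul_cancel hv0 hvt, mul_one]
      _ ≤ _ := le_of_eq (by ring)

/-! ### The Wolff inequality for Bessel potentials -/

/-- The Bessel potential `G_σ * ν` of a measure. -/
noncomputable def besselMeasurePotential {N : ℕ} (σ : ℝ) (ν : Measure (E N)) (x : E N) : ℝ≥0∞ :=
  ∫⁻ y, besselKernel σ (x - y) ∂ν

lemma measurable_besselMeasurePotential {N : ℕ} (σ : ℝ) (ν : Measure (E N)) [SFinite ν] :
    Measurable (besselMeasurePotential σ ν) := by
  have h : Measurable fun w : E N × E N => besselKernel σ (w.1 - w.2) :=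
    (measurable_besselKernel σ).comp (measurable_fst.sub measurable_snd)
  exact h.lintegral_prod_right'

/-- The Bessel potential is controlled by the truncated dyadic Riesz potential and its convolution
with the integrable tail weight. -/
lemma exists_besselMeasurePotential_le {N : ℕ} {σ ρ : ℝ} (hσ : 0 < σ) (hσN : σ < N) (hρ : 0 < ρ) :
    ∃ C : ℝ≥0∞, C ≠ ⊤ ∧ ∀ (ν : Measure (E N)) [SFinite ν] (x : E N),
      besselMeasurePotential σ ν x ≤ C * (∑' k, ballTerm ρ σ ν k x +
        ∫⁻ w, tailWeight w * ∑' k, ballTerm ρ σ ν k (x - w)) := by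
  obtain ⟨C, hC, h⟩ := exists_besselKernel_le (N := N) hσ hσN hρ
  set c := ENNReal.ofReal (ρ ^ ((N : ℝ) - σ)) with hc
  refine ⟨C * (1 + c), ENNReal.mul_ne_top hC (by simp [hc]), fun ν _ x => ?_⟩
  have hind : ∀ r : ℝ, Measurable fun y : E N =>
      (Metric.ball (0 : E N) r).indicator (1 : E N → ℝ≥0∞) (x - y) := fun r =>
    (measurable_one.indicator measurableSet_ball).comp (measurable_const.sub measurable_id)
  have hball : ∀ r : ℝ, ∫⁻ y, (Metric.ball (0 : E N) r).indicator (1 : E N → ℝ≥0∞) (x - y) ∂ν =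
      ν (Metric.ball x r) := by
    intro r
    rw [← lintegral_indicator_one measurableSet_ball]
    refine lintegral_congr fun y => ?_
    simp only [indicator, Metric.mem_ball, dist_comm y x, dist_eq_norm,
      Pi.one_apply, sub_zero]
  have hm1 : ∀ k : ℕ, Measurable fun y : E N => ENNReal.ofReal ((ρ / 2 ^ k) ^ (σ - N)) *
      (Metric.ball (0 : E N) (ρ / 2 ^ k)).indicator (1 : E N → ℝ≥0∞) (x - y) :=
    fun k => (hind _).const_mul _
  have hset : MeasurableSet {q : E N × E N | q.2 ∈ Metric.ball (x - q.1) ρ} := by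
    simp only [Metric.mem_ball]
    exact measurableSet_lt (by fun_prop) (by fun_prop)
  have hm3 : ∀ w : E N, Measurable fun y : E N =>
      (Metric.ball (x - y) ρ).indicator (1 : E N → ℝ≥0∞) w := by
    intro w
    have hs : MeasurableSet {y : E N | w ∈ Metric.ball (x - y) ρ} := by
      simp only [Metric.mem_ball]
      exact measurableSet_lt (by fun_prop) (by fun_prop)
    exact (measurable_one (α := ℝ≥0∞)).indicator hs
  have hswap : ∀ w : E N, ∫⁻ y, tailWeight w *
      (Metric.ball (x - y) ρ).indicator (1 : E N → ℝ≥0∞) w ∂ν =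
      tailWeight w * ν (Metric.ball (x - w) ρ) := by
    intro w
    rw [lintegral_const_mul _ (hm3 w), ← lintegral_indicator_one measurableSet_ball]
    congr 1
    refine lintegral_congr fun y => ?_
    have e : w ∈ Metric.ball (x - y) ρ ↔ y ∈ Metric.ball (x - w) ρ := by
      rw [Metric.mem_ball, Metric.mem_ball, dist_eq_norm, dist_eq_norm]
      have : w - (x - y) = y - (x - w) := by abel
      rw [this]
    by_cases hw : w ∈ Metric.ball (x - y) ρ
    · rw [indicator_of_mem hw, indicator_of_mem (e.1 hw)]; rfl
    · rw [indicator_of_notMem hw, indicator_of_notMem (fun h' => hw (e.2 h'))]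
  have hm2 : Measurable fun q : E N × E N =>
      tailWeight q.2 * (Metric.ball (x - q.1) ρ).indicator (1 : E N → ℝ≥0∞) q.2 := by
    refine (measurable_tailWeight.comp measurable_snd).mul ?_
    exact (measurable_one (α := ℝ≥0∞)).indicator hset
  calc besselMeasurePotential σ ν x
      ≤ ∫⁻ y, C * (∑' k : ℕ, ENNReal.ofReal ((ρ / 2 ^ k) ^ (σ - N)) *
        (Metric.ball (0 : E N) (ρ / 2 ^ k)).indicator 1 (x - y) +
        ∫⁻ w, tailWeight w * (Metric.ball (x - y) ρ).indicator 1 w) ∂ν :=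
        lintegral_mono fun y => h (x - y)
    _ = C * (∑' k, ballTerm ρ σ ν k x +
        ∫⁻ w, tailWeight w * ν (Metric.ball (x - w) ρ)) := by
        rw [lintegral_const_mul' _ _ hC, lintegral_add_left (Measurable.tsum hm1),
          lintegral_tsum fun k => (hm1 k).aemeasurable, lintegral_lintegral_swap hm2.aemeasurable]
        congr 2
        · refine tsum_congr fun k => ?_
          rw [lintegral_const_mul' _ _ ENNReal.ofReal_ne_top, hball, ballTerm]
        · exact lintegral_congr hswap
    _ ≤ C * ((1 + c) * ∑' k, ballTerm ρ σ ν k x +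
        (1 + c) * ∫⁻ w, tailWeight w * ∑' k, ballTerm ρ σ ν k (x - w)) := by
        refine mul_le_mul_right (add_le_add ?_ ?_) _
        · exact le_mul_of_one_le_left' le_self_add
        · rw [← lintegral_const_mul' _ _ (by simp [hc])]
          refine lintegral_mono fun w => ?_
          simp only
          rw [mul_left_comm]
          refine mul_le_mul_right ?_ _
          calc ν (Metric.ball (x - w) ρ) = c * ballTerm ρ σ ν 0 (x - w) := by
                rw [ballTerm, pow_zero, div_one, ← mul_assoc, hc,
                  ← ENNReal.ofReal_mul (by positivity), ← Real.rpow_add hρ]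
                simp
            _ ≤ _ := mul_le_mul' le_add_self (ENNReal.le_tsum 0)
    _ = _ := by rw [← mul_add, mul_assoc]

/-- Hölder's inequality against the constant function, for an exponent `m ≥ 1`. -/
lemma lintegral_rpow_le_mul {Ω : Type*} [MeasurableSpace Ω] (μ : Measure Ω) {f : Ω → ℝ≥0∞}
    (hf : AEMeasurable f μ) {m : ℝ} (hm : 1 ≤ m) :
    (∫⁻ x, f x ∂μ) ^ m ≤ μ univ ^ (m - 1) * ∫⁻ x, f x ^ m ∂μ := by
  have hm0 : 0 < m := by linarith
  have h := lintegral_rpow_le_of_le_one μ (hf.pow_const m) (θ := 1 / m) (by positivity)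
    ((div_le_one hm0).2 hm)
  simp_rw [← ENNReal.rpow_mul, mul_one_div_cancel hm0.ne', ENNReal.rpow_one] at h
  refine (ENNReal.rpow_le_rpow h hm0.le).trans (le_of_eq ?_)
  rw [ENNReal.mul_rpow_of_nonneg _ _ hm0.le, ← ENNReal.rpow_mul, ← ENNReal.rpow_mul,
    one_div_mul_cancel hm0.ne', ENNReal.rpow_one, mul_comm]
  congr 2; field_simp

/-- Young's inequality for the convolution with the weight. -/
lemma lintegral_convolution_rpow_le {N : ℕ} {S : E N → ℝ≥0∞} (hS : Measurable S) {m : ℝ}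
    (hm : 1 ≤ m) :
    ∫⁻ x, (∫⁻ w, tailWeight w * S (x - w)) ^ m ≤
      (∫⁻ w : E N, tailWeight w) ^ m * ∫⁻ x, S x ^ m := by
  set lam := (volume : Measure (E N)).withDensity tailWeight with hlam
  have hm0 : 0 < m := by linarith
  have hu : lam univ = ∫⁻ w : E N, tailWeight w := by
    rw [hlam, withDensity_apply _ MeasurableSet.univ, setLIntegral_univ]
  have hSx : ∀ x : E N, Measurable fun w => S (x - w) := fun x =>
    hS.comp (measurable_const.sub measurable_id)
  have hSm : Measurable fun q : E N × E N => S (q.1 - q.2) ^ m :=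
    (hS.comp (measurable_fst.sub measurable_snd)).pow_const _
  have h1 : ∀ x : E N, ∫⁻ w, tailWeight w * S (x - w) = ∫⁻ w, S (x - w) ∂lam := fun x =>
    (lintegral_withDensity_eq_lintegral_mul _ measurable_tailWeight (hSx x)).symm
  calc _ ≤ ∫⁻ x, lam univ ^ (m - 1) * ∫⁻ w, S (x - w) ^ m ∂lam := by
        refine lintegral_mono fun x => ?_
        simp only
        rw [h1]
        exact lintegral_rpow_le_mul lam (hSx x).aemeasurable hm
    _ = lam univ ^ (m - 1) * ∫⁻ w, (∫⁻ x, S (x - w) ^ m) ∂lam := by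
        have hsf : SFinite lam := by rw [hlam]; infer_instance
        rw [lintegral_const_mul _ hSm.lintegral_prod_right',
          lintegral_lintegral_swap hSm.aemeasurable]
    _ = lam univ ^ (m - 1) * (lam univ * ∫⁻ x, S x ^ m) := by
        congr 1
        rw [mul_comm (lam univ), ← lintegral_const]
        refine lintegral_congr fun w => ?_
        exact lintegral_sub_right_eq_self (fun x => S x ^ m) w
    _ = _ := by
        rw [← mul_assoc, hu]
        congr 1
        nth_rewrite 2 [← ENNReal.rpow_one (∫⁻ w : E N, tailWeight w)]
        rw [← ENNReal.rpow_add_of_nonneg _ _ (by linarith) zero_le_one, sub_add_cancel]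

/-- The `L^m` norm of a Bessel potential is bounded by that of the truncated Riesz potential,
uniformly in `m`. -/
lemma exists_lintegral_besselMeasurePotential_rpow_le {N : ℕ} {σ ρ : ℝ} (hσ : 0 < σ) (hσN : σ < N)
    (hρ : 0 < ρ) :
    ∃ C : ℝ≥0∞, C ≠ ⊤ ∧ ∀ (ν : Measure (E N)) [SFinite ν], ∀ m : ℝ, 1 ≤ m →
      ∫⁻ x, besselMeasurePotential σ ν x ^ m ≤
        C ^ m * ∫⁻ x, (∑' k, ballTerm ρ σ ν k x) ^ m := by
  obtain ⟨C, hC, h⟩ := exists_besselMeasurePotential_le (N := N) hσ hσN hρ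
  have hN : 0 < N := by
    have : (0 : ℝ) < N := hσ.trans hσN
    exact_mod_cast this
  set Θ := ∫⁻ w : E N, tailWeight w with hΘ
  have hΘt : Θ ≠ ⊤ := (lintegral_tailWeight_lt_top hN).ne
  refine ⟨C * 2 * (1 + Θ), ENNReal.mul_ne_top (ENNReal.mul_ne_top hC (by simp)) (by simp [hΘt]),
    fun ν _ m hm => ?_⟩
  have hm0 : 0 ≤ m := by linarith
  have hS : Measurable fun x => ∑' k, ballTerm ρ σ ν k x :=
    Measurable.tsum (measurable_ballTerm ρ σ ν)
  calc _ ≤ ∫⁻ x, (C * 2) ^ m * ((∑' k, ballTerm ρ σ ν k x) ^ m +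
        (∫⁻ w, tailWeight w * ∑' k, ballTerm ρ σ ν k (x - w)) ^ m) := by
        refine lintegral_mono fun x => ?_
        refine (ENNReal.rpow_le_rpow (h ν x) hm0).trans ?_
        rw [ENNReal.mul_rpow_of_nonneg _ _ hm0, ENNReal.mul_rpow_of_nonneg _ _ hm0, mul_assoc]
        refine mul_le_mul_right ?_ _
        refine (ENNReal.rpow_add_le_mul_rpow_add_rpow _ _ hm).trans ?_
        gcongr
        · norm_num
        · linarith
    _ = (C * 2) ^ m * ((∫⁻ x, (∑' k, ballTerm ρ σ ν k x) ^ m) +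
        ∫⁻ x, (∫⁻ w, tailWeight w * ∑' k, ballTerm ρ σ ν k (x - w)) ^ m) := by
        rw [lintegral_const_mul' _ _ (ENNReal.rpow_ne_top_of_nonneg hm0
          (ENNReal.mul_ne_top hC (by simp))), lintegral_add_left (hS.pow_const _)]
    _ ≤ (C * 2) ^ m * ((1 + Θ) ^ m * ∫⁻ x, (∑' k, ballTerm ρ σ ν k x) ^ m) := by
        refine mul_le_mul_right ?_ _
        calc _ ≤ (∫⁻ x, (∑' k, ballTerm ρ σ ν k x) ^ m) +
              Θ ^ m * ∫⁻ x, (∑' k, ballTerm ρ σ ν k x) ^ m := by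
              gcongr
              exact lintegral_convolution_rpow_le hS hm
          _ = (1 ^ m + Θ ^ m) * ∫⁻ x, (∑' k, ballTerm ρ σ ν k x) ^ m := by
              rw [ENNReal.one_rpow, add_mul, one_mul]
          _ ≤ _ := by
              gcongr
              exact ENNReal.add_rpow_le_rpow_add _ _ hm
    _ = _ := by
        rw [ENNReal.mul_rpow_of_nonneg (C * 2) _ hm0, mul_assoc]

/-- The Wolff inequality for each term of the series `Q_p`: the coefficient of `Q_p` absorbs the
growth in the exponent of the constant in the Muckenhoupt–Wheeden inequality. -/
lemma exists_qCoeff_mul_lintegral_le {N : ℕ} {α p β R : ℝ} {l : ℕ} (hp : 1 < p) (hα : 0 < α)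
    (hβ : 1 ≤ β) (hR : 0 < R) (hl : 1 ≤ l) (hlβ : p - 1 < l * β) (hαp : α * p < N) :
    ∃ C : ℝ≥0∞, C ≠ ⊤ ∧ ∀ (ν : Measure (E N)) [IsFiniteMeasure ν], ∀ q : ℕ, l ≤ q →
      qCoeff β p q * ∫⁻ x, besselMeasurePotential (α * p) ν x ^ (β / (p - 1) * q) ≤
        C ^ (β / (p - 1) * q) * ((q.factorial : ℝ≥0∞)⁻¹ * ∫⁻ x, wolff α p R ν x ^ (β * q)) := by
  have hp' : 0 < p - 1 := by linarith
  have hσ : 0 < α * p := by positivity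
  have hc := one_le_cubeDiam N
  have hρ : 0 < R / (2 * cubeDiam N) := by positivity
  obtain ⟨C₁, hC₁, h₁⟩ := exists_lintegral_besselMeasurePotential_rpow_le (N := N) hσ hαp hρ
  obtain ⟨C₂, hC₂, h₂⟩ := exists_lintegral_tsum_ballTerm_rpow_le (N := N) hp hα hαp hR
  set κ := β / (p - 1) with hκ
  have hκ0 : 0 < κ := by positivity
  have hm : ∀ q : ℕ, l ≤ q → 1 < κ * q := by
    intro q hq
    have hq' : (l : ℝ) ≤ q := by exact_mod_cast hq
    rw [hκ, div_mul_eq_mul_div, lt_div_iff₀ hp', one_mul]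
    nlinarith
  by_cases h2 : p = 2
  · subst h2
    set c := ENNReal.ofReal (2 ^ ((N : ℝ) - α * 2 + 1)) with hc'
    refine ⟨C₁ * c, ENNReal.mul_ne_top hC₁ ENNReal.ofReal_ne_top, fun ν _ q hq => ?_⟩
    have hmq := hm q hq
    have hm0 : 0 ≤ κ * q := by linarith
    have e : κ * q = β * q := by rw [hκ]; norm_num
    have hρR : 2 * (R / (2 * cubeDiam N)) ≤ R := by
      have e1 : 2 * (R / (2 * cubeDiam N)) = R / cubeDiam N := by field_simp
      rw [e1]; exact div_le_self hR.le hc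
    rw [qCoeff, if_pos rfl, mul_left_comm]
    refine mul_le_mul_right ?_ _
    refine (h₁ ν _ hmq.le).trans ?_
    rw [ENNReal.mul_rpow_of_nonneg _ _ hm0, mul_assoc]
    refine mul_le_mul_right ?_ _
    rw [← lintegral_const_mul' _ _ (ENNReal.rpow_ne_top_of_nonneg hm0 ENNReal.ofReal_ne_top)]
    refine lintegral_mono fun x => ?_
    simp only
    rw [← e, ← ENNReal.mul_rpow_of_nonneg _ _ hm0]
    exact ENNReal.rpow_le_rpow (tsum_ballTerm_le_wolff_two hαp hρ hρR ν x) hm0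
  · refine ⟨C₁ * (ENNReal.ofReal κ * C₂), ENNReal.mul_ne_top hC₁
      (ENNReal.mul_ne_top ENNReal.ofReal_ne_top hC₂), fun ν _ q hq => ?_⟩
    have hmq := hm q hq
    have hm0 : 0 ≤ κ * q := by linarith
    have hq0 : 0 < q := by omega
    have hqr : (0 : ℝ) < q := by exact_mod_cast hq0
    have e1 : (p - 1) * (κ * q) = β * q := by rw [hκ]; field_simp
    have e2 : β * q / (p - 1) = κ * q := by rw [hκ]; ring
    have hqm : ENNReal.ofReal ((q : ℝ) ^ (κ * q)) ≠ 0 := by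
      have : 0 < (q : ℝ) ^ (κ * q) := by positivity
      simpa using this
    have e3 : (ENNReal.ofReal (κ * q) * C₂) ^ (κ * q) =
        (ENNReal.ofReal κ * C₂) ^ (κ * q) * ENNReal.ofReal ((q : ℝ) ^ (κ * q)) := by
      rw [ENNReal.ofReal_mul hκ0.le, mul_right_comm, ENNReal.mul_rpow_of_nonneg _ _ hm0,
        ENNReal.ofReal_rpow_of_pos hqr]
    have hI : ∫⁻ x, besselMeasurePotential (α * p) ν x ^ (κ * q) ≤
        (C₁ * (ENNReal.ofReal κ * C₂)) ^ (κ * q) * ENNReal.ofReal ((q : ℝ) ^ (κ * q)) *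
          ∫⁻ x, wolff α p R ν x ^ (β * q) := by
      refine (h₁ ν _ hmq.le).trans ((mul_le_mul_right (h₂ ν _ hmq) _).trans (le_of_eq ?_))
      rw [e1, e3, ENNReal.mul_rpow_of_nonneg C₁ _ hm0]
      ring
    rw [qCoeff, if_neg h2, e2, ENNReal.mul_inv (Or.inl hqm) (Or.inl ENNReal.ofReal_ne_top)]
    refine (mul_le_mul_right hI _).trans (le_of_eq ?_)
    calc _ = (ENNReal.ofReal ((q : ℝ) ^ (κ * q)))⁻¹ * ENNReal.ofReal ((q : ℝ) ^ (κ * q)) *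
          ((C₁ * (ENNReal.ofReal κ * C₂)) ^ (κ * q) * ((q.factorial : ℝ≥0∞)⁻¹ *
            ∫⁻ x, wolff α p R ν x ^ (β * q))) := by ring
      _ = _ := by rw [ENNReal.inv_mul_cancel hqm ENNReal.ofReal_ne_top, one_mul]

/-! ### Duality between the energy and the capacity -/

lemma qCoeff_ne_zero (β p : ℝ) (q : ℕ) : qCoeff β p q ≠ 0 := by
  unfold qCoeff
  split_ifs
  · exact ENNReal.inv_ne_zero.2 (ENNReal.natCast_ne_top _)
  · exact ENNReal.inv_ne_zero.2
      (ENNReal.mul_ne_top ENNReal.ofReal_ne_top (ENNReal.natCast_ne_top _))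

lemma measurable_qSeries (l : ℕ) (β p : ℝ) : Measurable (qSeries l β p) :=
  Measurable.tsum fun _ => (measurable_id.pow_const _).const_mul _

/-- Young's inequality for `Q_p` and its complementary function. -/
lemma mul_le_Qstar_add_qSeries {l : ℕ} (hl : 1 ≤ l) {β p : ℝ} (hβ : 0 < β) (hp : 1 < p)
    (r s : ℝ≥0∞) : r * s ≤ Qstar l β p r + qSeries l β p s := by
  rcases eq_or_ne s ⊤ with rfl | hs
  · have h : qSeries l β p ⊤ = ⊤ := by
      refine top_unique (le_trans (le_of_eq ?_) (ENNReal.le_tsum 0))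
      have hl' : (0 : ℝ) < ((0 + l : ℕ) : ℝ) := by exact_mod_cast by omega
      have hp' : 0 < p - 1 := by linarith
      rw [ENNReal.top_rpow_of_pos (by positivity), ENNReal.mul_top (qCoeff_ne_zero _ _ _)]
    rw [h, add_top]
    exact le_top
  · lift s to ℝ≥0 using hs
    rw [← Q_eq_qSeries hl hβ hp, ← tsub_le_iff_right]
    exact le_iSup (fun s : ℝ≥0 => r * (s : ℝ≥0∞) - Q l β p s) s

/-- The `Q_p`-energy of a small multiple of the Bessel potential of `ν` is bounded by the integral
of `P(W[ν])`, with a gain from the order at which the series of `Q_p` starts. -/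
lemma exists_lintegral_qSeries_le {N : ℕ} {α p a β R : ℝ} {l : ℕ} (hp : 1 < p) (hα : 0 < α)
    (ha : 0 < a) (hβ : 1 ≤ β) (hR : 0 < R) (hl : 1 ≤ l) (hlβ : p - 1 < l * β)
    (hαp : α * p < N) :
    ∃ c : ℝ, 0 < c ∧ ∀ (ν : Measure (E N)) [IsFiniteMeasure ν], ∀ δ : ℝ, 0 < δ → δ ≤ 1 →
      ∫⁻ x, qSeries l β p (ENNReal.ofReal (c * δ) * besselMeasurePotential (α * p) ν x) ≤
        ENNReal.ofReal (δ ^ (β / (p - 1) * l)) * ∫⁻ x, P l a β (wolff α p R ν x) := by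
  have hp' : 0 < p - 1 := by linarith
  have hβ0 : 0 < β := by linarith
  obtain ⟨C, hC, h⟩ := exists_qCoeff_mul_lintegral_le (N := N) hp hα hβ hR hl hlβ hαp
  set κ := β / (p - 1) with hκ
  have hκ0 : 0 < κ := by positivity
  have hD : 0 < C.toReal + 1 := by positivity
  set c := a ^ (1 / κ) / (C.toReal + 1) with hc
  have hc0 : 0 < c := by positivity
  -- this choice of `c` makes the `q`-th coefficient at most `a ^ q / q!`
  have hcC : (ENNReal.ofReal c * C) ^ κ ≤ ENNReal.ofReal a := by
    rw [← ENNReal.ofReal_toReal hC, ← ENNReal.ofReal_mul hc0.le]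
    calc ENNReal.ofReal (c * C.toReal) ^ κ ≤ ENNReal.ofReal (a ^ (1 / κ)) ^ κ := by
          refine ENNReal.rpow_le_rpow (ENNReal.ofReal_le_ofReal ?_) hκ0.le
          rw [hc, div_mul_eq_mul_div, div_le_iff₀ hD]
          have : 0 < a ^ (1 / κ) := by positivity
          nlinarith
      _ = ENNReal.ofReal a := by
          rw [ENNReal.ofReal_rpow_of_pos (by positivity), ← Real.rpow_mul ha.le,
            one_div_mul_cancel hκ0.ne', Real.rpow_one]
  refine ⟨c, hc0, fun ν _ δ hδ hδ1 => ?_⟩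
  have hG := measurable_besselMeasurePotential (α * p) ν
  have hW : Measurable (wolff α p R ν) := measurable_wolff _ _ _ _
  simp_rw [qSeries, ← hκ, P_eq_tsum l ha hβ0]
  rw [lintegral_tsum fun n => (((hG.const_mul _).pow_const _).const_mul _).aemeasurable,
    lintegral_tsum fun n => ((hW.pow_const _).const_mul _).aemeasurable, ← ENNReal.tsum_mul_left]
  refine ENNReal.tsum_le_tsum fun n => ?_
  have hq : l ≤ n + l := by omega
  set q := n + l with hqd
  have hm : 0 ≤ κ * (q : ℝ) := by positivity
  rw [lintegral_const_mul _ ((hG.const_mul _).pow_const _), lintegral_const_mul _ (hW.pow_const _)]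
  simp_rw [ENNReal.mul_rpow_of_nonneg _ _ hm]
  rw [lintegral_const_mul _ (hG.pow_const _), ENNReal.ofReal_mul hc0.le,
    ENNReal.mul_rpow_of_nonneg _ _ hm]
  calc _ = ENNReal.ofReal δ ^ (κ * (q : ℝ)) * (ENNReal.ofReal c ^ (κ * (q : ℝ)) *
        (qCoeff β p q * ∫⁻ x, besselMeasurePotential (α * p) ν x ^ (κ * (q : ℝ)))) := by ring
    _ ≤ ENNReal.ofReal (δ ^ (κ * l)) * (ENNReal.ofReal c ^ (κ * (q : ℝ)) *
        (C ^ (κ * (q : ℝ)) * ((q.factorial : ℝ≥0∞)⁻¹ * ∫⁻ x, wolff α p R ν x ^ (β * q)))) := by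
        refine mul_le_mul' ?_ (mul_le_mul_right (h ν q hq) _)
        rw [ENNReal.ofReal_rpow_of_pos hδ]
        refine ENNReal.ofReal_le_ofReal (Real.rpow_le_rpow_of_exponent_ge hδ hδ1 ?_)
        gcongr
    _ = ENNReal.ofReal (δ ^ (κ * l)) * (((ENNReal.ofReal c * C) ^ κ) ^ q *
        ((q.factorial : ℝ≥0∞)⁻¹ * ∫⁻ x, wolff α p R ν x ^ (β * q))) := by
        rw [← ENNReal.rpow_natCast, ← ENNReal.rpow_mul, ENNReal.mul_rpow_of_nonneg _ _ hm]
        ring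
    _ ≤ ENNReal.ofReal (δ ^ (κ * l)) * (ENNReal.ofReal a ^ q *
        ((q.factorial : ℝ≥0∞)⁻¹ * ∫⁻ x, wolff α p R ν x ^ (β * q))) := by gcongr
    _ = _ := by rw [div_eq_mul_inv, mul_assoc]

/-- The Bessel potential operator is symmetric. -/
lemma lintegral_besselPotential {N : ℕ} (σ : ℝ) {g : E N → ℝ≥0∞} (hg : AEMeasurable g volume)
    (ν : Measure (E N)) [SFinite ν] :
    ∫⁻ x, besselPotential σ g x ∂ν = ∫⁻ y, g y * besselMeasurePotential σ ν y := by
  have hK : Measurable fun w : E N × E N => besselKernel σ (w.1 - w.2) :=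
    (measurable_besselKernel σ).comp (measurable_fst.sub measurable_snd)
  have hm : Measurable fun w : E N × E N => besselKernel σ (w.1 - w.2) * hg.mk g w.2 :=
    hK.mul (hg.measurable_mk.comp measurable_snd)
  have h1 : ∀ x, besselPotential σ g x = ∫⁻ y, besselKernel σ (x - y) * hg.mk g y := fun x =>
    lintegral_congr_ae (hg.ae_eq_mk.mono fun y hy => by simp only [hy])
  have h2 : ∀ y, ∫⁻ x, besselKernel σ (x - y) * hg.mk g y ∂ν =
      hg.mk g y * besselMeasurePotential σ ν y := by
    intro y
    have hKy : Measurable fun x : E N => besselKernel σ (x - y) :=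
      (measurable_besselKernel σ).comp (measurable_id.sub measurable_const)
    rw [lintegral_mul_const _ hKy, mul_comm, besselMeasurePotential]
    congr 1
    refine lintegral_congr fun x => ?_
    rw [← besselKernel_neg, neg_sub]
  simp_rw [h1]
  rw [lintegral_lintegral_swap hm.aemeasurable]
  simp_rw [h2]
  exact lintegral_congr_ae (hg.ae_eq_mk.mono fun y hy => by simp only [hy])

/-- A locally finite measure that dominates `P(W[ω])` is dominated by the capacity. -/
lemma exists_measure_le_besselCap {N : ℕ} {α p a β R : ℝ} {l : ℕ} (hp : 1 < p) (hα : 0 < α)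
    (ha : 0 < a) (hβ : 1 ≤ β) (hR : 0 < R) (hl : 1 ≤ l) (hlβ : p - 1 < l * β)
    (hαp : α * p < N) :
    ∃ C : ℝ, 0 < C ∧ ∀ (ω : Measure (E N)) [IsLocallyFiniteMeasure ω],
      volume.withDensity (fun x => P l a β (wolff α p R ω x)) ≤ ω →
      ∀ A : Set (E N), MeasurableSet A →
        ω A ≤ ENNReal.ofReal C * besselCap (α * p) (Qstar l β p) A := by
  have hp' : 0 < p - 1 := by linarith
  have hβ0 : 0 < β := by linarith
  obtain ⟨c, hc, henergy⟩ :=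
    exists_lintegral_qSeries_le (N := N) hp hα ha hβ hR hl hlβ hαp
  obtain ⟨C₂, hC₂, hdom⟩ :=
    exists_lintegral_P_wolff_restrict_le (N := N) (α := α) (R := R) hp ha hβ hlβ
  set κ := β / (p - 1) with hκ
  have hκl : 0 < κ * l - 1 := by
    rw [hκ, div_mul_eq_mul_div, sub_pos, lt_div_iff₀ hp']
    linarith
  have hD : 0 < C₂.toReal + 1 := by positivity
  obtain ⟨δ, hδ, hδ1, hδ2⟩ := exists_pos_rpow_le (e₂ := 1) (d₂ := 1) hκl one_pos
    (d₁ := c / (2 * (C₂.toReal + 1))) (by positivity) one_pos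
  rw [Real.rpow_one] at hδ2
  -- the energy is absorbed because `Q_p` starts at an order `κ l > 1`
  have habs : ENNReal.ofReal (δ ^ (κ * l)) * C₂ ≤ ENNReal.ofReal (c * δ / 2) := by
    rw [← ENNReal.ofReal_toReal hC₂, ← ENNReal.ofReal_mul (by positivity)]
    apply ENNReal.ofReal_le_ofReal
    have e : δ ^ (κ * l) = δ ^ (κ * l - 1) * δ := by
      rw [Real.rpow_sub hδ, Real.rpow_one]; field_simp
    rw [le_div_iff₀ (by positivity)] at hδ1
    rw [e]
    have h3 : 0 ≤ δ ^ (κ * l - 1) * δ := by positivity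
    nlinarith [mul_le_mul_of_nonneg_right hδ1 hδ.le]
  have hcδ : 0 < c * δ / 2 := by positivity
  refine ⟨1 / (c * δ / 2), by positivity, fun ω _ hω A hA => ?_⟩
  suffices hmain : ENNReal.ofReal (c * δ / 2) * ω A ≤ besselCap (α * p) (Qstar l β p) A by
    calc ω A = ENNReal.ofReal (1 / (c * δ / 2)) * (ENNReal.ofReal (c * δ / 2) * ω A) := by
          rw [← mul_assoc, ← ENNReal.ofReal_mul (by positivity), one_div_mul_cancel hcδ.ne',
            ENNReal.ofReal_one, one_mul]
      _ ≤ _ := mul_le_mul_right hmain _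
  refine le_iInf fun g => le_iInf fun hg => le_iInf fun hgA => le_iInf fun _ => ?_
  have hpiece : ∀ n : ℕ, ENNReal.ofReal (c * δ / 2) * ω (A ∩ Metric.ball 0 n) ≤
      ∫⁻ x, Qstar l β p (g x) := by
    intro n
    set B := A ∩ Metric.ball (0 : E N) n with hB
    have hBm : MeasurableSet B := hA.inter measurableSet_ball
    have hBt : ω B ≠ ⊤ := ((measure_mono inter_subset_right).trans_lt measure_ball_lt_top).ne
    have hfin : IsFiniteMeasure (ω.restrict B) := ⟨by
      rw [Measure.restrict_apply_univ]; exact hBt.lt_top⟩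
    have hG := measurable_besselMeasurePotential (α * p) (ω.restrict B)
    have h1 : ω B ≤ ∫⁻ x, g x * besselMeasurePotential (α * p) (ω.restrict B) x := by
      rw [← lintegral_besselPotential _ hg, ← setLIntegral_one]
      refine setLIntegral_mono' hBm fun x hx => ?_
      have := hgA x
      rwa [indicator_of_mem hx.1] at this
    have h2 : ENNReal.ofReal (c * δ / 2) * ω B + ENNReal.ofReal (c * δ / 2) * ω B ≤
        (∫⁻ x, Qstar l β p (g x)) + ENNReal.ofReal (c * δ / 2) * ω B := by
      calc _ = ENNReal.ofReal (c * δ) * ω B := by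
            rw [← add_mul, ← ENNReal.ofReal_add hcδ.le hcδ.le, add_halves]
        _ ≤ ∫⁻ x, ENNReal.ofReal (c * δ) *
              (g x * besselMeasurePotential (α * p) (ω.restrict B) x) := by
            rw [lintegral_const_mul' _ _ ENNReal.ofReal_ne_top]
            gcongr
        _ ≤ ∫⁻ x, (Qstar l β p (g x) + qSeries l β p
              (ENNReal.ofReal (c * δ) * besselMeasurePotential (α * p) (ω.restrict B) x)) := by
            refine lintegral_mono fun x => ?_
            simp only
            rw [mul_left_comm]
            exact mul_le_Qstar_add_qSeries hl hβ0 hp _ _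
        _ = (∫⁻ x, Qstar l β p (g x)) + ∫⁻ x, qSeries l β p
              (ENNReal.ofReal (c * δ) * besselMeasurePotential (α * p) (ω.restrict B) x) :=
            lintegral_add_right _ ((measurable_qSeries l β p).comp (hG.const_mul _))
        _ ≤ _ := by
            gcongr
            refine (henergy _ δ hδ hδ2).trans ((mul_le_mul_right (hdom ω hω B hBm) _).trans ?_)
            rw [← mul_assoc]
            gcongr
    exact (ENNReal.add_le_add_iff_right (ENNReal.mul_ne_top ENNReal.ofReal_ne_top hBt)).1 h2
  have hmono : Monotone fun n : ℕ => A ∩ Metric.ball (0 : E N) n := fun m n hmn =>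
    inter_subset_inter_right _ (Metric.ball_subset_ball (by exact_mod_cast hmn))
  have hA' : A = ⋃ n : ℕ, A ∩ Metric.ball (0 : E N) n := by
    rw [← inter_iUnion, Metric.iUnion_ball_nat, inter_univ]
  rw [hA', hmono.measure_iUnion, ENNReal.mul_iSup]
  exact iSup_le hpiece

/-- The measure `P(u) + μ` of a solution is dominated by the capacity. -/
lemma exists_withDensity_add_le_besselCap {N : ℕ} {α p a β R : ℝ} {l : ℕ} (hp : 1 < p)
    (hα : 0 < α) (ha : 0 < a) (hβ : 1 ≤ β) (hR : 0 < R) (hl : 1 ≤ l) (hlβ : p - 1 < l * β)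
    (hαp : α * p < N) :
    ∃ C : ℝ, 0 < C ∧ ∀ (f : E N → ℝ≥0∞) (μ : Measure (E N)) [IsLocallyFiniteMeasure μ],
      ∀ u : E N → ℝ≥0∞, IsSolution α p a β R l μ f u → ∀ A : Set (E N), MeasurableSet A →
        (∫⁻ x in A, P l a β (u x)) + μ A ≤
          ENNReal.ofReal C * besselCap (α * p) (Qstar l β p) A := by
  have hβ0 : 0 < β := by linarith
  obtain ⟨C, hC, h⟩ := exists_measure_le_besselCap (N := N) hp hα ha hβ hR hl hlβ hαp
  refine ⟨C, hC, fun f μ _ u hu A hA => ?_⟩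
  have hlf := hu.locInt.isLocallyFiniteMeasure
  have hle : volume.withDensity (fun x => P l a β (wolff α p R
      (volume.withDensity (fun y => P l a β (u y)) + μ) x)) ≤
      volume.withDensity (fun y => P l a β (u y)) + μ := by
    refine le_trans (withDensity_mono (Filter.Eventually.of_forall fun x => ?_))
      (Measure.le_add_right le_rfl)
    refine P_mono l ha hβ0 ?_
    rw [hu.eq x]
    exact le_self_add
  have := h _ hle A hA
  rwa [Measure.add_apply, withDensity_apply _ hA] at this

end WolffEq


open WolffEq in
theorem theorem1p5 (N : ℕ) (α p a β R : ℝ) (l : ℕ)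
    (hα : 0 < α) (hp : 1 < p) (ha : 0 < a) (hR : 0 < R) (hl : 1 ≤ l) (hβ : 1 ≤ β)
    (hlβ : p - 1 < l * β) (hαp : α * p < N) :
    ∃ C : ℝ, 0 < C ∧
      -- necessary condition for solvability, without any smallness assumption
      (∀ (f : E N → ℝ≥0∞) (μ : Measure (E N)) [IsLocallyFiniteMeasure μ],
        AEMeasurable f volume →
        ∀ u : E N → ℝ≥0∞, IsSolution α p a β R l μ f u →
          ∀ A : Set (E N), MeasurableSet A →
            (∫⁻ x in A, P l a β (u x)) + (∫⁻ x in A, P l a β (f x)) + μ A ≤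
              ENNReal.ofReal C * besselCap (α * p) (Qstar l β p) A) ∧
      -- existence for small data
      (∀ ε : ℝ, 0 < ε → ∃ M : ℝ, 0 < M ∧
        ∀ (f : E N → ℝ≥0∞) (μ μ₁ : Measure (E N)) [IsLocallyFiniteMeasure μ],
          AEMeasurable f volume →
          LocInt (fun x => P l (a + ε) β (f x)) →
          μ₁ = volume.withDensity (fun x => P l (a + ε) β (f x)) →
          supNorm (fracMax (etaExp p β) (α * p) R μ) ≤ ENNReal.ofReal M →
          supNorm (fracMax (etaExp p β) (α * p) R μ₁) ≤ ENNReal.ofReal M →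
          (∃ u : E N → ℝ≥0∞, IsSolution α p a β R l μ f u ∧
            (∀ x, u x ≤ majorant α p β R M μ μ₁ f x) ∧
            LocInt (fun x => P l a β (majorant α p β R M μ μ₁ f x))) ∧
          -- for such data the bound holds with `a + ε` in the term containing `f`
          (∀ u : E N → ℝ≥0∞, IsSolution α p a β R l μ f u →
            ∀ A : Set (E N), MeasurableSet A →
              (∫⁻ x in A, P l a β (u x)) + (∫⁻ x in A, P l (a + ε) β (f x)) + μ A ≤
                ENNReal.ofReal C * besselCap (α * p) (Qstar l β p) A)) := by
  have hβ0 : 0 < β := by linarith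
  obtain ⟨C, hC, hcap⟩ :=
    exists_withDensity_add_le_besselCap (N := N) hp hα ha hβ hR hl hlβ hαp
  have h2C : ENNReal.ofReal (2 * C) = ENNReal.ofReal C + ENNReal.ofReal C := by
    rw [two_mul, ENNReal.ofReal_add hC.le hC.le]
  refine ⟨2 * C, by positivity, fun f μ _ _ u hu A hA => ?_, fun ε hε => ?_⟩
  · have hfu : ∫⁻ x in A, P l a β (f x) ≤ ∫⁻ x in A, P l a β (u x) := by
      refine lintegral_mono fun x => P_mono l ha hβ0 ?_
      rw [hu.eq x]
      exact le_add_self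
    rw [h2C, add_mul, add_right_comm]
    exact add_le_add (hcap f μ u hu A hA)
      ((hfu.trans le_self_add).trans (hcap f μ u hu A hA))
  · obtain ⟨M, hM, hex⟩ :=
      exists_isSolution_of_small (N := N) hp hα ha hβ hR hlβ hαp hε
    refine ⟨M, hM, fun f μ μ₁ _ hf hP hμ₁ hμM hμ₁M =>
      ⟨hex f μ μ₁ hf hP hμ₁ hμM hμ₁M, fun u hu A hA => ?_⟩⟩
    have hlf : IsLocallyFiniteMeasure μ₁ := by
      rw [hμ₁]; exact hP.isLocallyFiniteMeasure
    have hP0 : (fun _ : E N => P l (a + ε) β 0) = 0 :=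
      funext fun _ => P_zero hl (by positivity) hβ0
    have hM0 : fracMax (etaExp p β) (α * p) R (0 : Measure (E N)) = fun _ => 0 := by
      ext x; simp [fracMax]
    -- the equation with datum `μ₁` in place of `μ` and without `f` is solvable as well
    obtain ⟨v, hv, -⟩ := hex (fun _ => 0) μ₁ 0 aemeasurable_const
      ⟨by rw [hP0]; exact aemeasurable_const, fun K _ => by
        simp [P_zero hl (add_pos ha hε) hβ0]⟩
      (by rw [hP0, withDensity_zero]) hμ₁M (by rw [supNorm, hM0]; simp)
    have hfA : ∫⁻ x in A, P l (a + ε) β (f x) = μ₁ A := by rw [hμ₁, withDensity_apply _ hA]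
    rw [h2C, add_mul, add_right_comm, hfA]
    exact add_le_add (hcap f μ u hu A hA) (le_add_self.trans (hcap _ μ₁ v hv A hA))
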